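/- Let $U\subseteq\mathbb R^4$ be open, let $\mu_1,\dots,\mu_4:U\to(0,\infty)$ be smooth, $g=\sum_i\mu_i^2\,dx_i^2$, and $\nu_i=\ln\mu_i$. Write $\nu_{i,j}=\partial\nu_i/\partial x_j$ and $\nu_{i,jk}=\partial^2\nu_i/\partial x_j\partial x_k$. The Stäckel system on $U$ is $$\nu_{i,j}\nu_{j,k}+\nu_{i,k}\nu_{k,j}-\nu_{i,j}\nu_{i,k}=0,\qquad \nu_{i,jk}=0,\qquad \nu_{i,ij}+2\nu_{i,j}\nu_{j,i}=0$$ for all pairwise distinct $i,j,k\in\{1,2,3,4\}$. Consider the following ten kinds of metrics, where all functions of one variable are smooth on the set of values that their argument takes on the domain, the stated inequalities hold at all these values, and all $\mu_i$ are positive: * $I_1$: $\mu_1^2=1$, $\mu_2^2=\eta(x_1)$, $\mu_3^2=\eta(x_1)\psi(x_2)$, $\mu_4^2=\eta(x_1)\phi(x_2)$, with $\eta'\neq0$. * $I_2$: $\mu_1^2=1$, $\mu_2^2=\phi(x_1)|\xi(x_2)-\zeta(x_3)||\xi(x_2)-\eta(x_4)|$, $\mu_3^2=\phi(x_1)|\zeta(x_3)-\xi(x_2)||\zeta(x_3)-\eta(x_4)|$,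 $\mu_4^2=\phi(x_1)|\eta(x_4)-\xi(x_2)||\eta(x_4)-\zeta(x_3)|$, with $\zeta'\neq0$, $\eta'\neq0$. * $I_3$: $\mu_1^2=\eta(x_1)$, $\mu_2^2=x_1\xi(x_2)$, $\mu_3^2=\mu_4^2=x_1x_2(\phi(x_3)+\psi(x_4))$. * $I_4$: $\mu_1^2=\mu_2^2=\phi(x_1)+\psi(x_2)$, $\mu_3^2=\mu_4^2=\xi(x_3)+\eta(x_4)$. * $I_5$: $\mu_1^2=\mu_2^2=\xi(x_1)-\eta(x_2)$, $\mu_3^2=\mu_4^2=\xi(x_1)\eta(x_2)(\psi(x_3)+\phi(x_4))$, with $\xi'\neq0$, $\eta'\neq0$. * $I_6$: $\mu_1^2=\phi(x_1)$, $\mu_2^2=\psi(x_1)$, $\mu_3^2=\mu_4^2=x_1(\xi(x_3)+\eta(x_4))$, with $\phi>0$, $\psi>0$. * $I_7$: $\mu_1^2=1$, $\mu_2^2=\phi(x_1)$, $\mu_3^2=\psi(x_1)$, $\mu_4^2=\eta(x_1)$. * $I_8$: $\mu_i^2=\phi_i(x_i)\prod_{j\neq i}|x_i-x_j|$ for $i=1,2,3,4$.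 * $I_9$: $\mu_1^2=x_2x_3x_4$, $\mu_i^2=\phi_i(x_i)|x_i-x_j||x_i-x_k|$ for $\{i,j,k\}=\{2,3,4\}$. * $I_{10}$: $\mu_1^2=|x_3-b||x_4-b|$, $\mu_2^2=|x_3x_4|$, $\mu_i^2=\phi_i(x_i)|x_i-x_j|$ for $\{i,j\}=\{3,4\}$, where $b\in\mathbb R$ is a constant. Then (a) if $g$ is of one of the kinds $I_1$–$I_{10}$ on $U$, the Stäckel system holds on $U$; and (b) the Stäckel system holds on $U$ if and only if there is an open dense subset $V$ of $U$ such that every point of $V$ has an open neighbourhood $W\subseteq U$ on which $g$ becomes a metric of one of the kinds $I_1$–$I_{10}$ after a change of coordinates $x'_{\sigma(i)}=y_i(x_i)$ mapping $W$ bijectively onto an open set, with $\sigma$ a permutation of $\{1,2,3,4\}$ and $y_i$ smooth with $y_i'\neq0$. -/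

import Mathlib

open scoped ContDiff

/-- The partial derivative `∂f/∂x_j` of a function on `ℝ⁴`. Coordinates are numbered `0, 1, 2, 3`. -/
noncomputable def pderiv (j : Fin 4) (f : (Fin 4 → ℝ) → ℝ) : (Fin 4 → ℝ) → ℝ :=
  fun x => fderiv ℝ f x (Pi.single j 1)

/-- `g = ∑ i, (μ i)² (dx i)²` is a smooth diagonal Riemannian metric on `U`, with smooth and
strictly positive coefficients `μ i`. -/
structure IsDiagonalMetric (U : Set (Fin 4 → ℝ)) (μ : Fin 4 → (Fin 4 → ℝ) → ℝ) : Prop where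
  smooth : ∀ i, ContDiffOn ℝ ∞ (μ i) U
  pos : ∀ i, ∀ x ∈ U, 0 < μ i x

/-- The functions `ν_i = ln μ_i`. -/
noncomputable def logCoeff (μ : Fin 4 → (Fin 4 → ℝ) → ℝ) (i : Fin 4) : (Fin 4 → ℝ) → ℝ :=
  fun x => Real.log (μ i x)

/-- The Stäckel system on `U` for the functions `ν_i = ln μ_i`. -/
structure StackelSystem (U : Set (Fin 4 → ℝ)) (μ : Fin 4 → (Fin 4 → ℝ) → ℝ) : Prop where
  /-- `ν_{i,j} ν_{j,k} + ν_{i,k} ν_{k,j} - ν_{i,j} ν_{i,k} = 0` -/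
  first : ∀ x ∈ U, ∀ i j k : Fin 4, i ≠ j → i ≠ k → j ≠ k →
    pderiv j (logCoeff μ i) x * pderiv k (logCoeff μ j) x
      + pderiv k (logCoeff μ i) x * pderiv j (logCoeff μ k) x
      - pderiv j (logCoeff μ i) x * pderiv k (logCoeff μ i) x = 0
  /-- `ν_{i,jk} = 0` -/
  second : ∀ x ∈ U, ∀ i j k : Fin 4, i ≠ j → i ≠ k → j ≠ k →
    pderiv k (pderiv j (logCoeff μ i)) x = 0
  /-- `ν_{i,ij} + 2 ν_{i,j} ν_{j,i} = 0` -/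
  third : ∀ x ∈ U, ∀ i j : Fin 4, i ≠ j →
    pderiv j (pderiv i (logCoeff μ i)) x
      + 2 * pderiv j (logCoeff μ i) x * pderiv i (logCoeff μ j) x = 0

/-- The one-variable function `f` is smooth on the set of values of the `i`-th coordinate on `U`. -/
def SmoothInCoord (U : Set (Fin 4 → ℝ)) (i : Fin 4) (f : ℝ → ℝ) : Prop :=
  ContDiffOn ℝ ∞ f ((fun x : Fin 4 → ℝ => x i) '' U)

/-- Metrics of kind `I₁`. -/
def KindOne (U : Set (Fin 4 → ℝ)) (μ : Fin 4 → (Fin 4 → ℝ) → ℝ) : Prop :=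
  ∃ η ψ φ : ℝ → ℝ,
    SmoothInCoord U 0 η ∧ SmoothInCoord U 1 ψ ∧ SmoothInCoord U 1 φ ∧
    (∀ x ∈ U, deriv η (x 0) ≠ 0) ∧
    ∀ x ∈ U,
      μ 0 x ^ 2 = 1 ∧
      μ 1 x ^ 2 = η (x 0) ∧
      μ 2 x ^ 2 = η (x 0) * ψ (x 1) ∧
      μ 3 x ^ 2 = η (x 0) * φ (x 1)

/-- Metrics of kind `I₂`. -/
def KindTwo (U : Set (Fin 4 → ℝ)) (μ : Fin 4 → (Fin 4 → ℝ) → ℝ) : Prop :=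
  ∃ φ ξ ζ η : ℝ → ℝ,
    SmoothInCoord U 0 φ ∧ SmoothInCoord U 1 ξ ∧ SmoothInCoord U 2 ζ ∧ SmoothInCoord U 3 η ∧
    (∀ x ∈ U, deriv ζ (x 2) ≠ 0) ∧ (∀ x ∈ U, deriv η (x 3) ≠ 0) ∧
    ∀ x ∈ U,
      μ 0 x ^ 2 = 1 ∧
      μ 1 x ^ 2 = φ (x 0) * |ξ (x 1) - ζ (x 2)| * |ξ (x 1) - η (x 3)| ∧
      μ 2 x ^ 2 = φ (x 0) * |ζ (x 2) - ξ (x 1)| * |ζ (x 2) - η (x 3)| ∧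
      μ 3 x ^ 2 = φ (x 0) * |η (x 3) - ξ (x 1)| * |η (x 3) - ζ (x 2)|

/-- Metrics of kind `I₃`. -/
def KindThree (U : Set (Fin 4 → ℝ)) (μ : Fin 4 → (Fin 4 → ℝ) → ℝ) : Prop :=
  ∃ η ξ φ ψ : ℝ → ℝ,
    SmoothInCoord U 0 η ∧ SmoothInCoord U 1 ξ ∧ SmoothInCoord U 2 φ ∧ SmoothInCoord U 3 ψ ∧
    ∀ x ∈ U,
      μ 0 x ^ 2 = η (x 0) ∧
      μ 1 x ^ 2 = x 0 * ξ (x 1) ∧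
      μ 2 x ^ 2 = x 0 * x 1 * (φ (x 2) + ψ (x 3)) ∧
      μ 3 x ^ 2 = x 0 * x 1 * (φ (x 2) + ψ (x 3))

/-- Metrics of kind `I₄`. -/
def KindFour (U : Set (Fin 4 → ℝ)) (μ : Fin 4 → (Fin 4 → ℝ) → ℝ) : Prop :=
  ∃ φ ψ ξ η : ℝ → ℝ,
    SmoothInCoord U 0 φ ∧ SmoothInCoord U 1 ψ ∧ SmoothInCoord U 2 ξ ∧ SmoothInCoord U 3 η ∧
    ∀ x ∈ U,
      μ 0 x ^ 2 = φ (x 0) + ψ (x 1) ∧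
      μ 1 x ^ 2 = φ (x 0) + ψ (x 1) ∧
      μ 2 x ^ 2 = ξ (x 2) + η (x 3) ∧
      μ 3 x ^ 2 = ξ (x 2) + η (x 3)

/-- Metrics of kind `I₅`. -/
def KindFive (U : Set (Fin 4 → ℝ)) (μ : Fin 4 → (Fin 4 → ℝ) → ℝ) : Prop :=
  ∃ ξ η ψ φ : ℝ → ℝ,
    SmoothInCoord U 0 ξ ∧ SmoothInCoord U 1 η ∧ SmoothInCoord U 2 ψ ∧ SmoothInCoord U 3 φ ∧
    (∀ x ∈ U, deriv ξ (x 0) ≠ 0) ∧ (∀ x ∈ U, deriv η (x 1) ≠ 0) ∧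
    ∀ x ∈ U,
      μ 0 x ^ 2 = ξ (x 0) - η (x 1) ∧
      μ 1 x ^ 2 = ξ (x 0) - η (x 1) ∧
      μ 2 x ^ 2 = ξ (x 0) * η (x 1) * (ψ (x 2) + φ (x 3)) ∧
      μ 3 x ^ 2 = ξ (x 0) * η (x 1) * (ψ (x 2) + φ (x 3))

/-- Metrics of kind `I₆`. -/
def KindSix (U : Set (Fin 4 → ℝ)) (μ : Fin 4 → (Fin 4 → ℝ) → ℝ) : Prop :=
  ∃ φ ψ ξ η : ℝ → ℝ,
    SmoothInCoord U 0 φ ∧ SmoothInCoord U 0 ψ ∧ SmoothInCoord U 2 ξ ∧ SmoothInCoord U 3 η ∧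
    (∀ x ∈ U, 0 < φ (x 0)) ∧ (∀ x ∈ U, 0 < ψ (x 0)) ∧
    ∀ x ∈ U,
      μ 0 x ^ 2 = φ (x 0) ∧
      μ 1 x ^ 2 = ψ (x 0) ∧
      μ 2 x ^ 2 = x 0 * (ξ (x 2) + η (x 3)) ∧
      μ 3 x ^ 2 = x 0 * (ξ (x 2) + η (x 3))

/-- Metrics of kind `I₇`. -/
def KindSeven (U : Set (Fin 4 → ℝ)) (μ : Fin 4 → (Fin 4 → ℝ) → ℝ) : Prop :=
  ∃ φ ψ η : ℝ → ℝ,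
    SmoothInCoord U 0 φ ∧ SmoothInCoord U 0 ψ ∧ SmoothInCoord U 0 η ∧
    ∀ x ∈ U,
      μ 0 x ^ 2 = 1 ∧
      μ 1 x ^ 2 = φ (x 0) ∧
      μ 2 x ^ 2 = ψ (x 0) ∧
      μ 3 x ^ 2 = η (x 0)

/-- Metrics of kind `I₈`. -/
def KindEight (U : Set (Fin 4 → ℝ)) (μ : Fin 4 → (Fin 4 → ℝ) → ℝ) : Prop :=
  ∃ φ : Fin 4 → ℝ → ℝ,
    (∀ i, SmoothInCoord U i (φ i)) ∧
    ∀ x ∈ U, ∀ i, μ i x ^ 2 = φ i (x i) * ∏ j ∈ Finset.univ.erase i, |x i - x j|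

/-- Metrics of kind `I₉`. -/
def KindNine (U : Set (Fin 4 → ℝ)) (μ : Fin 4 → (Fin 4 → ℝ) → ℝ) : Prop :=
  ∃ φ₁ φ₂ φ₃ : ℝ → ℝ,
    SmoothInCoord U 1 φ₁ ∧ SmoothInCoord U 2 φ₂ ∧ SmoothInCoord U 3 φ₃ ∧
    ∀ x ∈ U,
      μ 0 x ^ 2 = x 1 * x 2 * x 3 ∧
      μ 1 x ^ 2 = φ₁ (x 1) * |x 1 - x 2| * |x 1 - x 3| ∧
      μ 2 x ^ 2 = φ₂ (x 2) * |x 2 - x 1| * |x 2 - x 3| ∧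
      μ 3 x ^ 2 = φ₃ (x 3) * |x 3 - x 1| * |x 3 - x 2|

/-- Metrics of kind `I₁₀`. -/
def KindTen (U : Set (Fin 4 → ℝ)) (μ : Fin 4 → (Fin 4 → ℝ) → ℝ) : Prop :=
  ∃ (b : ℝ) (φ₂ φ₃ : ℝ → ℝ),
    SmoothInCoord U 2 φ₂ ∧ SmoothInCoord U 3 φ₃ ∧
    ∀ x ∈ U,
      μ 0 x ^ 2 = |x 2 - b| * |x 3 - b| ∧
      μ 1 x ^ 2 = |x 2 * x 3| ∧
      μ 2 x ^ 2 = φ₂ (x 2) * |x 2 - x 3| ∧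
      μ 3 x ^ 2 = φ₃ (x 3) * |x 3 - x 2|

/-- The metric is, in the given coordinates, of one of the ten kinds. -/
def IsOfListedKind (U : Set (Fin 4 → ℝ)) (μ : Fin 4 → (Fin 4 → ℝ) → ℝ) : Prop :=
  KindOne U μ ∨ KindTwo U μ ∨ KindThree U μ ∨ KindFour U μ ∨ KindFive U μ ∨
  KindSix U μ ∨ KindSeven U μ ∨ KindEight U μ ∨ KindNine U μ ∨ KindTen U μ

/-- The map `x ↦ x'` with `x'_{σ i} = y_i (x_i)`: every coordinate is replaced by a function of
itself, and the coordinates are renumbered by `σ`. -/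
def coordMap (σ : Equiv.Perm (Fin 4)) (y : Fin 4 → ℝ → ℝ) (x : Fin 4 → ℝ) : Fin 4 → ℝ :=
  fun m => y (σ.symm m) (x (σ.symm m))

/-- The diagonal metric `μ` on `W` becomes the diagonal metric `μ'` on `W'` under a smooth change
of coordinates `x'_{σ i} = y_i (x_i)` with nowhere vanishing `y_i'`, that is,
`∑ i, (μ i)² (dx i)²` is the pull-back of `∑ m, (μ' m)² (dx' m)²`. -/
def IsCoordChange (W : Set (Fin 4 → ℝ)) (μ : Fin 4 → (Fin 4 → ℝ) → ℝ)
    (W' : Set (Fin 4 → ℝ)) (μ' : Fin 4 → (Fin 4 → ℝ) → ℝ) : Prop :=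
  ∃ (σ : Equiv.Perm (Fin 4)) (y : Fin 4 → ℝ → ℝ),
    (∀ i, SmoothInCoord W i (y i)) ∧
    (∀ i, ∀ x ∈ W, deriv (y i) (x i) ≠ 0) ∧
    Set.BijOn (coordMap σ y) W W' ∧
    ∀ x ∈ W, ∀ i, μ i x = |deriv (y i) (x i)| * μ' (σ i) (coordMap σ y x)

/-- Near the point `p` of `U` the metric is of one of the ten kinds, up to a change of
coordinates. -/
def IsLocallyOfListedKind (U : Set (Fin 4 → ℝ)) (μ : Fin 4 → (Fin 4 → ℝ) → ℝ)
    (p : Fin 4 → ℝ) : Prop :=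
  ∃ W : Set (Fin 4 → ℝ), IsOpen W ∧ p ∈ W ∧ W ⊆ U ∧
    ∃ (W' : Set (Fin 4 → ℝ)) (μ' : Fin 4 → (Fin 4 → ℝ) → ℝ),
      IsOpen W' ∧ IsDiagonalMetric W' μ' ∧ IsCoordChange W μ W' μ' ∧ IsOfListedKind W' μ'

/-! ### Smoothness in single coordinates and partial derivatives. -/

open Function

/-! Everything passes through separable forms: up to sign, μ_i² is H_i(x_i) times the product over j
≠ i of symmetric factors S_ij = u_ij(x_i) + u_ji(x_j). For such a form ν_{i,j} = u_ji'(x_j) / (2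
S_ij). Hence the second and third families of equations hold automatically, and the first becomes
the algebraic relation `IsCompatible`. Each of the ten kinds is a compatible separable form, this
property pulls back along the admissible coordinate changes, and the equations extend by continuity
from a dense subset. This gives (a) and the "if" half of (b).

For the converse, work on a box around p. The equations ν_{i,jk} = 0 split ν_i into functions of the
pairs (x_i, x_j). On each coordinate plane the third family says that a suitable exponential has
zero mixed derivative, so it is a sum of two functions of one variable (`exp_eq_add_of_planar`).
This yields a compatible separable form with S_ij = 1 at p (`StackelSystem.exists_normalForm`).

On a dense open set every ν_{i,j} is locally either identically zero or nowhere zero. Say that i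
depends on j if x_j enters μ_i. At p, compatibility has the shape ac + bd = ab, which makes
dependence transitive and makes any two coordinates entering the same μ_i comparable. A finite check
(`listedPattern_of_forest_aux`) shows that such a forest of dependences is, after renumbering, one
of ten patterns.

Within a pattern the factors are rigid. If x_k enters μ_i but not μ_r, then u_rk = u_ri
(`NormalForm.eq_of_dep`). If x_j and x_k enter each other's coefficients and also μ_i, the three
factors are constant multiples of differences of functions X_i, X_j, X_k of one variable each
(`NormalForm.exists_affine`, `NormalForm.exists_triple`); `NormalForm.exists_quadruple` makes these
functions agree across four indices. New coordinates are either built from these functions or chosen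
by solving (y')² = h to absorb a remaining one-variable factor, and the metric takes the form of the
corresponding kind. -/

theorem SmoothInCoord.isOpen_image {U : Set (Fin 4 → ℝ)} (hU : IsOpen U) (i : Fin 4) :
    IsOpen ((fun x : Fin 4 → ℝ => x i) '' U) :=
  isOpenMap_eval i U hU

theorem SmoothInCoord.contDiffAt {U : Set (Fin 4 → ℝ)} (hU : IsOpen U) {i : Fin 4} {f : ℝ → ℝ}
    (h : SmoothInCoord U i f) {x : Fin 4 → ℝ} (hx : x ∈ U) : ContDiffAt ℝ ∞ f (x i) :=
  ContDiffOn.contDiffAt h ((isOpen_image hU i).mem_nhds ⟨x, hx, rfl⟩)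

theorem SmoothInCoord.hasDerivAt {U : Set (Fin 4 → ℝ)} (hU : IsOpen U) {i : Fin 4} {f : ℝ → ℝ}
    (h : SmoothInCoord U i f) {x : Fin 4 → ℝ} (hx : x ∈ U) :
    HasDerivAt f (deriv f (x i)) (x i) :=
  ((h.contDiffAt hU hx).differentiableAt (by simp)).hasDerivAt

theorem contDiffOn_pderiv {U : Set (Fin 4 → ℝ)} (hU : IsOpen U) {f : (Fin 4 → ℝ) → ℝ}
    (hf : ContDiffOn ℝ ∞ f U) (j : Fin 4) : ContDiffOn ℝ ∞ (pderiv j f) U := by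
  have h := hf.fderiv_of_isOpen hU (m := ∞) (by simp)
  exact h.clm_apply contDiffOn_const

theorem hasDerivAt_pderiv_update {f : (Fin 4 → ℝ) → ℝ} {x : Fin 4 → ℝ} (j : Fin 4) {s : ℝ}
    (hf : DifferentiableAt ℝ f (update x j s)) :
    HasDerivAt (fun r => f (update x j r)) (pderiv j f (update x j s)) s :=
  hf.hasFDerivAt.comp_hasDerivAt s (hasDerivAt_update x j s)

/-- Reduces a partial derivative to a one-variable derivative along the coordinate line through the
point, where a formula valid near `x j` suffices. -/
theorem pderiv_eq_of_hasDerivAt {f : (Fin 4 → ℝ) → ℝ} {x : Fin 4 → ℝ} {j : Fin 4} {c : ℝ}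
    (hf : DifferentiableAt ℝ f x)
    (h : HasDerivAt (fun r => f (update x j r)) c (x j)) : pderiv j f x = c := by
  have := hasDerivAt_pderiv_update (x := x) j (s := x j) (f := f) (by simpa using hf)
  simpa using this.unique h

theorem pderiv_comm {U : Set (Fin 4 → ℝ)} (hU : IsOpen U) {f : (Fin 4 → ℝ) → ℝ}
    (hf : ContDiffOn ℝ ∞ f U) {x : Fin 4 → ℝ} (hx : x ∈ U) (i j : Fin 4) :
    pderiv i (pderiv j f) x = pderiv j (pderiv i f) x := by
  have hfx : ContDiffAt ℝ ∞ f x := hf.contDiffAt (hU.mem_nhds hx)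
  have hs : IsSymmSndFDerivAt ℝ f x := hfx.isSymmSndFDerivAt (by
    rw [minSmoothness_of_isRCLikeNormedField]
    exact WithTop.coe_le_coe.2 (le_top : (2 : ℕ∞) ≤ ⊤))
  have hd : DifferentiableAt ℝ (fderiv ℝ f) x :=
    (hfx.fderiv_right (m := ∞) (by simp)).differentiableAt (by simp)
  have key : ∀ a b : Fin 4, pderiv a (pderiv b f) x
      = fderiv ℝ (fderiv ℝ f) x (Pi.single a 1) (Pi.single b 1) := by
    intro a b
    unfold pderiv
    rw [fderiv_clm_apply hd (differentiableAt_const _)]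
    simp
  rw [key, key]
  exact hs _ _

theorem eventually_update_mem {U : Set (Fin 4 → ℝ)} (hU : IsOpen U) {x : Fin 4 → ℝ} (hx : x ∈ U)
    (j : Fin 4) : ∀ᶠ s in nhds (x j), update x j s ∈ U := by
  have hc : ContinuousAt (fun s => update x j s) (x j) := by fun_prop
  exact hc.preimage_mem_nhds (by simpa using hU.mem_nhds hx)

theorem contDiffOn_logCoeff {U : Set (Fin 4 → ℝ)} {μ : Fin 4 → (Fin 4 → ℝ) → ℝ}
    (hμ : IsDiagonalMetric U μ) (i : Fin 4) : ContDiffOn ℝ ∞ (logCoeff μ i) U :=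
  (hμ.smooth i).log fun x hx => (hμ.pos i x hx).ne'

/-! ### Separable forms and their Stäckel equations. -/

/-- A function of the two coordinates `x_i` and `x_j`, the sum of functions of each of them. -/
def sepFactor (u : Fin 4 → Fin 4 → ℝ → ℝ) (i j : Fin 4) (x : Fin 4 → ℝ) : ℝ :=
  u i j (x i) + u j i (x j)

theorem sepFactor_comm (u : Fin 4 → Fin 4 → ℝ → ℝ) (i j : Fin 4) (x : Fin 4 → ℝ) :
    sepFactor u i j x = sepFactor u j i x := add_comm _ _

/-- The squares of the coefficients are, up to a factor that depends on `x_i` only, products of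
symmetric factors `u_ij(x_i) + u_ji(x_j)`. -/
structure HasSeparableForm (U : Set (Fin 4 → ℝ)) (μ : Fin 4 → (Fin 4 → ℝ) → ℝ)
    (u : Fin 4 → Fin 4 → ℝ → ℝ) (H : Fin 4 → ℝ → ℝ) : Prop where
  smooth_u : ∀ i j, SmoothInCoord U i (u i j)
  smooth_H : ∀ i, SmoothInCoord U i (H i)
  sq : ∀ x ∈ U, ∀ i, μ i x ^ 2 = |H i (x i) * ∏ j ∈ Finset.univ.erase i, sepFactor u i j x|

/-- The algebraic condition on a separable form that is equivalent to the Stäckel system. -/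
def IsCompatible (U : Set (Fin 4 → ℝ)) (u : Fin 4 → Fin 4 → ℝ → ℝ) : Prop :=
  ∀ x ∈ U, ∀ i j k : Fin 4, i ≠ j → i ≠ k → j ≠ k →
    deriv (u j i) (x j) * deriv (u k j) (x k) * sepFactor u i k x
      + deriv (u k i) (x k) * deriv (u j k) (x j) * sepFactor u i j x
      = deriv (u j i) (x j) * deriv (u k i) (x k) * sepFactor u j k x

namespace HasSeparableForm

variable {U : Set (Fin 4 → ℝ)} {μ : Fin 4 → (Fin 4 → ℝ) → ℝ} {u : Fin 4 → Fin 4 → ℝ → ℝ}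
  {H : Fin 4 → ℝ → ℝ}

theorem coeff_ne_zero (h : HasSeparableForm U μ u H) (hμ : IsDiagonalMetric U μ)
    {x : Fin 4 → ℝ} (hx : x ∈ U) (i : Fin 4) : H i (x i) ≠ 0 := by
  have h1 := h.sq x hx i
  have h2 : μ i x ^ 2 ≠ 0 := pow_ne_zero _ (hμ.pos i x hx).ne'
  intro h0
  rw [h0, zero_mul, abs_zero] at h1
  exact h2 h1

theorem sepFactor_ne_zero (h : HasSeparableForm U μ u H) (hμ : IsDiagonalMetric U μ)
    {x : Fin 4 → ℝ} (hx : x ∈ U) {i j : Fin 4} (hij : i ≠ j) : sepFactor u i j x ≠ 0 := by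
  have h1 := h.sq x hx i
  have h2 : μ i x ^ 2 ≠ 0 := pow_ne_zero _ (hμ.pos i x hx).ne'
  intro h0
  have : ∏ j ∈ Finset.univ.erase i, sepFactor u i j x = 0 :=
    Finset.prod_eq_zero (i := j) (by simp [hij.symm]) h0
  rw [this, mul_zero, abs_zero] at h1
  exact h2 h1

theorem logCoeff_eq (h : HasSeparableForm U μ u H) (hμ : IsDiagonalMetric U μ)
    {x : Fin 4 → ℝ} (hx : x ∈ U) (i : Fin 4) :
    logCoeff μ i x = (Real.log (H i (x i)) +
      ∑ j ∈ Finset.univ.erase i, Real.log (sepFactor u i j x)) / 2 := by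
  have h1 := congrArg Real.log (h.sq x hx i)
  -- `Real.log` ignores signs, so the absolute value disappears and the factors only have to be
  -- nonzero.
  rw [Real.log_pow, Real.log_abs, Real.log_mul (h.coeff_ne_zero hμ hx i), Real.log_prod] at h1
  · unfold logCoeff
    rw [← h1]; push_cast; ring
  · intro j hj
    exact h.sepFactor_ne_zero hμ hx (Finset.ne_of_mem_erase hj).symm
  · refine Finset.prod_ne_zero_iff.2 fun j hj => ?_
    exact h.sepFactor_ne_zero hμ hx (Finset.ne_of_mem_erase hj).symm

/-- Among all the factors of μ_i², only S_ij involves x_j; the denominator 2 comes from ν_i being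
half the logarithm of μ_i². -/
theorem pderiv_logCoeff (h : HasSeparableForm U μ u H) (hμ : IsDiagonalMetric U μ) (hU : IsOpen U)
    {x : Fin 4 → ℝ} (hx : x ∈ U) {i j : Fin 4} (hij : i ≠ j) :
    pderiv j (logCoeff μ i) x = deriv (u j i) (x j) / (2 * sepFactor u i j x) := by
  have hS := h.sepFactor_ne_zero hμ hx hij
  refine pderiv_eq_of_hasDerivAt
    (((contDiffOn_logCoeff hμ i).contDiffAt (hU.mem_nhds hx)).differentiableAt (by simp)) ?_
  have hj : j ∈ Finset.univ.erase i := by simp [hij.symm]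
  have heq : (fun r => logCoeff μ i (update x j r)) =ᶠ[nhds (x j)] fun r =>
      (Real.log (H i (x i)) + (Real.log (u i j (x i) + u j i r)
        + ∑ k ∈ (Finset.univ.erase i).erase j, Real.log (sepFactor u i k x))) / 2 := by
    filter_upwards [eventually_update_mem hU hx j] with r hr
    rw [h.logCoeff_eq hμ hr, ← Finset.add_sum_erase _ _ hj, update_of_ne hij]
    congr 3
    · simp [sepFactor, update_of_ne hij]
    · refine Finset.sum_congr rfl fun k hk => ?_
      simp [sepFactor, update_of_ne hij, update_of_ne (Finset.ne_of_mem_erase hk)]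
  refine HasDerivAt.congr_of_eventuallyEq ?_ heq
  have h1 := (h.smooth_u j i).hasDerivAt hU hx
  have h2 := (((h1.const_add (u i j (x i))).log hS).add_const
    (∑ k ∈ (Finset.univ.erase i).erase j, Real.log (sepFactor u i k x))).const_add
      (Real.log (H i (x i)))
  refine (h2.div_const 2).congr_deriv ?_
  unfold sepFactor
  rw [div_div, mul_comm]

/-- With the formula for ν_{i,j}, the left-hand side of the first equation has common denominator 4
S_ij S_ik S_jk; its numerator is the compatibility relation. -/
theorem isCompatible_iff_first (h : HasSeparableForm U μ u H) (hμ : IsDiagonalMetric U μ)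
    (hU : IsOpen U) {x : Fin 4 → ℝ} (hx : x ∈ U) {i j k : Fin 4} (hij : i ≠ j) (hik : i ≠ k)
    (hjk : j ≠ k) :
    (pderiv j (logCoeff μ i) x * pderiv k (logCoeff μ j) x
      + pderiv k (logCoeff μ i) x * pderiv j (logCoeff μ k) x
      - pderiv j (logCoeff μ i) x * pderiv k (logCoeff μ i) x = 0) ↔
    deriv (u j i) (x j) * deriv (u k j) (x k) * sepFactor u i k x
      + deriv (u k i) (x k) * deriv (u j k) (x j) * sepFactor u i j x
      = deriv (u j i) (x j) * deriv (u k i) (x k) * sepFactor u j k x := by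
  have h1 := h.sepFactor_ne_zero hμ hx hij
  have h2 := h.sepFactor_ne_zero hμ hx hik
  have h3 := h.sepFactor_ne_zero hμ hx hjk
  rw [h.pderiv_logCoeff hμ hU hx hij, h.pderiv_logCoeff hμ hU hx hik,
    h.pderiv_logCoeff hμ hU hx hjk, h.pderiv_logCoeff hμ hU hx hjk.symm,
    sepFactor_comm u k j, ← sub_eq_zero (b := _ * sepFactor u j k x)]
  have : deriv (u j i) (x j) / (2 * sepFactor u i j x) * (deriv (u k j) (x k) / (2 * sepFactor u j k x))
      + deriv (u k i) (x k) / (2 * sepFactor u i k x) * (deriv (u j k) (x j) / (2 * sepFactor u j k x))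
      - deriv (u j i) (x j) / (2 * sepFactor u i j x) * (deriv (u k i) (x k) / (2 * sepFactor u i k x))
      = (deriv (u j i) (x j) * deriv (u k j) (x k) * sepFactor u i k x
        + deriv (u k i) (x k) * deriv (u j k) (x j) * sepFactor u i j x
        - deriv (u j i) (x j) * deriv (u k i) (x k) * sepFactor u j k x)
        / (4 * sepFactor u i j x * sepFactor u i k x * sepFactor u j k x) := by
    field_simp
    ring
  rw [this, div_eq_zero_iff, or_iff_left (by positivity)]

/-- The derivative ν_{i,j} involves only x_i and x_j, which gives the second equation.
Differentiating 1/S_ij in x_i produces -u_ij'/S_ij², which is exactly what the third equation asks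
for. -/
theorem stackelSystem (h : HasSeparableForm U μ u H) (hc : IsCompatible U u)
    (hμ : IsDiagonalMetric U μ) (hU : IsOpen U) : StackelSystem U μ := by
  have hdiff : ∀ i j : Fin 4, ∀ x ∈ U, DifferentiableAt ℝ (pderiv j (logCoeff μ i)) x :=
    fun i j x hx => ((contDiffOn_pderiv hU (contDiffOn_logCoeff hμ i) j).contDiffAt
      (hU.mem_nhds hx)).differentiableAt (by simp)
  refine ⟨fun x hx i j k hij hik hjk => (h.isCompatible_iff_first hμ hU hx hij hik hjk).2
    (hc x hx i j k hij hik hjk), fun x hx i j k hij hik hjk => ?_, fun x hx i j hij => ?_⟩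
  · refine pderiv_eq_of_hasDerivAt (hdiff i j x hx) ?_
    refine (hasDerivAt_const (x k) (deriv (u j i) (x j) / (2 * sepFactor u i j x))
      ).congr_of_eventuallyEq ?_
    filter_upwards [eventually_update_mem hU hx k] with r hr
    rw [h.pderiv_logCoeff hμ hU hr hij]
    simp [sepFactor, update_of_ne hik, update_of_ne hjk]
  · have hS := h.sepFactor_ne_zero hμ hx hij
    rw [pderiv_comm hU (contDiffOn_logCoeff hμ i) hx, h.pderiv_logCoeff hμ hU hx hij,
      h.pderiv_logCoeff hμ hU hx hij.symm, sepFactor_comm u j i]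
    have : pderiv i (pderiv j (logCoeff μ i)) x
        = -(deriv (u j i) (x j) * (2 * deriv (u i j) (x i))) / (2 * sepFactor u i j x) ^ 2 := by
      refine pderiv_eq_of_hasDerivAt (hdiff i j x hx) ?_
      have heq : (fun r => pderiv j (logCoeff μ i) (update x i r)) =ᶠ[nhds (x i)] fun r =>
          deriv (u j i) (x j) / (2 * (u i j r + u j i (x j))) := by
        filter_upwards [eventually_update_mem hU hx i] with r hr
        rw [h.pderiv_logCoeff hμ hU hr hij]
        simp [sepFactor, update_of_ne hij.symm]
      refine HasDerivAt.congr_of_eventuallyEq ?_ heq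
      have h1 := (((h.smooth_u i j).hasDerivAt hU hx).add_const (u j i (x j))).const_mul 2
      have h2 := (hasDerivAt_const (x i) (deriv (u j i) (x j))).div h1
        (by simpa [sepFactor] using hS)
      refine h2.congr_deriv ?_
      simp [sepFactor]
    rw [this]
    field_simp
    ring

end HasSeparableForm

/-! ### The ten kinds as compatible separable forms. -/

theorem prod_erase_fin_four (f : Fin 4 → ℝ) :
    ∏ j ∈ Finset.univ.erase 0, f j = f 1 * f 2 * f 3 ∧
    ∏ j ∈ Finset.univ.erase 1, f j = f 0 * f 2 * f 3 ∧
    ∏ j ∈ Finset.univ.erase 2, f j = f 0 * f 1 * f 3 ∧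
    ∏ j ∈ Finset.univ.erase 3, f j = f 0 * f 1 * f 2 := by
  have h0 : (Finset.univ.erase 0 : Finset (Fin 4)) = {1, 2, 3} := by decide
  have h1 : (Finset.univ.erase 1 : Finset (Fin 4)) = {0, 2, 3} := by decide
  have h2 : (Finset.univ.erase 2 : Finset (Fin 4)) = {0, 1, 3} := by decide
  have h3 : (Finset.univ.erase 3 : Finset (Fin 4)) = {0, 1, 2} := by decide
  rw [h0, h1, h2, h3]
  simp [mul_assoc]

/-- Each factor appears here only in the order i < j, so that explicit tables of functions can be
substituted and simplified. -/
theorem hasSeparableForm_of {U : Set (Fin 4 → ℝ)} {μ : Fin 4 → (Fin 4 → ℝ) → ℝ}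
    (u : Fin 4 → Fin 4 → ℝ → ℝ) (H : Fin 4 → ℝ → ℝ)
    (hu : ∀ i j, SmoothInCoord U i (u i j)) (hH : ∀ i, SmoothInCoord U i (H i))
    (hsq : ∀ x ∈ U,
      μ 0 x ^ 2 = |H 0 (x 0) * ((u 0 1 (x 0) + u 1 0 (x 1)) * (u 0 2 (x 0) + u 2 0 (x 2))
        * (u 0 3 (x 0) + u 3 0 (x 3)))| ∧
      μ 1 x ^ 2 = |H 1 (x 1) * ((u 0 1 (x 0) + u 1 0 (x 1)) * (u 1 2 (x 1) + u 2 1 (x 2))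
        * (u 1 3 (x 1) + u 3 1 (x 3)))| ∧
      μ 2 x ^ 2 = |H 2 (x 2) * ((u 0 2 (x 0) + u 2 0 (x 2)) * (u 1 2 (x 1) + u 2 1 (x 2))
        * (u 2 3 (x 2) + u 3 2 (x 3)))| ∧
      μ 3 x ^ 2 = |H 3 (x 3) * ((u 0 3 (x 0) + u 3 0 (x 3)) * (u 1 3 (x 1) + u 3 1 (x 3))
        * (u 2 3 (x 2) + u 3 2 (x 3)))|) :
    HasSeparableForm U μ u H := by
  refine ⟨hu, hH, fun x hx i => ?_⟩
  obtain ⟨h0, h1, h2, h3⟩ := hsq x hx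
  have e0 := (prod_erase_fin_four fun j => sepFactor u 0 j x).1
  have e1 := (prod_erase_fin_four fun j => sepFactor u 1 j x).2.1
  have e2 := (prod_erase_fin_four fun j => sepFactor u 2 j x).2.2.1
  have e3 := (prod_erase_fin_four fun j => sepFactor u 3 j x).2.2.2
  have hi : i = 0 ∨ i = 1 ∨ i = 2 ∨ i = 3 := by revert i; decide
  rcases hi with rfl | rfl | rfl | rfl
  · rw [e0, h0]; rfl
  · rw [e1, h1, sepFactor_comm u 1 0]; rfl
  · rw [e2, h2, sepFactor_comm u 2 0, sepFactor_comm u 2 1]; rfl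
  · rw [e3, h3, sepFactor_comm u 3 0, sepFactor_comm u 3 1, sepFactor_comm u 3 2]; rfl

/-- The compatibility condition at the point `x` for the distinct indices `i`, `j`, `k`. -/
def CompatAt (u : Fin 4 → Fin 4 → ℝ → ℝ) (x : Fin 4 → ℝ) (i j k : Fin 4) : Prop :=
  deriv (u j i) (x j) * deriv (u k j) (x k) * (u i k (x i) + u k i (x k))
      + deriv (u k i) (x k) * deriv (u j k) (x j) * (u i j (x i) + u j i (x j))
      = deriv (u j i) (x j) * deriv (u k i) (x k) * (u j k (x j) + u k j (x k))

/-- Exchanging j and k only permutes the terms, so twelve of the twenty-four index triples suffice.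
-/
theorem CompatAt.symm {u : Fin 4 → Fin 4 → ℝ → ℝ} {x : Fin 4 → ℝ} {i j k : Fin 4}
    (h : CompatAt u x i j k) : CompatAt u x i k j := by
  unfold CompatAt at h ⊢
  linear_combination h

theorem isCompatible_of {U : Set (Fin 4 → ℝ)} {u : Fin 4 → Fin 4 → ℝ → ℝ}
    (h : ∀ x ∈ U,
      (CompatAt u x 0 1 2 ∧ CompatAt u x 0 1 3 ∧ CompatAt u x 0 2 3) ∧
      (CompatAt u x 1 0 2 ∧ CompatAt u x 1 0 3 ∧ CompatAt u x 1 2 3) ∧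
      (CompatAt u x 2 0 1 ∧ CompatAt u x 2 0 3 ∧ CompatAt u x 2 1 3) ∧
      (CompatAt u x 3 0 1 ∧ CompatAt u x 3 0 2 ∧ CompatAt u x 3 1 2)) :
    IsCompatible U u := by
  intro x hx i j k hij hik hjk
  change CompatAt u x i j k
  obtain ⟨⟨h1, h2, h3⟩, ⟨h4, h5, h6⟩, ⟨h7, h8, h9⟩, ⟨h10, h11, h12⟩⟩ := h x hx
  fin_cases i <;> fin_cases j <;> fin_cases k <;>
    first | exact absurd rfl hij | exact absurd rfl hik | exact absurd rfl hjk
          | assumption | (apply CompatAt.symm; assumption)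

theorem SmoothInCoord.const {U : Set (Fin 4 → ℝ)} {i : Fin 4} (c : ℝ) :
    SmoothInCoord U i fun _ => c :=
  contDiffOn_const

theorem SmoothInCoord.inv {U : Set (Fin 4 → ℝ)} {i : Fin 4} {f : ℝ → ℝ} (hf : SmoothInCoord U i f)
    (h0 : ∀ x ∈ U, f (x i) ≠ 0) : SmoothInCoord U i fun s => (f s)⁻¹ :=
  ContDiffOn.inv hf (by rintro _ ⟨x, hx, rfl⟩; exact h0 x hx)

theorem SmoothInCoord.mul {U : Set (Fin 4 → ℝ)} {i : Fin 4} {f g : ℝ → ℝ}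
    (hf : SmoothInCoord U i f) (hg : SmoothInCoord U i g) : SmoothInCoord U i fun s => f s * g s :=
  ContDiffOn.mul hf hg

theorem SmoothInCoord.neg {U : Set (Fin 4 → ℝ)} {i : Fin 4} {f : ℝ → ℝ}
    (hf : SmoothInCoord U i f) : SmoothInCoord U i fun s => -f s :=
  ContDiffOn.neg hf

theorem SmoothInCoord.sub_const {U : Set (Fin 4 → ℝ)} {i : Fin 4} {f : ℝ → ℝ}
    (hf : SmoothInCoord U i f) (c : ℝ) : SmoothInCoord U i fun s => f s - c :=
  ContDiffOn.sub hf contDiffOn_const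

theorem SmoothInCoord.pow {U : Set (Fin 4 → ℝ)} {i : Fin 4} {f : ℝ → ℝ}
    (hf : SmoothInCoord U i f) (n : ℕ) : SmoothInCoord U i fun s => f s ^ n :=
  ContDiffOn.pow hf n

theorem SmoothInCoord.id {U : Set (Fin 4 → ℝ)} {i : Fin 4} : SmoothInCoord U i fun s => s :=
  contDiffOn_id

section Kinds

set_option linter.unusedSimpArgs false
set_option linter.unreachableTactic false
set_option linter.unusedTactic false

variable {U : Set (Fin 4 → ℝ)} {μ : Fin 4 → (Fin 4 → ℝ) → ℝ}

theorem sq_ne_zero_of_mem (hμ : IsDiagonalMetric U μ) {x : Fin 4 → ℝ} (hx : x ∈ U) (i : Fin 4) :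
    μ i x ^ 2 ≠ 0 := pow_ne_zero _ (hμ.pos i x hx).ne'

/-- A square is its own absolute value, so the signs chosen for the factors S_ij are immaterial when
matching a kind. -/
theorem sq_eq_abs {i : Fin 4} {x : Fin 4 → ℝ} {a b : ℝ} (h : μ i x ^ 2 = a) (hab : |a| = |b|) :
    μ i x ^ 2 = |b| := by
  rw [← hab, ← h, abs_of_nonneg (sq_nonneg _)]

/-- Here S_01 = S_02 = S_03 = η, S_12 = ψ, S_13 = φ and S_23 = 1; the functions H_0 and H_1 cancel
the factors that μ_0² and μ_1² should not contain. The diagonal entries of the table never enter.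
The other kinds follow the same scheme. -/
theorem KindOne.separable (hμ : IsDiagonalMetric U μ) (h : KindOne U μ) :
    ∃ u H, HasSeparableForm U μ u H ∧ IsCompatible U u := by
  obtain ⟨η, ψ, φ, hη, hψ, hφ, -, h⟩ := h
  have hne : ∀ x ∈ U, η (x 0) ≠ 0 ∧ ψ (x 1) ≠ 0 ∧ φ (x 1) ≠ 0 := by
    intro x hx
    obtain ⟨h0, h1, h2, h3⟩ := h x hx
    have e0 := sq_ne_zero_of_mem hμ hx 0
    have e1 := sq_ne_zero_of_mem hμ hx 1
    have e2 := sq_ne_zero_of_mem hμ hx 2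
    have e3 := sq_ne_zero_of_mem hμ hx 3
    rw [h0] at e0
    rw [h1] at e1
    rw [h2] at e2
    rw [h3] at e3
    simp_all
  refine ⟨![![0, η, η, η], ![fun _ => 0, 0, ψ, φ], ![fun _ => 0, fun _ => 0, 0, fun _ => 1],
    ![fun _ => 0, fun _ => 0, fun _ => 0, 0]],
    ![fun s => (η s ^ 3)⁻¹, fun s => (ψ s * φ s)⁻¹, fun _ => 1, fun _ => 1],
    hasSeparableForm_of _ _ ?_ ?_ ?_, isCompatible_of ?_⟩
  · intro i j
    fin_cases i <;> fin_cases j <;>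
      first | exact hη | exact hψ | exact hφ | exact .const _
  · intro i
    fin_cases i
    · exact (hη.pow 3).inv fun x hx => pow_ne_zero _ (hne x hx).1
    · exact (hψ.mul hφ).inv fun x hx => mul_ne_zero (hne x hx).2.1 (hne x hx).2.2
    · exact .const _
    · exact .const _
  · intro x hx
    obtain ⟨h0, h1, h2, h3⟩ := h x hx
    obtain ⟨n0, n1, n2⟩ := hne x hx
    refine ⟨?_, ?_, ?_, ?_⟩
    · exact sq_eq_abs h0 (by congr 1; simp; field_simp)
    · exact sq_eq_abs h1 (by congr 1; simp; field_simp)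
    · exact sq_eq_abs h2 (by congr 1; simp)
    · exact sq_eq_abs h3 (by congr 1; simp)
  · intro x hx
    refine ⟨⟨?_, ?_, ?_⟩, ⟨?_, ?_, ?_⟩, ⟨?_, ?_, ?_⟩, ⟨?_, ?_, ?_⟩⟩ <;>
      simp [CompatAt, -mul_eq_mul_left_iff, -mul_eq_mul_right_iff] <;> ring

/-- All factors containing the index 0 equal φ; the others are the differences of ξ, ζ, η. -/
theorem KindTwo.separable (hμ : IsDiagonalMetric U μ) (h : KindTwo U μ) :
    ∃ u H, HasSeparableForm U μ u H ∧ IsCompatible U u := by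
  obtain ⟨φ, ξ, ζ, η, hφ, hξ, hζ, hη, -, -, h⟩ := h
  have hne : ∀ x ∈ U, φ (x 0) ≠ 0 := by
    intro x hx
    obtain ⟨h0, h1, h2, h3⟩ := h x hx
    have e0 := sq_ne_zero_of_mem hμ hx 0
    have e1 := sq_ne_zero_of_mem hμ hx 1
    have e2 := sq_ne_zero_of_mem hμ hx 2
    have e3 := sq_ne_zero_of_mem hμ hx 3
    rw [h0] at e0
    rw [h1] at e1
    rw [h2] at e2
    rw [h3] at e3
    exact left_ne_zero_of_mul (left_ne_zero_of_mul e1)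
  refine ⟨![![0, φ, φ, φ], ![fun _ => 0, 0, ξ, ξ], ![fun _ => 0, fun s => -ζ s, 0, ζ],
    ![fun _ => 0, fun s => -η s, fun s => -η s, 0]],
    ![fun s => (φ s ^ 3)⁻¹, fun _ => 1, fun _ => 1, fun _ => 1],
    hasSeparableForm_of _ _ ?_ ?_ ?_, isCompatible_of ?_⟩
  · intro i j
    fin_cases i <;> fin_cases j <;>
      first | exact hφ | exact hξ | exact hζ | exact hη | exact hζ.neg | exact hη.neg | exact .const _
  · intro i
    fin_cases i
    · exact (hφ.pow 3).inv fun x hx => pow_ne_zero _ (hne x hx)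
    · exact .const _
    · exact .const _
    · exact .const _
  · intro x hx
    obtain ⟨h0, h1, h2, h3⟩ := h x hx
    obtain n0 := hne x hx
    refine ⟨?_, ?_, ?_, ?_⟩
    · exact sq_eq_abs h0 (by congr 1; simp; field_simp)
    · exact sq_eq_abs h1 (by simp [abs_mul, abs_sub_comm, ← sub_eq_add_neg, mul_assoc])
    · exact sq_eq_abs h2 (by simp [abs_mul, abs_sub_comm, ← sub_eq_add_neg, mul_assoc])
    · exact sq_eq_abs h3 (by simp [abs_mul, abs_sub_comm, ← sub_eq_add_neg, mul_assoc])
  · intro x hx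
    refine ⟨⟨?_, ?_, ?_⟩, ⟨?_, ?_, ?_⟩, ⟨?_, ?_, ?_⟩, ⟨?_, ?_, ?_⟩⟩ <;>
      simp [CompatAt, -mul_eq_mul_left_iff, -mul_eq_mul_right_iff] <;> ring

theorem KindThree.separable (hμ : IsDiagonalMetric U μ) (h : KindThree U μ) :
    ∃ u H, HasSeparableForm U μ u H ∧ IsCompatible U u := by
  obtain ⟨η, ξ, φ, ψ, hη, hξ, hφ, hψ, h⟩ := h
  have hne : ∀ x ∈ U, x 0 ≠ 0 ∧ x 1 ≠ 0 := by
    intro x hx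
    obtain ⟨h0, h1, h2, h3⟩ := h x hx
    have e0 := sq_ne_zero_of_mem hμ hx 0
    have e1 := sq_ne_zero_of_mem hμ hx 1
    have e2 := sq_ne_zero_of_mem hμ hx 2
    have e3 := sq_ne_zero_of_mem hμ hx 3
    rw [h0] at e0
    rw [h1] at e1
    rw [h2] at e2
    rw [h3] at e3
    exact ⟨left_ne_zero_of_mul e1, right_ne_zero_of_mul (left_ne_zero_of_mul e2)⟩
  refine ⟨![![0, fun s => s, fun s => s, fun s => s], ![fun _ => 0, 0, fun s => s, fun s => s],
    ![fun _ => 0, fun _ => 0, 0, φ], ![fun _ => 0, fun _ => 0, ψ, 0]],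
    ![fun s => η s * (s ^ 3)⁻¹, fun s => ξ s * (s ^ 2)⁻¹, fun _ => 1, fun _ => 1],
    hasSeparableForm_of _ _ ?_ ?_ ?_, isCompatible_of ?_⟩
  · intro i j
    fin_cases i <;> fin_cases j <;>
      first | exact .id | exact hφ | exact hψ | exact .const _
  · intro i
    fin_cases i
    · exact hη.mul ((SmoothInCoord.id.pow 3).inv fun x hx => pow_ne_zero _ (hne x hx).1)
    · exact hξ.mul ((SmoothInCoord.id.pow 2).inv fun x hx => pow_ne_zero _ (hne x hx).2)
    · exact .const _
    · exact .const _
  · intro x hx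
    obtain ⟨h0, h1, h2, h3⟩ := h x hx
    obtain ⟨n0, n1⟩ := hne x hx
    refine ⟨?_, ?_, ?_, ?_⟩
    · exact sq_eq_abs h0 (by congr 1; simp; field_simp)
    · exact sq_eq_abs h1 (by congr 1; simp; field_simp)
    · exact sq_eq_abs h2 (by congr 1; simp)
    · exact sq_eq_abs h3 (by congr 1; simp)
  · intro x hx
    refine ⟨⟨?_, ?_, ?_⟩, ⟨?_, ?_, ?_⟩, ⟨?_, ?_, ?_⟩, ⟨?_, ?_, ?_⟩⟩ <;>
      simp [CompatAt, -mul_eq_mul_left_iff, -mul_eq_mul_right_iff] <;> ring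

theorem KindFour.separable (hμ : IsDiagonalMetric U μ) (h : KindFour U μ) :
    ∃ u H, HasSeparableForm U μ u H ∧ IsCompatible U u := by
  obtain ⟨φ, ψ, ξ, η, hφ, hψ, hξ, hη, h⟩ := h
  refine ⟨![![0, φ, fun _ => 1, fun _ => 1], ![ψ, 0, fun _ => 1, fun _ => 1],
    ![fun _ => 0, fun _ => 0, 0, ξ], ![fun _ => 0, fun _ => 0, η, 0]],
    ![fun _ => 1, fun _ => 1, fun _ => 1, fun _ => 1],
    hasSeparableForm_of _ _ ?_ ?_ ?_, isCompatible_of ?_⟩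
  · intro i j
    fin_cases i <;> fin_cases j <;>
      first | exact hφ | exact hψ | exact hξ | exact hη | exact .const _
  · intro i
    fin_cases i
    · exact .const _
    · exact .const _
    · exact .const _
    · exact .const _
  · intro x hx
    obtain ⟨h0, h1, h2, h3⟩ := h x hx
    refine ⟨?_, ?_, ?_, ?_⟩
    · exact sq_eq_abs h0 (by congr 1; simp)
    · exact sq_eq_abs h1 (by congr 1; simp)
    · exact sq_eq_abs h2 (by congr 1; simp)
    · exact sq_eq_abs h3 (by congr 1; simp)
  · intro x hx
    refine ⟨⟨?_, ?_, ?_⟩, ⟨?_, ?_, ?_⟩, ⟨?_, ?_, ?_⟩, ⟨?_, ?_, ?_⟩⟩ <;>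
      simp [CompatAt, -mul_eq_mul_left_iff, -mul_eq_mul_right_iff] <;> ring

/-- S_01 = ξ - η, S_02 = S_03 = ξ, S_12 = S_13 = η and S_23 = ψ + φ; dividing by ξ² and η² restores
μ_0² and μ_1². -/
theorem KindFive.separable (hμ : IsDiagonalMetric U μ) (h : KindFive U μ) :
    ∃ u H, HasSeparableForm U μ u H ∧ IsCompatible U u := by
  obtain ⟨ξ, η, ψ, φ, hξ, hη, hψ, hφ, -, -, h⟩ := h
  have hne : ∀ x ∈ U, ξ (x 0) ≠ 0 ∧ η (x 1) ≠ 0 := by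
    intro x hx
    obtain ⟨h0, h1, h2, h3⟩ := h x hx
    have e0 := sq_ne_zero_of_mem hμ hx 0
    have e1 := sq_ne_zero_of_mem hμ hx 1
    have e2 := sq_ne_zero_of_mem hμ hx 2
    have e3 := sq_ne_zero_of_mem hμ hx 3
    rw [h0] at e0
    rw [h1] at e1
    rw [h2] at e2
    rw [h3] at e3
    exact ⟨left_ne_zero_of_mul (left_ne_zero_of_mul e2),
      right_ne_zero_of_mul (left_ne_zero_of_mul e2)⟩
  refine ⟨![![0, ξ, ξ, ξ], ![fun s => -η s, 0, η, η],
    ![fun _ => 0, fun _ => 0, 0, ψ], ![fun _ => 0, fun _ => 0, φ, 0]],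
    ![fun s => (ξ s ^ 2)⁻¹, fun s => (η s ^ 2)⁻¹, fun _ => 1, fun _ => 1],
    hasSeparableForm_of _ _ ?_ ?_ ?_, isCompatible_of ?_⟩
  · intro i j
    fin_cases i <;> fin_cases j <;>
      first | exact hξ | exact hη | exact hψ | exact hφ | exact hη.neg | exact .const _
  · intro i
    fin_cases i
    · exact (hξ.pow 2).inv fun x hx => pow_ne_zero _ (hne x hx).1
    · exact (hη.pow 2).inv fun x hx => pow_ne_zero _ (hne x hx).2
    · exact .const _
    · exact .const _
  · intro x hx
    obtain ⟨h0, h1, h2, h3⟩ := h x hx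
    obtain ⟨n0, n1⟩ := hne x hx
    refine ⟨?_, ?_, ?_, ?_⟩
    · exact sq_eq_abs h0 (by congr 1; simp; field_simp; ring)
    · exact sq_eq_abs h1 (by congr 1; simp; field_simp; ring)
    · exact sq_eq_abs h2 (by congr 1; simp)
    · exact sq_eq_abs h3 (by congr 1; simp)
  · intro x hx
    refine ⟨⟨?_, ?_, ?_⟩, ⟨?_, ?_, ?_⟩, ⟨?_, ?_, ?_⟩, ⟨?_, ?_, ?_⟩⟩ <;>
      simp [CompatAt, -mul_eq_mul_left_iff, -mul_eq_mul_right_iff] <;> ring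

theorem KindSix.separable (hμ : IsDiagonalMetric U μ) (h : KindSix U μ) :
    ∃ u H, HasSeparableForm U μ u H ∧ IsCompatible U u := by
  obtain ⟨φ, ψ, ξ, η, hφ, hψ, hξ, hη, -, -, h⟩ := h
  have hne : ∀ x ∈ U, x 0 ≠ 0 ∧ ψ (x 0) ≠ 0 := by
    intro x hx
    obtain ⟨h0, h1, h2, h3⟩ := h x hx
    have e0 := sq_ne_zero_of_mem hμ hx 0
    have e1 := sq_ne_zero_of_mem hμ hx 1
    have e2 := sq_ne_zero_of_mem hμ hx 2
    have e3 := sq_ne_zero_of_mem hμ hx 3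
    rw [h0] at e0
    rw [h1] at e1
    rw [h2] at e2
    rw [h3] at e3
    exact ⟨left_ne_zero_of_mul e2, e1⟩
  refine ⟨![![0, ψ, fun s => s, fun s => s], ![fun _ => 0, 0, fun _ => 1, fun _ => 1],
    ![fun _ => 0, fun _ => 0, 0, ξ], ![fun _ => 0, fun _ => 0, η, 0]],
    ![fun s => φ s * (ψ s * s ^ 2)⁻¹, fun _ => 1, fun _ => 1, fun _ => 1],
    hasSeparableForm_of _ _ ?_ ?_ ?_, isCompatible_of ?_⟩
  · intro i j
    fin_cases i <;> fin_cases j <;>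
      first | exact .id | exact hψ | exact hξ | exact hη | exact .const _
  · intro i
    fin_cases i
    · exact hφ.mul ((hψ.mul (SmoothInCoord.id.pow 2)).inv fun x hx =>
      mul_ne_zero (hne x hx).2 (pow_ne_zero _ (hne x hx).1))
    · exact .const _
    · exact .const _
    · exact .const _
  · intro x hx
    obtain ⟨h0, h1, h2, h3⟩ := h x hx
    obtain ⟨n0, n1⟩ := hne x hx
    refine ⟨?_, ?_, ?_, ?_⟩
    · exact sq_eq_abs h0 (by congr 1; simp; field_simp)
    · exact sq_eq_abs h1 (by congr 1; simp)
    · exact sq_eq_abs h2 (by congr 1; simp)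
    · exact sq_eq_abs h3 (by congr 1; simp)
  · intro x hx
    refine ⟨⟨?_, ?_, ?_⟩, ⟨?_, ?_, ?_⟩, ⟨?_, ?_, ?_⟩, ⟨?_, ?_, ?_⟩⟩ <;>
      simp [CompatAt, -mul_eq_mul_left_iff, -mul_eq_mul_right_iff] <;> ring

theorem KindSeven.separable (hμ : IsDiagonalMetric U μ) (h : KindSeven U μ) :
    ∃ u H, HasSeparableForm U μ u H ∧ IsCompatible U u := by
  obtain ⟨φ, ψ, η, hφ, hψ, hη, h⟩ := h
  have hne : ∀ x ∈ U, φ (x 0) ≠ 0 ∧ ψ (x 0) ≠ 0 ∧ η (x 0) ≠ 0 := by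
    intro x hx
    obtain ⟨h0, h1, h2, h3⟩ := h x hx
    have e0 := sq_ne_zero_of_mem hμ hx 0
    have e1 := sq_ne_zero_of_mem hμ hx 1
    have e2 := sq_ne_zero_of_mem hμ hx 2
    have e3 := sq_ne_zero_of_mem hμ hx 3
    rw [h0] at e0
    rw [h1] at e1
    rw [h2] at e2
    rw [h3] at e3
    exact ⟨e1, e2, e3⟩
  refine ⟨![![0, φ, ψ, η], ![fun _ => 0, 0, fun _ => 1, fun _ => 1],
    ![fun _ => 0, fun _ => 0, 0, fun _ => 1], ![fun _ => 0, fun _ => 0, fun _ => 0, 0]],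
    ![fun s => (φ s * ψ s * η s)⁻¹, fun _ => 1, fun _ => 1, fun _ => 1],
    hasSeparableForm_of _ _ ?_ ?_ ?_, isCompatible_of ?_⟩
  · intro i j
    fin_cases i <;> fin_cases j <;>
      first | exact hφ | exact hψ | exact hη | exact .const _
  · intro i
    fin_cases i
    · exact ((hφ.mul hψ).mul hη).inv fun x hx =>
      mul_ne_zero (mul_ne_zero (hne x hx).1 (hne x hx).2.1) (hne x hx).2.2
    · exact .const _
    · exact .const _
    · exact .const _
  · intro x hx
    obtain ⟨h0, h1, h2, h3⟩ := h x hx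
    obtain ⟨n0, n1, n2⟩ := hne x hx
    refine ⟨?_, ?_, ?_, ?_⟩
    · exact sq_eq_abs h0 (by congr 1; simp; field_simp)
    · exact sq_eq_abs h1 (by congr 1; simp)
    · exact sq_eq_abs h2 (by congr 1; simp)
    · exact sq_eq_abs h3 (by congr 1; simp)
  · intro x hx
    refine ⟨⟨?_, ?_, ?_⟩, ⟨?_, ?_, ?_⟩, ⟨?_, ?_, ?_⟩, ⟨?_, ?_, ?_⟩⟩ <;>
      simp [CompatAt, -mul_eq_mul_left_iff, -mul_eq_mul_right_iff] <;> ring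

/-- For i < j the factor is x_i - x_j, and compatibility is a polynomial identity between such
differences. -/
theorem KindEight.separable (hμ : IsDiagonalMetric U μ) (h : KindEight U μ) :
    ∃ u H, HasSeparableForm U μ u H ∧ IsCompatible U u := by
  obtain ⟨φ, hφ, h⟩ := h
  have h' : ∀ x ∈ U, _ ∧ _ ∧ _ ∧ _ := fun x hx =>
    ⟨(h x hx 0).trans (congrArg _ (prod_erase_fin_four _).1),
      (h x hx 1).trans (congrArg _ (prod_erase_fin_four _).2.1),
      (h x hx 2).trans (congrArg _ (prod_erase_fin_four _).2.2.1),
      (h x hx 3).trans (congrArg _ (prod_erase_fin_four _).2.2.2)⟩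
  refine ⟨![![0, fun s => s, fun s => s, fun s => s], ![fun s => -s, 0, fun s => s, fun s => s],
    ![fun s => -s, fun s => -s, 0, fun s => s], ![fun s => -s, fun s => -s, fun s => -s, 0]],
    φ,
    hasSeparableForm_of _ _ ?_ ?_ ?_, isCompatible_of ?_⟩
  · intro i j
    fin_cases i <;> fin_cases j <;>
      first | exact .id | exact .neg .id | exact .const _
  · exact hφ
  · intro x hx
    obtain ⟨h0, h1, h2, h3⟩ := h' x hx
    refine ⟨?_, ?_, ?_, ?_⟩
    · exact sq_eq_abs h0 (by simp [abs_mul, abs_sub_comm, ← sub_eq_add_neg, mul_assoc])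
    · exact sq_eq_abs h1 (by simp [abs_mul, abs_sub_comm, ← sub_eq_add_neg, mul_assoc])
    · exact sq_eq_abs h2 (by simp [abs_mul, abs_sub_comm, ← sub_eq_add_neg, mul_assoc])
    · exact sq_eq_abs h3 (by simp [abs_mul, abs_sub_comm, ← sub_eq_add_neg, mul_assoc])
  · intro x hx
    refine ⟨⟨?_, ?_, ?_⟩, ⟨?_, ?_, ?_⟩, ⟨?_, ?_, ?_⟩, ⟨?_, ?_, ?_⟩⟩ <;>
      simp [CompatAt, -mul_eq_mul_left_iff, -mul_eq_mul_right_iff] <;> ring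

/-- This is the scheme of differences with index 0 placed at the constant value 0: the factors S_0j
are x_j, and they are divided out of μ_j² for j ≠ 0. -/
theorem KindNine.separable (hμ : IsDiagonalMetric U μ) (h : KindNine U μ) :
    ∃ u H, HasSeparableForm U μ u H ∧ IsCompatible U u := by
  obtain ⟨φ₁, φ₂, φ₃, h₁, h₂, h₃, h⟩ := h
  have hne : ∀ x ∈ U, x 1 ≠ 0 ∧ x 2 ≠ 0 ∧ x 3 ≠ 0 := by
    intro x hx
    obtain ⟨h0, h1, h2, h3⟩ := h x hx
    have e0 := sq_ne_zero_of_mem hμ hx 0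
    have e1 := sq_ne_zero_of_mem hμ hx 1
    have e2 := sq_ne_zero_of_mem hμ hx 2
    have e3 := sq_ne_zero_of_mem hμ hx 3
    rw [h0] at e0
    rw [h1] at e1
    rw [h2] at e2
    rw [h3] at e3
    exact ⟨left_ne_zero_of_mul (left_ne_zero_of_mul e0),
      right_ne_zero_of_mul (left_ne_zero_of_mul e0), right_ne_zero_of_mul e0⟩
  refine ⟨![![0, fun _ => 0, fun _ => 0, fun _ => 0], ![fun s => s, 0, fun s => s, fun s => s],
    ![fun s => s, fun s => -s, 0, fun s => s], ![fun s => s, fun s => -s, fun s => -s, 0]],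
    ![fun _ => 1, fun s => φ₁ s * s⁻¹, fun s => φ₂ s * s⁻¹, fun s => φ₃ s * s⁻¹],
    hasSeparableForm_of _ _ ?_ ?_ ?_, isCompatible_of ?_⟩
  · intro i j
    fin_cases i <;> fin_cases j <;>
      first | exact .id | exact .neg .id | exact .const _
  · intro i
    fin_cases i
    · exact .const _
    · exact h₁.mul (SmoothInCoord.id.inv fun x hx => (hne x hx).1)
    · exact h₂.mul (SmoothInCoord.id.inv fun x hx => (hne x hx).2.1)
    · exact h₃.mul (SmoothInCoord.id.inv fun x hx => (hne x hx).2.2)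
  · intro x hx
    obtain ⟨h0, h1, h2, h3⟩ := h x hx
    obtain ⟨n0, n1, n2⟩ := hne x hx
    refine ⟨?_, ?_, ?_, ?_⟩
    · exact sq_eq_abs h0 (by simp [abs_mul, abs_sub_comm, ← sub_eq_add_neg, mul_assoc])
    · exact sq_eq_abs h1 (by
        simp [abs_mul, abs_sub_comm, ← sub_eq_add_neg]; field_simp)
    · exact sq_eq_abs h2 (by
        simp [abs_mul, abs_sub_comm, ← sub_eq_add_neg]; field_simp)
    · exact sq_eq_abs h3 (by
        simp [abs_mul, abs_sub_comm, ← sub_eq_add_neg]; field_simp)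
  · intro x hx
    refine ⟨⟨?_, ?_, ?_⟩, ⟨?_, ?_, ?_⟩, ⟨?_, ?_, ?_⟩, ⟨?_, ?_, ?_⟩⟩ <;>
      simp [CompatAt, -mul_eq_mul_left_iff, -mul_eq_mul_right_iff] <;> ring

/-- The indices 0 and 1 are placed at the constant values b and 0, so that S_0j = x_j - b and S_1j =
x_j for j = 2, 3, while S_01 = 1. -/
theorem KindTen.separable (hμ : IsDiagonalMetric U μ) (h : KindTen U μ) :
    ∃ u H, HasSeparableForm U μ u H ∧ IsCompatible U u := by
  obtain ⟨b, φ₂, φ₃, h₂, h₃, h⟩ := h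
  have hne : ∀ x ∈ U, (x 2 ≠ 0 ∧ x 3 ≠ 0) ∧ x 2 - b ≠ 0 ∧ x 3 - b ≠ 0 := by
    intro x hx
    obtain ⟨h0, h1, h2, h3⟩ := h x hx
    have e0 := sq_ne_zero_of_mem hμ hx 0
    have e1 := sq_ne_zero_of_mem hμ hx 1
    have e2 := sq_ne_zero_of_mem hμ hx 2
    have e3 := sq_ne_zero_of_mem hμ hx 3
    rw [h0] at e0
    rw [h1] at e1
    rw [h2] at e2
    rw [h3] at e3
    simpa using And.intro e1 e0
  refine ⟨![![0, fun _ => 1, fun _ => 0, fun _ => 0], ![fun _ => 0, 0, fun _ => 0, fun _ => 0],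
    ![fun s => s - b, fun s => s, 0, fun s => s], ![fun s => s - b, fun s => s, fun s => -s, 0]],
    ![fun _ => 1, fun _ => 1, fun s => φ₂ s * ((s - b) * s)⁻¹, fun s => φ₃ s * ((s - b) * s)⁻¹],
    hasSeparableForm_of _ _ ?_ ?_ ?_, isCompatible_of ?_⟩
  · intro i j
    fin_cases i <;> fin_cases j <;>
      first | exact .id | exact .neg .id | exact .sub_const .id _ | exact .const _
  · intro i
    fin_cases i
    · exact .const _
    · exact .const _
    · exact h₂.mul (((SmoothInCoord.id.sub_const b).mul .id).inv fun x hx =>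
      mul_ne_zero (hne x hx).2.1 (hne x hx).1.1)
    · exact h₃.mul (((SmoothInCoord.id.sub_const b).mul .id).inv fun x hx =>
      mul_ne_zero (hne x hx).2.2 (hne x hx).1.2)
  · intro x hx
    obtain ⟨h0, h1, h2, h3⟩ := h x hx
    obtain ⟨⟨n0, n1⟩, n2, n3⟩ := hne x hx
    refine ⟨?_, ?_, ?_, ?_⟩
    · exact sq_eq_abs h0 (by simp [abs_mul])
    · exact sq_eq_abs h1 (by simp [abs_mul])
    · exact sq_eq_abs h2 (by
        simp [abs_mul, abs_sub_comm (x 3) (x 2), ← sub_eq_add_neg]; field_simp)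
    · exact sq_eq_abs h3 (by
        simp [abs_mul, abs_sub_comm (x 3) (x 2), ← sub_eq_add_neg]; field_simp)
  · intro x hx
    refine ⟨⟨?_, ?_, ?_⟩, ⟨?_, ?_, ?_⟩, ⟨?_, ?_, ?_⟩, ⟨?_, ?_, ?_⟩⟩ <;>
      simp [CompatAt, -mul_eq_mul_left_iff, -mul_eq_mul_right_iff] <;> ring

theorem IsOfListedKind.separable (hμ : IsDiagonalMetric U μ) (h : IsOfListedKind U μ) :
    ∃ u H, HasSeparableForm U μ u H ∧ IsCompatible U u := by
  rcases h with h | h | h | h | h | h | h | h | h | h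
  exacts [h.separable hμ, h.separable hμ, h.separable hμ, h.separable hμ, h.separable hμ,
    h.separable hμ, h.separable hμ, h.separable hμ, h.separable hμ, h.separable hμ]

end Kinds

/-! ### Pull-back along coordinate changes, and passage to the closure. -/

theorem SmoothInCoord.comp_of_mapsTo {W W' : Set (Fin 4 → ℝ)} {i m : Fin 4} {f y : ℝ → ℝ}
    (hf : SmoothInCoord W' m f) (hy : SmoothInCoord W i y)
    (hmap : ∀ x ∈ W, ∃ x' ∈ W', x' m = y (x i)) : SmoothInCoord W i fun s => f (y s) := by
  refine ContDiffOn.comp (t := (fun x : Fin 4 → ℝ => x m) '' W') hf hy ?_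
  rintro _ ⟨x, hx, rfl⟩
  obtain ⟨x', hx', h⟩ := hmap x hx
  exact ⟨x', hx', h⟩

theorem SmoothInCoord.deriv {W : Set (Fin 4 → ℝ)} (hW : IsOpen W) {i : Fin 4} {y : ℝ → ℝ}
    (hy : SmoothInCoord W i y) : SmoothInCoord W i (deriv y) :=
  ContDiffOn.deriv_of_isOpen hy (isOpen_image hW i) (by simp)

theorem coordMap_apply (σ : Equiv.Perm (Fin 4)) (y : Fin 4 → ℝ → ℝ) (x : Fin 4 → ℝ) (i : Fin 4) :
    coordMap σ y x (σ i) = y i (x i) := by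
  simp [coordMap]

/-- Compatible separable forms can be pulled back along a change of coordinates. -/
theorem IsCoordChange.separable {W W' : Set (Fin 4 → ℝ)} {μ μ' : Fin 4 → (Fin 4 → ℝ) → ℝ}
    (hW : IsOpen W) (hW' : IsOpen W') (h : IsCoordChange W μ W' μ')
    (hs : ∃ u H, HasSeparableForm W' μ' u H ∧ IsCompatible W' u) :
    ∃ u H, HasSeparableForm W μ u H ∧ IsCompatible W u := by
  obtain ⟨σ, y, hy, -, hbij, hμ⟩ := h
  obtain ⟨u, H, hsep, hcomp⟩ := hs
  have hmap : ∀ i, ∀ x ∈ W, ∃ x' ∈ W', x' (σ i) = y i (x i) := fun i x hx =>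
    ⟨coordMap σ y x, hbij.mapsTo hx, coordMap_apply σ y x i⟩
  -- The factors are merely composed with the coordinate change; the Jacobian factor (y_i')² depends
  -- on x_i only and goes into H_i.
  refine ⟨fun i j s => u (σ i) (σ j) (y i s), fun i s => deriv (y i) s ^ 2 * H (σ i) (y i s),
    ⟨fun i j => (hsep.smooth_u _ _).comp_of_mapsTo (hy i) (hmap i), fun i =>
      (((hy i).deriv hW).pow 2).mul ((hsep.smooth_H _).comp_of_mapsTo (hy i) (hmap i)),
      fun x hx i => ?_⟩, ?_⟩
  · rw [hμ x hx i, mul_pow, sq_abs, hsep.sq _ (hbij.mapsTo hx), coordMap_apply, mul_assoc,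
      abs_mul (_ ^ 2), abs_of_nonneg (sq_nonneg (deriv (y i) (x i)))]
    congr 3
    refine (Finset.prod_bij (fun j _ => σ j) ?_ ?_ ?_ ?_).symm
    · intro j hj; simpa using hj
    · intro j _ k _ hjk; exact σ.injective hjk
    · intro m hm
      refine ⟨σ.symm m, ?_, by simp⟩
      have : m ≠ σ i := by simpa using hm
      simpa [Equiv.symm_apply_eq] using this
    · intro j _
      simp [sepFactor, coordMap_apply]
  · intro x hx i j k hij hik hjk
    have hd : ∀ i j, deriv (fun s => u (σ i) (σ j) (y i s)) (x i)
        = deriv (u (σ i) (σ j)) (y i (x i)) * deriv (y i) (x i) := by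
      intro i j
      have h1 := (hsep.smooth_u (σ i) (σ j)).hasDerivAt hW' (hbij.mapsTo hx)
      rw [coordMap_apply] at h1
      exact (h1.comp (x i) ((hy i).hasDerivAt hW hx)).deriv
    have h1 := hcomp _ (hbij.mapsTo hx) (σ i) (σ j) (σ k) (σ.injective.ne hij)
      (σ.injective.ne hik) (σ.injective.ne hjk)
    simp only [hd]
    simp only [sepFactor, coordMap_apply] at h1 ⊢
    -- By the chain rule every term of the relation acquires the same factor y_j' y_k'.
    linear_combination deriv (y j) (x j) * deriv (y k) (x k) * h1

theorem eq_zero_of_dense {U V : Set (Fin 4 → ℝ)} (hU : IsOpen U) (hVU : U ⊆ closure V)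
    {f : (Fin 4 → ℝ) → ℝ} (hf : ContinuousOn f U) (h0 : ∀ x ∈ V, x ∈ U → f x = 0) {x : Fin 4 → ℝ}
    (hx : x ∈ U) : f x = 0 := by
  by_contra hne
  have h1 : ∀ᶠ y in nhds x, f y ≠ 0 := (hf.continuousAt (hU.mem_nhds hx)).eventually_ne hne
  obtain ⟨y, ⟨hy1, hy2⟩, hyV⟩ := mem_closure_iff_nhds.1 (hVU hx) _ (h1.and (hU.mem_nhds hx))
  exact hy1 (h0 y hyV hy2)

/-- The Stäckel system holds on an open set as soon as it holds near the points of a dense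
subset. -/
theorem stackelSystem_of_dense {U V : Set (Fin 4 → ℝ)} (hU : IsOpen U)
    {μ : Fin 4 → (Fin 4 → ℝ) → ℝ} (hμ : IsDiagonalMetric U μ) (hVU : U ⊆ closure V)
    (h : ∀ p ∈ V, ∃ W, p ∈ W ∧ StackelSystem W μ) : StackelSystem U μ := by
  have h1 : ∀ i j, ContinuousOn (pderiv j (logCoeff μ i)) U := fun i j =>
    (contDiffOn_pderiv hU (contDiffOn_logCoeff hμ i) j).continuousOn
  have h2 : ∀ i j k, ContinuousOn (pderiv k (pderiv j (logCoeff μ i))) U := fun i j k =>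
    (contDiffOn_pderiv hU (contDiffOn_pderiv hU (contDiffOn_logCoeff hμ i) j) k).continuousOn
  refine ⟨fun x hx i j k hij hik hjk => ?_, fun x hx i j k hij hik hjk => ?_,
    fun x hx i j hij => ?_⟩
  · refine eq_zero_of_dense hU hVU (f := fun x => _) ((((h1 i j).mul (h1 j k)).add
      ((h1 i k).mul (h1 k j))).sub ((h1 i j).mul (h1 i k))) (fun y hy _ => ?_) hx
    obtain ⟨W, hyW, hW⟩ := h y hy
    exact hW.first y hyW i j k hij hik hjk
  · refine eq_zero_of_dense hU hVU (f := fun x => _) (h2 i j k) (fun y hy _ => ?_) hx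
    obtain ⟨W, hyW, hW⟩ := h y hy
    exact hW.second y hyW i j k hij hik hjk
  · refine eq_zero_of_dense hU hVU (f := fun x => _) ((h2 i i j).add
      ((continuousOn_const.mul (h1 i j)).mul (h1 j i))) (fun y hy _ => ?_) hx
    obtain ⟨W, hyW, hW⟩ := h y hy
    exact hW.third y hyW i j hij

theorem IsDiagonalMetric.mono {U W : Set (Fin 4 → ℝ)} {μ : Fin 4 → (Fin 4 → ℝ) → ℝ}
    (h : IsDiagonalMetric U μ) (hWU : W ⊆ U) : IsDiagonalMetric W μ :=
  ⟨fun i => (h.smooth i).mono hWU, fun i x hx => h.pos i x (hWU hx)⟩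

theorem StackelSystem.mono {U W : Set (Fin 4 → ℝ)} {μ : Fin 4 → (Fin 4 → ℝ) → ℝ}
    (h : StackelSystem U μ) (hWU : W ⊆ U) : StackelSystem W μ :=
  ⟨fun x hx => h.first x (hWU hx), fun x hx => h.second x (hWU hx),
    fun x hx => h.third x (hWU hx)⟩

theorem IsOfListedKind.stackelSystem {U : Set (Fin 4 → ℝ)} (hU : IsOpen U)
    {μ : Fin 4 → (Fin 4 → ℝ) → ℝ} (hμ : IsDiagonalMetric U μ) (h : IsOfListedKind U μ) :
    StackelSystem U μ := by
  obtain ⟨u, H, h1, h2⟩ := h.separable hμ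
  exact h1.stackelSystem h2 hμ hU

theorem IsLocallyOfListedKind.exists_stackelSystem {U : Set (Fin 4 → ℝ)}
    {μ : Fin 4 → (Fin 4 → ℝ) → ℝ} (hμ : IsDiagonalMetric U μ) {p : Fin 4 → ℝ}
    (h : IsLocallyOfListedKind U μ p) : ∃ W, p ∈ W ∧ StackelSystem W μ := by
  obtain ⟨W, hW, hpW, hWU, W', μ', hW', hμ', hcc, hk⟩ := h
  obtain ⟨u, H, h1, h2⟩ := hcc.separable hW hW' (hk.separable hμ')
  exact ⟨W, hpW, h1.stackelSystem h2 (hμ.mono hWU) hW⟩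

/-! ### From the Stäckel system to a separable form on a box. -/

theorem eq_of_hasDerivAt_zero {I : Set ℝ} (hI : IsOpen I) (hI' : IsPreconnected I) {f : ℝ → ℝ}
    (h : ∀ s ∈ I, HasDerivAt f 0 s) {s t : ℝ} (hs : s ∈ I) (ht : t ∈ I) : f s = f t :=
  hI.is_const_of_deriv_eq_zero hI'
    (fun r hr => (h r hr).differentiableAt.differentiableWithinAt) (fun r hr => (h r hr).deriv)
    hs ht

/-- If `∂₂α` and `∂₁β` satisfy `∂₁∂₂α = -2 ∂₂α ∂₁β = ∂₂∂₁β`, a certain exponential is the sum of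
functions of one variable. -/
theorem exp_eq_add_of_planar {I J : Set ℝ} (hI : IsOpen I) (hI' : IsPreconnected I)
    (hJ : IsOpen J) (hJ' : IsPreconnected J) {p q : ℝ} (hp : p ∈ I) (hq : q ∈ J)
    {α β α₁ α₂ β₁ c : ℝ → ℝ → ℝ}
    (hα₁ : ∀ s ∈ I, ∀ t ∈ J, HasDerivAt (fun r => α r t) (α₁ s t) s)
    (hα₂ : ∀ s ∈ I, ∀ t ∈ J, HasDerivAt (α s) (α₂ s t) t)
    (hβ₁ : ∀ s ∈ I, ∀ t ∈ J, HasDerivAt (fun r => β r t) (β₁ s t) s)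
    (hα₁₂ : ∀ s ∈ I, ∀ t ∈ J, HasDerivAt (α₁ s) (c s t) t)
    (hα₂₁ : ∀ s ∈ I, ∀ t ∈ J, HasDerivAt (fun r => α₂ r t) (c s t) s)
    (hβ₁₂ : ∀ s ∈ I, ∀ t ∈ J, HasDerivAt (β₁ s) (c s t) t)
    (hc : ∀ s ∈ I, ∀ t ∈ J, c s t = -(2 * α₂ s t * β₁ s t))
    {s t : ℝ} (hs : s ∈ I) (ht : t ∈ J) :
    Real.exp (2 * (α s t - α s q + β s q - β p q))
      = Real.exp (2 * (β s q - β p q)) + Real.exp (2 * (α p t - α p q)) - 1 := by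
  -- The mixed derivatives of α and β coincide, so ∂₁(α - β) does not depend on the second variable.
  have hdiff : ∀ s ∈ I, ∀ t ∈ J, α₁ s t - β₁ s t = α₁ s q - β₁ s q := fun s hs t ht =>
    eq_of_hasDerivAt_zero hJ hJ' (f := fun t => α₁ s t - β₁ s t)
      (fun r hr => ((hα₁₂ s hs r hr).sub (hβ₁₂ s hs r hr)).congr_deriv (sub_self _)) ht hq
  -- The correction terms at t = q depend on s only; they turn the logarithmic derivative in s from
  -- 2α₁ into 2β₁ and leave the one in t unchanged.
  have h₁ : ∀ s ∈ I, ∀ t ∈ J,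
      HasDerivAt (fun s => Real.exp (2 * (α s t - α s q + β s q - β p q)))
        (Real.exp (2 * (α s t - α s q + β s q - β p q)) * (2 * β₁ s t)) s := by
    intro s hs t ht
    have := (((((hα₁ s hs t ht).sub (hα₁ s hs q hq)).add (hβ₁ s hs q hq)).sub_const
      (β p q)).const_mul 2).exp
    refine this.congr_deriv ?_
    have := hdiff s hs t ht
    rw [show α₁ s t - α₁ s q + β₁ s q = β₁ s t by linarith]
    rfl
  have h₂ : ∀ s ∈ I, ∀ t ∈ J,
      HasDerivAt (fun t => Real.exp (2 * (α s t - α s q + β s q - β p q)))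
        (Real.exp (2 * (α s t - α s q + β s q - β p q)) * (2 * α₂ s t)) t := fun s hs t ht =>
    ((((hα₂ s hs t ht).sub_const _).add_const _).sub_const _ |>.const_mul 2).exp
  -- The mixed derivative of the exponential E is 2E(2α₂β₁ + c) = 0, so its t-derivative does not
  -- vary with s.
  have h₂₁ : ∀ s ∈ I, ∀ t ∈ J,
      Real.exp (2 * (α s t - α s q + β s q - β p q)) * (2 * α₂ s t)
        = Real.exp (2 * (α p t - α p q + β p q - β p q)) * (2 * α₂ p t) := fun s hs t ht =>
    eq_of_hasDerivAt_zero hI hI'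
      (f := fun s => Real.exp (2 * (α s t - α s q + β s q - β p q)) * (2 * α₂ s t))
      (fun r hr => ((h₁ r hr t ht).mul ((hα₂₁ r hr t ht).const_mul 2)).congr_deriv (by
        rw [hc r hr t ht]; ring)) hs hp
  -- Thus E(s,·) - E(p,·) is constant; its value at t = q gives the claim, because E(p,q) = 1.
  have key := eq_of_hasDerivAt_zero hJ hJ'
    (f := fun t => Real.exp (2 * (α s t - α s q + β s q - β p q))
      - Real.exp (2 * (α p t - α p q + β p q - β p q)))
    (fun r hr => ((h₂ s hs r hr).sub (h₂ p hp r hr)).congr_deriv (by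
      rw [h₂₁ s hs r hr]; ring)) ht hq
  simp only [sub_self, zero_add, add_sub_cancel_right, mul_zero, Real.exp_zero] at key
  linarith

section Box

variable {I : Fin 4 → Set ℝ} {p : Fin 4 → ℝ}

theorem update_mem_pi {x : Fin 4 → ℝ} (hx : x ∈ Set.univ.pi I) {j : Fin 4} {s : ℝ}
    (hs : s ∈ I j) : update x j s ∈ Set.univ.pi I := by
  intro k _
  by_cases h : k = j
  · subst h; simpa using hs
  · rw [update_of_ne h]; exact hx k trivial

theorem eq_update_of_pderiv_eq_zero (hI : ∀ i, IsOpen (I i)) (hI' : ∀ i, IsPreconnected (I i))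
    {F : (Fin 4 → ℝ) → ℝ} (hF : ContDiffOn ℝ ∞ F (Set.univ.pi I)) {j : Fin 4}
    (h : ∀ x ∈ Set.univ.pi I, pderiv j F x = 0) {x : Fin 4 → ℝ} (hx : x ∈ Set.univ.pi I)
    {s : ℝ} (hs : s ∈ I j) : F x = F (update x j s) := by
  have hopen : IsOpen (Set.univ.pi I) := isOpen_set_pi Set.finite_univ fun i _ => hI i
  have := eq_of_hasDerivAt_zero (hI j) (hI' j) (f := fun r => F (update x j r)) (fun r hr => by
    have hr' := update_mem_pi hx hr
    rw [← h _ hr']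
    exact hasDerivAt_pderiv_update j
      ((hF.contDiffAt (hopen.mem_nhds hr')).differentiableAt (by simp))) (hx j trivial) hs
  simpa using this

/-- The x_j-derivative of the difference on the left is a difference of two values of ∂_jF on a line
along which ∂_jF is constant. -/
theorem sub_update_eq_of_mixed_eq_zero (hI : ∀ i, IsOpen (I i))
    (hI' : ∀ i, IsPreconnected (I i))
    (hp : ∀ i, p i ∈ I i) {F : (Fin 4 → ℝ) → ℝ} (hF : ContDiffOn ℝ ∞ F (Set.univ.pi I))
    {j k : Fin 4} (hjk : j ≠ k) (h : ∀ x ∈ Set.univ.pi I, pderiv k (pderiv j F) x = 0)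
    {x : Fin 4 → ℝ} (hx : x ∈ Set.univ.pi I) :
    F x - F (update x k (p k))
      = F (update x j (p j)) - F (update (update x j (p j)) k (p k)) := by
  have hopen : IsOpen (Set.univ.pi I) := isOpen_set_pi Set.finite_univ fun i _ => hI i
  have hd : ∀ y ∈ Set.univ.pi I, DifferentiableAt ℝ F y := fun y hy =>
    (hF.contDiffAt (hopen.mem_nhds hy)).differentiableAt (by simp)
  have hxk := update_mem_pi hx (hp k)
  have := eq_of_hasDerivAt_zero (hI j) (hI' j)
    (f := fun r => F (update x j r) - F (update (update x k (p k)) j r)) (fun r hr => by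
      have h1 := hasDerivAt_pderiv_update j (hd _ (update_mem_pi hx hr))
      have h2 := hasDerivAt_pderiv_update j (hd _ (update_mem_pi hxk hr))
      refine (h1.sub h2).congr_deriv ?_
      rw [eq_update_of_pderiv_eq_zero hI hI' (contDiffOn_pderiv hopen hF j) h
        (update_mem_pi hx hr) (hp k), update_comm hjk.symm, sub_self]) (hx j trivial) (hp j)
  simp only [update_eq_self] at this
  rw [update_comm hjk, ← this]
  congr 2
  ext m
  by_cases hm : m = j
  · subst hm; simp [update_of_ne hjk]
  · rw [update_of_ne hm]

/-- With x_i frozen, F is a sum of functions of x_j, x_k and x_l separately. Three instances of the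
two-variable identity telescope, and the common value on the x_i-line through p is subtracted twice.
-/
theorem eq_sum_planar_of_mixed_eq_zero (hI : ∀ i, IsOpen (I i))
    (hI' : ∀ i, IsPreconnected (I i)) (hp : ∀ i, p i ∈ I i) {F : (Fin 4 → ℝ) → ℝ}
    (hF : ContDiffOn ℝ ∞ F (Set.univ.pi I))
    {i j k l : Fin 4} (hij : i ≠ j) (hik : i ≠ k) (hil : i ≠ l) (hjk : j ≠ k) (hjl : j ≠ l)
    (hkl : k ≠ l) (hall : ∀ m, m = i ∨ m = j ∨ m = k ∨ m = l)
    (h : ∀ x ∈ Set.univ.pi I, ∀ a b, i ≠ a → i ≠ b → a ≠ b → pderiv b (pderiv a F) x = 0)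
    {x : Fin 4 → ℝ} (hx : x ∈ Set.univ.pi I) :
    F x = F (update (update p i (x i)) j (x j)) + F (update (update p i (x i)) k (x k))
      + F (update (update p i (x i)) l (x l)) - 2 * F (update p i (x i)) := by
  have e1 := sub_update_eq_of_mixed_eq_zero hI hI' hp hF hjl
    (fun y hy => h y hy j l hij hil hjl) hx
  have e2 := sub_update_eq_of_mixed_eq_zero hI hI' hp hF hkl
    (fun y hy => h y hy k l hik hil hkl) (update_mem_pi hx (hp j))
  have e3 := sub_update_eq_of_mixed_eq_zero hI hI' hp hF hjk
    (fun y hy => h y hy j k hij hik hjk) (update_mem_pi hx (hp l))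
  have c1 : update (update x j (p j)) k (p k) = update (update p i (x i)) l (x l) := by
    ext m; rcases hall m with rfl | rfl | rfl | rfl <;> simp [update_apply, hij, hik, hil, hjk, hjl, hkl,
      hij.symm, hik.symm, hil.symm, hjk.symm, hjl.symm, hkl.symm]
  have c2 : update (update (update x j (p j)) k (p k)) l (p l) = update p i (x i) := by
    ext m; rcases hall m with rfl | rfl | rfl | rfl <;> simp [update_apply, hij, hik, hil, hjk, hjl, hkl,
      hij.symm, hik.symm, hil.symm, hjk.symm, hjl.symm, hkl.symm]
  have c3 : update (update x l (p l)) j (p j) = update (update p i (x i)) k (x k) := by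
    ext m; rcases hall m with rfl | rfl | rfl | rfl <;> simp [update_apply, hij, hik, hil, hjk, hjl, hkl,
      hij.symm, hik.symm, hil.symm, hjk.symm, hjl.symm, hkl.symm]
  have c4 : update (update (update x l (p l)) j (p j)) k (p k) = update p i (x i) := by
    ext m; rcases hall m with rfl | rfl | rfl | rfl <;> simp [update_apply, hij, hik, hil, hjk, hjl, hkl,
      hij.symm, hik.symm, hil.symm, hjk.symm, hjl.symm, hkl.symm]
  have c5 : update (update x l (p l)) k (p k) = update (update p i (x i)) j (x j) := by
    ext m; rcases hall m with rfl | rfl | rfl | rfl <;> simp [update_apply, hij, hik, hil, hjk, hjl, hkl,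
      hij.symm, hik.symm, hil.symm, hjk.symm, hjl.symm, hkl.symm]
  rw [c2, c1] at e2
  rw [c4, c3, c5] at e3
  linarith

end Box

/-- A normalised compatible separable form on the open box with sides `I i` around the point `p`. -/
structure NormalForm (I : Fin 4 → Set ℝ) (p : Fin 4 → ℝ) (μ : Fin 4 → (Fin 4 → ℝ) → ℝ)
    (u : Fin 4 → Fin 4 → ℝ → ℝ) (H : Fin 4 → ℝ → ℝ) : Prop where
  isOpen : ∀ i, IsOpen (I i)
  isPreconnected : ∀ i, IsPreconnected (I i)
  mem : ∀ i, p i ∈ I i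
  metric : IsDiagonalMetric (Set.univ.pi I) μ
  smooth_u : ∀ i j, ContDiffOn ℝ ∞ (u i j) (I i)
  smooth_H : ∀ i, ContDiffOn ℝ ∞ (H i) (I i)
  H_pos : ∀ i, ∀ s ∈ I i, 0 < H i s
  base : ∀ i j, u i j (p i) = 1 / 2
  pos : ∀ i j, i ≠ j → ∀ s ∈ I i, ∀ t ∈ I j, 0 < u i j s + u j i t
  sq : ∀ x ∈ Set.univ.pi I, ∀ i,
    μ i x ^ 2 = H i (x i) * ∏ j ∈ Finset.univ.erase i, (u i j (x i) + u j i (x j))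
  compat : ∀ i j k, i ≠ j → i ≠ k → j ≠ k → ∀ s ∈ I i, ∀ t ∈ I j, ∀ r ∈ I k,
    deriv (u j i) t * deriv (u k j) r * (u i k s + u k i r)
      + deriv (u k i) r * deriv (u j k) t * (u i j s + u j i t)
      = deriv (u j i) t * deriv (u k i) r * (u j k t + u k j r)

theorem smoothInCoord_pi_iff {I : Fin 4 → Set ℝ} {p : Fin 4 → ℝ} (hp : ∀ i, p i ∈ I i)
    {i : Fin 4} {f : ℝ → ℝ} :
    SmoothInCoord (Set.univ.pi I) i f ↔ ContDiffOn ℝ ∞ f (I i) := by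
  have : (fun x : Fin 4 → ℝ => x i) '' Set.univ.pi I = I i :=
    Set.eval_image_univ_pi ⟨p, fun i _ => hp i⟩
  rw [SmoothInCoord, this]

section Box

variable {I : Fin 4 → Set ℝ} {p : Fin 4 → ℝ} {μ : Fin 4 → (Fin 4 → ℝ) → ℝ}

theorem exp_two_mul_logCoeff {U : Set (Fin 4 → ℝ)} (hμ : IsDiagonalMetric U μ) {x : Fin 4 → ℝ}
    (hx : x ∈ U) (i : Fin 4) : Real.exp (2 * logCoeff μ i x) = μ i x ^ 2 := by
  have h := hμ.pos i x hx
  rw [logCoeff, mul_comm, Real.exp_mul, Real.exp_log h]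
  exact Real.rpow_two _

/-- For a solution of the Stäckel system, `μ_i²` restricted to the coordinate plane through `p` is
the product of a function of `x_i` and the sum of functions of `x_i` and `x_j`. -/
theorem StackelSystem.planar (hI : ∀ i, IsOpen (I i)) (hI' : ∀ i, IsPreconnected (I i))
    (hp : ∀ i, p i ∈ I i) (hμ : IsDiagonalMetric (Set.univ.pi I) μ)
    (h : StackelSystem (Set.univ.pi I) μ) {i j : Fin 4} (hij : i ≠ j) {s t : ℝ} (hs : s ∈ I i)
    (ht : t ∈ I j) :
    μ i (update (update p i s) j t) ^ 2 / μ i (update p i s) ^ 2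
      * (μ j (update p i s) ^ 2 / μ j p ^ 2)
      = μ j (update p i s) ^ 2 / μ j p ^ 2 + μ i (update p j t) ^ 2 / μ i p ^ 2 - 1 := by
  have hU : IsOpen (Set.univ.pi I) := isOpen_set_pi Set.finite_univ fun i _ => hI i
  have hpU : p ∈ Set.univ.pi I := fun i _ => hp i
  have hsm := contDiffOn_logCoeff hμ
  have hsmd := fun a b => contDiffOn_pderiv hU (hsm a) b
  have hd : ∀ (F : (Fin 4 → ℝ) → ℝ), ContDiffOn ℝ ∞ F (Set.univ.pi I) → ∀ x ∈ Set.univ.pi I,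
      DifferentiableAt ℝ F x := fun F hF x hx =>
    (hF.contDiffAt (hU.mem_nhds hx)).differentiableAt (by simp)
  have hmem : ∀ s ∈ I i, ∀ t ∈ I j, update (update p i s) j t ∈ Set.univ.pi I :=
    fun s hs t ht => update_mem_pi (update_mem_pi hpU hs) ht
  have h1 : ∀ F : (Fin 4 → ℝ) → ℝ, ContDiffOn ℝ ∞ F (Set.univ.pi I) → ∀ s ∈ I i, ∀ t ∈ I j,
      HasDerivAt (fun r => F (update (update p i r) j t))
        (pderiv i F (update (update p i s) j t)) s := by
    intro F hF s hs t ht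
    simp only [update_comm hij]
    exact hasDerivAt_pderiv_update i (hd F hF _ (by rw [update_comm hij.symm]; exact hmem s hs t ht))
  have h2 : ∀ F : (Fin 4 → ℝ) → ℝ, ContDiffOn ℝ ∞ F (Set.univ.pi I) → ∀ s ∈ I i, ∀ t ∈ I j,
      HasDerivAt (fun r => F (update (update p i s) j r))
        (pderiv j F (update (update p i s) j t)) t := by
    intro F hF s hs t ht
    exact hasDerivAt_pderiv_update j (hd F hF _ (hmem s hs t ht))
  -- The planar lemma is used with α = ν_i and β = ν_j. The third equation for (i, j) and for (j,
  -- i), together with the symmetry of second derivatives, gives both the same mixed derivative c.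
  have key := exp_eq_add_of_planar (hI i) (hI' i) (hI j) (hI' j) (hp i) (hp j)
    (α := fun s t => logCoeff μ i (update (update p i s) j t))
    (β := fun s t => logCoeff μ j (update (update p i s) j t))
    (c := fun s t => pderiv j (pderiv i (logCoeff μ i)) (update (update p i s) j t))
    (h1 _ (hsm i)) (h2 _ (hsm i)) (h1 _ (hsm j)) (h2 _ (hsmd i i))
    (fun s hs t ht => by
      rw [← pderiv_comm hU (hsm i) (hmem s hs t ht)]
      exact h1 _ (hsmd i j) s hs t ht)
    (fun s hs t ht => by
      have e1 := h.third _ (hmem s hs t ht) i j hij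
      have e2 := h.third _ (hmem s hs t ht) j i hij.symm
      rw [pderiv_comm hU (hsm j) (hmem s hs t ht)] at e2
      exact (h2 _ (hsmd j i) s hs t ht).congr_deriv (by linarith))
    (fun s hs t ht => by
      have e1 := h.third _ (hmem s hs t ht) i j hij
      linarith) hs ht
  have e1 : update (update p i s) j (p j) = update p i s := by
    rw [update_comm hij, update_eq_self]
  rw [update_eq_self, update_eq_self, e1] at key
  have hms := update_mem_pi hpU hs
  have hmt := update_mem_pi hpU ht
  have hE : ∀ x ∈ Set.univ.pi I, ∀ y ∈ Set.univ.pi I, ∀ a b,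
      Real.exp (2 * (logCoeff μ a x - logCoeff μ b y)) = μ a x ^ 2 / μ b y ^ 2 := by
    intro x hx y hy a b
    rw [mul_sub, Real.exp_sub, exp_two_mul_logCoeff hμ hx, exp_two_mul_logCoeff hμ hy]
  rw [hE _ hms _ hpU, hE _ hmt _ hpU, add_sub_assoc, mul_add, Real.exp_add,
    hE _ (hmem s hs t ht) _ hms, hE _ hms _ hpU] at key
  exact key

theorem contDiffOn_comp_update (hp : ∀ i, p i ∈ I i)
    {F : (Fin 4 → ℝ) → ℝ} (hF : ContDiffOn ℝ ∞ F (Set.univ.pi I)) (i : Fin 4) :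
    ContDiffOn ℝ ∞ (fun s => F (update p i s)) (I i) :=
  hF.comp (contDiff_update ∞ p i).contDiffOn fun _ hs => update_mem_pi (fun i _ => hp i) hs

/-- This is the exponential of the additive splitting of 2ν_i into planar pieces. -/
theorem sq_eq_prod_planar (hI : ∀ i, IsOpen (I i)) (hI' : ∀ i, IsPreconnected (I i))
    (hp : ∀ i, p i ∈ I i) (hμ : IsDiagonalMetric (Set.univ.pi I) μ)
    (h : StackelSystem (Set.univ.pi I) μ) {x : Fin 4 → ℝ} (hx : x ∈ Set.univ.pi I) (i : Fin 4) :
    μ i x ^ 2 = μ i (update p i (x i)) ^ 2 * ∏ j ∈ Finset.univ.erase i,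
      (μ i (update (update p i (x i)) j (x j)) ^ 2 / μ i (update p i (x i)) ^ 2) := by
  have hpU : p ∈ Set.univ.pi I := fun i _ => hp i
  have key : ∀ j k l : Fin 4, i ≠ j → i ≠ k → i ≠ l → j ≠ k → j ≠ l → k ≠ l →
      (∀ m, m = i ∨ m = j ∨ m = k ∨ m = l) → Finset.univ.erase i = {j, k, l} →
      μ i x ^ 2 = μ i (update p i (x i)) ^ 2 * ∏ j ∈ Finset.univ.erase i,
        (μ i (update (update p i (x i)) j (x j)) ^ 2 / μ i (update p i (x i)) ^ 2) := by
    intro j k l hij hik hil hjk hjl hkl hall hset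
    have h1 := eq_sum_planar_of_mixed_eq_zero hI hI' hp (contDiffOn_logCoeff hμ i) hij hik hil hjk
      hjl hkl hall (fun y hy a b ha hb hab => h.second y hy i a b ha hb hab) hx
    have hmi := update_mem_pi hpU (hx i trivial)
    have h0 := hμ.pos i _ hmi
    have h2 := congrArg (fun r => Real.exp (2 * r)) h1
    simp only [mul_add, mul_sub, Real.exp_add, Real.exp_sub] at h2
    rw [exp_two_mul_logCoeff hμ hx, exp_two_mul_logCoeff hμ (update_mem_pi hmi (hx j trivial)),
      exp_two_mul_logCoeff hμ (update_mem_pi hmi (hx k trivial)),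
      exp_two_mul_logCoeff hμ (update_mem_pi hmi (hx l trivial)), two_mul (2 * logCoeff _ _ _),
      Real.exp_add, exp_two_mul_logCoeff hμ hmi] at h2
    rw [hset, Finset.prod_insert (by simp [hjk, hjl]), Finset.prod_insert (by simp [hkl]),
      Finset.prod_singleton, h2]
    field_simp
  have hi : i = 0 ∨ i = 1 ∨ i = 2 ∨ i = 3 := by clear key; revert i; decide
  rcases hi with rfl | rfl | rfl | rfl
  · apply key 1 2 3 <;> decide
  · apply key 0 2 3 <;> decide
  · apply key 0 1 3 <;> decide
  · apply key 0 1 2 <;> decide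

/-- A solution of the Stäckel system on a box has a normalised compatible separable form. -/
theorem StackelSystem.exists_normalForm (hI : ∀ i, IsOpen (I i))
    (hI' : ∀ i, IsPreconnected (I i)) (hp : ∀ i, p i ∈ I i)
    (hμ : IsDiagonalMetric (Set.univ.pi I) μ) (h : StackelSystem (Set.univ.pi I) μ) :
    ∃ u H, NormalForm I p μ u H := by
  have hU : IsOpen (Set.univ.pi I) := isOpen_set_pi Set.finite_univ fun i _ => hI i
  have hpU : p ∈ Set.univ.pi I := fun i _ => hp i
  -- The constant -1 of the planar identity is shared equally between the two summands. The
  -- definition is then the same for (i, j) and (j, i), and every S_ij equals 1 at p.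
  set u : Fin 4 → Fin 4 → ℝ → ℝ := fun i j s => μ j (update p i s) ^ 2 / μ j p ^ 2 - 1 / 2 with hu
  -- The planar ratio is S_ij times μ_j(p)² / μ_j² on the x_i-line; these one-variable quotients are
  -- collected here.
  set H : Fin 4 → ℝ → ℝ := fun i s => μ i (update p i s) ^ 2 *
    ∏ j ∈ Finset.univ.erase i, (μ j p ^ 2 / μ j (update p i s) ^ 2) with hH
  have hpl : ∀ i j, i ≠ j → ∀ s ∈ I i, ∀ t ∈ I j, u i j s + u j i t =
      μ i (update (update p i s) j t) ^ 2 / μ i (update p i s) ^ 2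
      * (μ j (update p i s) ^ 2 / μ j p ^ 2) := by
    intro i j hij s hs t ht
    rw [h.planar hI hI' hp hμ hij hs ht]
    simp only [hu]
    ring
  have hpos : ∀ i j, i ≠ j → ∀ s ∈ I i, ∀ t ∈ I j, 0 < u i j s + u j i t := by
    intro i j hij s hs t ht
    rw [hpl i j hij s hs t ht]
    have hms := update_mem_pi hpU hs
    have h1 := hμ.pos i _ hms
    have h2 := hμ.pos j _ hms
    have h3 := hμ.pos j p hpU
    have h4 := hμ.pos i _ (update_mem_pi hms ht)
    positivity
  have hsmu : ∀ i j, ContDiffOn ℝ ∞ (u i j) (I i) := fun i j =>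
    (((contDiffOn_comp_update hp (hμ.smooth j) i).pow 2).div_const _).sub contDiffOn_const
  have hsmH : ∀ i, ContDiffOn ℝ ∞ (H i) (I i) := by
    intro i
    refine ((contDiffOn_comp_update hp (hμ.smooth i) i).pow 2).mul (contDiffOn_prod fun j _ =>
      contDiffOn_const.div ((contDiffOn_comp_update hp (hμ.smooth j) i).pow 2) fun s hs => ?_)
    exact pow_ne_zero _ (hμ.pos j _ (update_mem_pi hpU hs)).ne'
  have hHpos : ∀ i, ∀ s ∈ I i, 0 < H i s := by
    intro i s hs
    have hms := update_mem_pi hpU hs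
    refine mul_pos (pow_pos (hμ.pos i _ hms) 2) (Finset.prod_pos fun j _ => ?_)
    exact div_pos (pow_pos (hμ.pos j _ hpU) 2) (pow_pos (hμ.pos j _ hms) 2)
  have hsq : ∀ x ∈ Set.univ.pi I, ∀ i,
      μ i x ^ 2 = H i (x i) * ∏ j ∈ Finset.univ.erase i, (u i j (x i) + u j i (x j)) := by
    intro x hx i
    rw [sq_eq_prod_planar hI hI' hp hμ h hx i]
    simp only [hH]
    rw [mul_assoc, ← Finset.prod_mul_distrib]
    congr 1
    refine Finset.prod_congr rfl fun j hj => ?_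
    rw [hpl i j (Finset.ne_of_mem_erase hj).symm _ (hx i trivial) _ (hx j trivial)]
    have h1 := (hμ.pos j p hpU).ne'
    have h2 := (hμ.pos j _ (update_mem_pi hpU (hx i trivial))).ne'
    field_simp
  have hsep : HasSeparableForm (Set.univ.pi I) μ u H := by
    refine ⟨fun i j => (smoothInCoord_pi_iff hp).2 (hsmu i j),
      fun i => (smoothInCoord_pi_iff hp).2 (hsmH i), fun x hx i => ?_⟩
    rw [hsq x hx i, abs_of_pos]
    · rfl
    · exact lt_of_lt_of_eq (pow_pos (hμ.pos i x hx) 2) (hsq x hx i)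
  refine ⟨u, H, hI, hI', hp, hμ, hsmu, hsmH, hHpos, fun i j => ?_, hpos, hsq, ?_⟩
  · have := (hμ.pos j p hpU).ne'
    simp only [hu, update_eq_self]
    rw [div_self (pow_ne_zero _ this)]
    norm_num
  · intro i j k hij hik hjk s hs t ht r hr
    have hx : update (update (update p i s) j t) k r ∈ Set.univ.pi I :=
      update_mem_pi (update_mem_pi (update_mem_pi hpU hs) ht) hr
    have := (hsep.isCompatible_iff_first hμ hU hx hij hik hjk).1 (h.first _ hx i j k hij hik hjk)
    simpa [sepFactor, hij, hik, hjk, hij.symm, hik.symm, hjk.symm] using this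

end Box

/-! ### Dependences between coordinates and rigidity of the factors. -/

/-- The factor of `μ_i` that involves `x_j` has nowhere vanishing derivative in `x_j`. -/
def Dep (I : Fin 4 → Set ℝ) (u : Fin 4 → Fin 4 → ℝ → ℝ) (i j : Fin 4) : Prop :=
  ∀ t ∈ I j, deriv (u j i) t ≠ 0

/-- The coefficient `μ_i` does not depend on `x_j`. -/
def Indep (I : Fin 4 → Set ℝ) (u : Fin 4 → Fin 4 → ℝ → ℝ) (i j : Fin 4) : Prop :=
  ∀ t ∈ I j, deriv (u j i) t = 0

/-- The hypothesis is the vanishing of the numerator in the quotient rule. -/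
theorem eqOn_const_of_ratio {I : Set ℝ} (hI : IsOpen I) (hI' : IsPreconnected I) {f g : ℝ → ℝ}
    {f' g' : ℝ → ℝ} (hf : ∀ t ∈ I, HasDerivAt f (f' t) t) (hg : ∀ t ∈ I, HasDerivAt g (g' t) t)
    (hg0 : ∀ t ∈ I, g t ≠ 0) (h : ∀ t ∈ I, f' t * g t = f t * g' t) {s t : ℝ} (hs : s ∈ I)
    (ht : t ∈ I) : f s / g s = f t / g t :=
  eq_of_hasDerivAt_zero hI hI' (f := fun t => f t / g t) (fun r hr =>
    ((hf r hr).div (hg r hr) (hg0 r hr)).congr_deriv (by rw [h r hr]; simp)) hs ht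

namespace NormalForm

variable {I : Fin 4 → Set ℝ} {p : Fin 4 → ℝ} {μ : Fin 4 → (Fin 4 → ℝ) → ℝ}
  {u : Fin 4 → Fin 4 → ℝ → ℝ} {H : Fin 4 → ℝ → ℝ}

theorem hasDerivAt (N : NormalForm I p μ u H) (i j : Fin 4) {s : ℝ} (hs : s ∈ I i) :
    HasDerivAt (u i j) (deriv (u i j) s) s :=
  (((N.smooth_u i j).contDiffAt ((N.isOpen i).mem_nhds hs)).differentiableAt (by simp)).hasDerivAt

theorem isOpen_pi (N : NormalForm I p μ u H) : IsOpen (Set.univ.pi I) :=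
  isOpen_set_pi Set.finite_univ fun i _ => N.isOpen i

theorem separable (N : NormalForm I p μ u H) : HasSeparableForm (Set.univ.pi I) μ u H := by
  refine ⟨fun i j => (smoothInCoord_pi_iff N.mem).2 (N.smooth_u i j),
    fun i => (smoothInCoord_pi_iff N.mem).2 (N.smooth_H i), fun x hx i => ?_⟩
  rw [N.sq x hx i, abs_of_pos]
  · rfl
  · exact lt_of_lt_of_eq (pow_pos (N.metric.pos i x hx) 2) (N.sq x hx i)

theorem eq_half (N : NormalForm I p μ u H) {i j : Fin 4} (h : Indep I u i j) {t : ℝ}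
    (ht : t ∈ I j) : u j i t = 1 / 2 := by
  rw [← N.base j i]
  exact eq_of_hasDerivAt_zero (N.isOpen j) (N.isPreconnected j)
    (fun r hr => (h r hr) ▸ N.hasDerivAt j i hr) ht (N.mem j)

/-- If `x_k` enters `μ_i` but not `μ_r`, then `x_r` enters `μ_i` and `μ_k` in the same way. -/
theorem eq_of_dep (N : NormalForm I p μ u H) {r i k : Fin 4} (hri : r ≠ i) (hrk : r ≠ k)
    (hik : i ≠ k) (h0 : Indep I u r k) (h1 : Dep I u i k) {s : ℝ} (hs : s ∈ I r) :
    u r k s = u r i s := by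
  have h2 : Indep I u r i := by
    intro t ht
    have := N.compat r i k hri hrk hik _ (N.mem r) t ht _ (N.mem k)
    rw [h0 _ (N.mem k)] at this
    have h3 := h1 _ (N.mem k)
    have h4 := (N.pos r k hrk _ (N.mem r) _ (N.mem k)).ne'
    simpa [h3, h4] using this
  have hpos : ∀ s ∈ I r, u r i s + 1 / 2 ≠ 0 := fun s hs => by
    have := N.pos r i hri s hs _ (N.mem i)
    rw [N.base] at this
    exact this.ne'
  -- Since x_k is absent from μ_r, compatibility for (i, r, k) collapses to u_rk'(u_ri + 1/2) =
  -- u_ri'(u_rk + 1/2). The quotient of the two shifted functions is therefore constant, and it is 1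
  -- at p.
  have key := eqOn_const_of_ratio (N.isOpen r) (N.isPreconnected r)
    (fun t ht => (N.hasDerivAt r k ht).add_const (1 / 2))
    (fun t ht => (N.hasDerivAt r i ht).add_const (1 / 2)) hpos (fun t ht => by
      have := N.compat i r k hri.symm hik hrk _ (N.mem i) t ht _ (N.mem k)
      rw [h0 _ (N.mem k)] at this
      simp only [N.base] at this
      refine mul_left_cancel₀ (h1 _ (N.mem k)) ?_
      linear_combination this) hs (N.mem r)
  rw [N.base, N.base, div_eq_div_iff (hpos s hs) (by norm_num)] at key
  linarith

/-- If `x_j` and `x_k` enter the coefficients of each other and also `μ_i`, the corresponding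
functions are affinely related. -/
theorem exists_affine (N : NormalForm I p μ u H) {i j k : Fin 4} (hij : i ≠ j) (hik : i ≠ k)
    (hjk : j ≠ k) (h1 : Dep I u i j) (h2 : Dep I u i k) (h3 : Dep I u j k) (h4 : Dep I u k j) :
    ∃ r : ℝ, r ≠ 0 ∧ 1 - r ≠ 0 ∧
      (∀ t ∈ I j, u j k t - 1 / 2 = r * (u j i t - 1 / 2)) ∧
      (∀ t ∈ I k, u k j t - 1 / 2 = (1 - r) * (u k i t - 1 / 2)) ∧
      (∀ s ∈ I i, (1 - r) * (u i k s - 1 / 2) + r * (u i j s - 1 / 2) = 0) := by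
  -- Compatibility divided by u_ji' u_ki': a function of x_k times S_ik plus a function of x_j times
  -- S_ij equals S_jk.
  have heq : ∀ s ∈ I i, ∀ t ∈ I j, ∀ q ∈ I k,
      deriv (u k j) q / deriv (u k i) q * (u i k s + u k i q)
        + deriv (u j k) t / deriv (u j i) t * (u i j s + u j i t) = u j k t + u k j q := by
    intro s hs t ht q hq
    have := N.compat i j k hij hik hjk s hs t ht q hq
    have e1 := h1 t ht
    have e2 := h2 q hq
    field_simp
    linear_combination this
  have hpi := N.mem i
  have hpj := N.mem j
  have hpk := N.mem k
  set r := deriv (u j k) (p j) / deriv (u j i) (p j) with hr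
  set r' := deriv (u k j) (p k) / deriv (u k i) (p k) with hr'
  have hrr : r' + r = 1 := by
    have := heq _ hpi _ hpj _ hpk
    simp only [N.base] at this
    linarith
  -- With the other two variables frozen at p, the ratio of derivatives equals the ratio of the
  -- functions up to additive constants. A ratio f/g with f/g = f'/g' is constant.
  have hj : ∀ t ∈ I j, deriv (u j k) t / deriv (u j i) t = r := by
    have hpos : ∀ t ∈ I j, u j i t + 1 / 2 ≠ 0 := fun t ht => by
      have := N.pos j i hij.symm t ht _ hpi
      rw [N.base] at this
      exact this.ne'
    have e : ∀ t ∈ I j, deriv (u j k) t / deriv (u j i) t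
        = (u j k t + (1 / 2 - r')) / (u j i t + 1 / 2) := by
      intro t ht
      rw [eq_div_iff (hpos t ht)]
      have := heq _ hpi t ht _ hpk
      simp only [N.base] at this
      linarith
    intro t ht
    rw [hr, e t ht, e _ hpj]
    refine eqOn_const_of_ratio (N.isOpen j) (N.isPreconnected j)
      (fun t ht => (N.hasDerivAt j k ht).add_const _)
      (fun t ht => (N.hasDerivAt j i ht).add_const _) hpos (fun t ht => ?_) ht hpj
    have := e t ht
    rw [div_eq_div_iff (h1 t ht) (hpos t ht)] at this
    exact this
  have hk : ∀ t ∈ I k, deriv (u k j) t / deriv (u k i) t = r' := by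
    have hpos : ∀ t ∈ I k, u k i t + 1 / 2 ≠ 0 := fun t ht => by
      have := N.pos k i hik.symm t ht _ hpi
      rw [N.base] at this
      exact this.ne'
    have e : ∀ t ∈ I k, deriv (u k j) t / deriv (u k i) t
        = (u k j t + (1 / 2 - r)) / (u k i t + 1 / 2) := by
      intro t ht
      rw [eq_div_iff (hpos t ht)]
      have := heq _ hpi _ hpj t ht
      simp only [N.base] at this
      linarith
    intro t ht
    rw [hr', e t ht, e _ hpk]
    refine eqOn_const_of_ratio (N.isOpen k) (N.isPreconnected k)
      (fun t ht => (N.hasDerivAt k j ht).add_const _)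
      (fun t ht => (N.hasDerivAt k i ht).add_const _) hpos (fun t ht => ?_) ht hpk
    have := e t ht
    rw [div_eq_div_iff (h2 t ht) (hpos t ht)] at this
    exact this
  have hr'' : 1 - r = r' := by linarith
  refine ⟨r, div_ne_zero (h4 _ hpj) (h1 _ hpj), ?_, fun t ht => ?_, fun t ht => ?_,
    fun s hs => ?_⟩
  · rw [hr'']
    exact div_ne_zero (h3 _ hpk) (h2 _ hpk)
  · have := heq _ hpi t ht _ hpk
    rw [hj t ht] at this
    simp only [N.base] at this
    linear_combination hrr - this
  · have := heq _ hpi _ hpj t ht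
    rw [hk t ht] at this
    simp only [N.base] at this
    rw [hr'']
    linear_combination hrr - this
  · have := heq s hs _ hpj _ hpk
    simp only [N.base] at this
    rw [hr'']
    linear_combination this - hrr

theorem exists_ne_half (N : NormalForm I p μ u H) {i j : Fin 4} (h : Dep I u i j) :
    ∃ t ∈ I j, u j i t ≠ 1 / 2 := by
  by_contra! hc
  refine h _ (N.mem j) ?_
  have : u j i =ᶠ[nhds (p j)] fun _ => 1 / 2 := by
    filter_upwards [(N.isOpen j).mem_nhds (N.mem j)] with t ht using hc t ht
  rw [this.deriv_eq, deriv_const]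

/-- The three factors attached to the indices `i`, `j`, `k`, where `x_j` and `x_k` enter the
coefficients of each other and also `μ_i`. -/
theorem exists_triple (N : NormalForm I p μ u H) {i j k : Fin 4} (hij : i ≠ j) (hik : i ≠ k)
    (hjk : j ≠ k) (h1 : Dep I u i j) (h2 : Dep I u i k) (h3 : Dep I u j k) (h4 : Dep I u k j) :
    ∃ r : ℝ, r ≠ 0 ∧ 1 - r ≠ 0 ∧
      (∀ t ∈ I j, u j k t - 1 / 2 = r * (u j i t - 1 / 2)) ∧
      (∀ s ∈ I i, ∀ t ∈ I j,
        u i j s + u j i t = ((u j k t + 1 / 2) - (1 - r * (u i j s + 1 / 2))) / r) ∧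
      (∀ s ∈ I i, ∀ t ∈ I k,
        u i k s + u k i t = ((1 - r * (u i j s + 1 / 2)) - (1 / 2 - u k j t)) / (1 - r)) := by
  -- With X_j = u_jk + 1/2, X_k = 1/2 - u_kj and X_i = 1 - r(u_ij + 1/2), one has S_jk = X_j - X_k,
  -- and the affine relations turn S_ij and S_ik into multiples of X_j - X_i and X_i - X_k.
  obtain ⟨r, hr, hr', e1, e2, e3⟩ := N.exists_affine hij hik hjk h1 h2 h3 h4
  refine ⟨r, hr, hr', e1, fun s hs t ht => ?_, fun s hs t ht => ?_⟩
  · rw [eq_div_iff hr]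
    linear_combination -e1 t ht
  · rw [eq_div_iff hr']
    linear_combination -e2 t ht + e3 s hs

/-- The factor attached to `i` and `l` in terms of the same functions as in `exists_triple`. -/
theorem exists_quadruple (N : NormalForm I p μ u H) {i j k l : Fin 4} (hij : i ≠ j)
    (hli : l ≠ i) (hlj : l ≠ j)
    (h1 : Dep I u l i) (h2 : Dep I u l j) (h3 : Dep I u i j) (h4 : Dep I u j i)
    {r r' : ℝ} (hr : r ≠ 0) (hjr : ∀ t ∈ I j, u j k t - 1 / 2 = r * (u j i t - 1 / 2))
    (hjr' : ∀ t ∈ I j, u j k t - 1 / 2 = r' * (u j l t - 1 / 2)) :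
    ∃ c : ℝ, c ≠ 0 ∧ ∀ s ∈ I i, ∀ t ∈ I l,
      u i l s + u l i t = ((1 - r * (u i j s + 1 / 2)) - (1 - r' * (u l j t + 1 / 2))) / c := by
  obtain ⟨q, hq, hq', e1, e2, e3⟩ := N.exists_affine hli hlj hij h1 h2 h3 h4
  -- Two proportionality relations for u_jk are compared at a point where u_jl - 1/2 does not
  -- vanish.
  have hrq : r' = r * (1 - q) := by
    obtain ⟨t, ht, hne⟩ := N.exists_ne_half h2
    refine mul_right_cancel₀ (sub_ne_zero.2 hne) ?_
    linear_combination -hjr' t ht + hjr t ht + r * e2 t ht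
  refine ⟨-(r * q), by simp [hr, hq], fun s hs t ht => ?_⟩
  rw [eq_div_iff (by simp [hr, hq]), hrq]
  linear_combination r * e1 s hs - r * e3 t ht

end NormalForm

/-! ### One-variable changes of coordinates on a box. -/

theorem exists_smooth_inverse {I : Set ℝ} (hI : IsOpen I) (hI' : IsPreconnected I) {y : ℝ → ℝ}
    (hy : ContDiffOn ℝ ∞ y I) (hy' : ∀ s ∈ I, deriv y s ≠ 0) :
    ∃ z : ℝ → ℝ, (∀ s ∈ I, z (y s) = s) ∧ IsOpen (y '' I) ∧ ContDiffOn ℝ ∞ z (y '' I) ∧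
      ∀ s ∈ I, HasDerivAt z (deriv y s)⁻¹ (y s) := by
  have hat : ∀ s ∈ I, ContDiffAt ℝ ∞ y s := fun s hs => hy.contDiffAt (hI.mem_nhds hs)
  have hstrict : ∀ s ∈ I, HasStrictDerivAt y (deriv y s) s := fun s hs =>
    (hat s hs).hasStrictDerivAt (by simp)
  have hlt : ∀ s ∈ I, ∀ t ∈ I, s < t → y s ≠ y t := by
    intro s hs t ht hst heq
    have hsub : Set.Icc s t ⊆ I := hI'.ordConnected.out hs ht
    -- Rolle's theorem yields injectivity on the whole interval; smoothness of the inverse then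
    -- follows from the local inverse function theorem.
    obtain ⟨c, hc, hc0⟩ := exists_deriv_eq_zero hst (hy.continuousOn.mono hsub) heq
    exact hy' c (hsub (Set.Ioo_subset_Icc_self hc)) hc0
  have hinj : Set.InjOn y I := by
    intro s hs t ht heq
    rcases lt_trichotomy s t with h | h | h
    · exact absurd heq (hlt s hs t ht h)
    · exact h
    · exact absurd heq.symm (hlt t ht s hs h)
  have hleft : ∀ s ∈ I, invFunOn y I (y s) = s := fun s hs => hinj.leftInvOn_invFunOn hs
  have hev : ∀ s ∈ I, ∀ᶠ r in nhds s, invFunOn y I (y r) = r := fun s hs => by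
    filter_upwards [hI.mem_nhds hs] with r hr using hleft r hr
  refine ⟨invFunOn y I, hleft, ?_, ?_, fun s hs => ?_⟩
  · rw [isOpen_iff_mem_nhds]
    rintro _ ⟨s, hs, rfl⟩
    rw [← (hstrict s hs).map_nhds_eq (hy' s hs)]
    exact Filter.image_mem_map (hI.mem_nhds hs)
  · rintro _ ⟨s, hs, rfl⟩
    have h1 := (hstrict s hs).hasStrictFDerivAt_equiv (hy' s hs)
    have h2 := (hat s hs).to_localInverse h1.hasFDerivAt (by simp)
    exact (h2.congr_of_eventuallyEq (h1.localInverse_unique (hev s hs))).contDiffWithinAt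
  · exact ((hstrict s hs).to_local_left_inverse (hy' s hs) (hev s hs)).hasDerivAt

theorem exists_smooth_antideriv {I : Set ℝ} (hI : IsOpen I) (hI' : IsPreconnected I) {f : ℝ → ℝ}
    (hf : ContDiffOn ℝ ∞ f I) :
    ∃ F : ℝ → ℝ, ContDiffOn ℝ ∞ F I ∧ ∀ s ∈ I, deriv F s = f s := by
  rcases I.eq_empty_or_nonempty with rfl | ⟨p, hp⟩
  · exact ⟨f, hf, by simp⟩
  have hd : ∀ s ∈ I, HasDerivAt (fun t => ∫ r in p..t, f r) (f s) s := by
    intro s hs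
    have hsub : Set.uIcc p s ⊆ I := hI'.ordConnected.uIcc_subset hp hs
    exact intervalIntegral.integral_hasDerivAt_right
      ((hf.continuousOn.mono hsub).intervalIntegrable)
      (hf.continuousOn.stronglyMeasurableAtFilter hI s hs)
      (hf.continuousOn.continuousAt (hI.mem_nhds hs))
  refine ⟨fun t => ∫ r in p..t, f r, ?_, fun s hs => (hd s hs).deriv⟩
  rw [contDiffOn_infty_iff_deriv_of_isOpen hI]
  exact ⟨fun s hs => (hd s hs).differentiableAt.differentiableWithinAt,
    hf.congr fun s hs => (hd s hs).deriv⟩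

/-- Integrating √h gives such a function. A coordinate of this sort absorbs a positive one-variable
factor h of a squared coefficient. -/
theorem exists_smooth_deriv_sq_eq {I : Set ℝ} (hI : IsOpen I) (hI' : IsPreconnected I)
    {h : ℝ → ℝ} (hh : ContDiffOn ℝ ∞ h I) (hpos : ∀ s ∈ I, 0 < h s) :
    ∃ y : ℝ → ℝ, ContDiffOn ℝ ∞ y I ∧ (∀ s ∈ I, deriv y s ≠ 0) ∧
      ∀ s ∈ I, deriv y s ^ 2 = h s := by
  obtain ⟨y, h1, h2⟩ := exists_smooth_antideriv hI hI' (hh.sqrt fun s hs => (hpos s hs).ne')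
  refine ⟨y, h1, fun s hs => ?_, fun s hs => ?_⟩
  · rw [h2 s hs]; exact (Real.sqrt_pos.2 (hpos s hs)).ne'
  · rw [h2 s hs]; exact Real.sq_sqrt (hpos s hs).le

/-- The metric `μ` on the box with sides `I i` becomes `μ'` on `W'` in the coordinates `y i`, whose
inverses are the functions `z i`. -/
structure IsReparam (I : Fin 4 → Set ℝ) (μ : Fin 4 → (Fin 4 → ℝ) → ℝ) (y z : Fin 4 → ℝ → ℝ)
    (W' : Set (Fin 4 → ℝ)) (μ' : Fin 4 → (Fin 4 → ℝ) → ℝ) : Prop where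
  smooth_comp : ∀ i f, ContDiffOn ℝ ∞ f (I i) → SmoothInCoord W' i fun s => f (z i s)
  mem : ∀ x ∈ W', ∀ i, z i (x i) ∈ I i
  right_inv : ∀ x ∈ W', ∀ i, y i (z i (x i)) = x i
  deriv_comp : ∀ x ∈ W', ∀ i f, DifferentiableAt ℝ f (z i (x i)) →
    deriv (fun s => f (z i s)) (x i) = deriv f (z i (x i)) * (deriv (y i) (z i (x i)))⁻¹
  sq : ∀ x ∈ W', ∀ i, μ' i x ^ 2
    = μ i (fun k => z k (x k)) ^ 2 / deriv (y i) (z i (x i)) ^ 2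

/-- The new domain is the product of the images of the sides, and no renumbering is involved. The
construction of the inverses is hidden behind `IsReparam`, so that the pattern lemmas only verify
formulas for squared coefficients. -/
theorem NormalForm.isLocallyOfListedKind {I : Fin 4 → Set ℝ} {p : Fin 4 → ℝ}
    {μ : Fin 4 → (Fin 4 → ℝ) → ℝ} {u : Fin 4 → Fin 4 → ℝ → ℝ} {H : Fin 4 → ℝ → ℝ}
    (N : NormalForm I p μ u H) (y : Fin 4 → ℝ → ℝ) (hy : ∀ i, ContDiffOn ℝ ∞ (y i) (I i))
    (hy' : ∀ i, ∀ s ∈ I i, deriv (y i) s ≠ 0)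
    (hk : ∀ z W' μ', IsReparam I μ y z W' μ' → IsOfListedKind W' μ') :
    IsLocallyOfListedKind (Set.univ.pi I) μ p := by
  choose z hz hopen hzs hzd using fun i =>
    exists_smooth_inverse (N.isOpen i) (N.isPreconnected i) (hy i) (hy' i)
  set W' : Set (Fin 4 → ℝ) := Set.univ.pi fun i => y i '' I i with hW'
  have hWopen : IsOpen W' := isOpen_set_pi Set.finite_univ fun i _ => hopen i
  have hzy : ∀ x ∈ W', ∀ i, z i (x i) ∈ I i ∧ y i (z i (x i)) = x i := by
    intro x hx i
    obtain ⟨s, hs, hsx⟩ := hx i trivial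
    rw [← hsx, hz i s hs]
    exact ⟨hs, rfl⟩
  have hzW : ∀ x ∈ W', (fun k => z k (x k)) ∈ Set.univ.pi I := fun x hx i _ => (hzy x hx i).1
  have hzsm : ContDiffOn ℝ ∞ (fun x : Fin 4 → ℝ => fun k => z k (x k)) W' :=
    contDiffOn_pi.2 fun k => (hzs k).comp (contDiff_apply ℝ ℝ k).contDiffOn
      fun x hx => hx k trivial
  set μ' : Fin 4 → (Fin 4 → ℝ) → ℝ := fun i x =>
    μ i (fun k => z k (x k)) / |deriv (y i) (z i (x i))| with hμ'
  have hdy : ∀ i, ContDiffOn ℝ ∞ (deriv (y i)) (I i) := fun i =>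
    (hy i).deriv_of_isOpen (N.isOpen i) (by simp)
  have hmetric : IsDiagonalMetric W' μ' := by
    refine ⟨fun i => ?_, fun i x hx => ?_⟩
    · refine ((N.metric.smooth i).comp hzsm hzW).div ?_ fun x hx =>
        abs_ne_zero.2 (hy' i _ (hzy x hx i).1)
      refine ContDiffOn.norm ℝ (f := fun x => deriv (y i) (z i (x i))) ?_ fun x hx =>
        hy' i _ (hzy x hx i).1
      exact (hdy i).comp (contDiffOn_pi.1 hzsm i) fun x hx => (hzy x hx i).1
    · exact div_pos (N.metric.pos i _ (hzW x hx)) (abs_pos.2 (hy' i _ (hzy x hx i).1))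
  have hcoord : ∀ x, coordMap 1 y x = fun m => y m (x m) := fun x => rfl
  refine ⟨Set.univ.pi I, N.isOpen_pi, fun i _ => N.mem i, subset_rfl, W', μ', hWopen, hmetric,
    ⟨1, y, fun i => (smoothInCoord_pi_iff N.mem).2 (hy i), fun i x hx => hy' i _ (hx i trivial),
      ⟨fun x hx i _ => ⟨x i, hx i trivial, rfl⟩, fun x hx x' hx' h => ?_, fun x hx =>
        ⟨fun k => z k (x k), hzW x hx, funext fun i => (hzy x hx i).2⟩⟩, fun x hx i => ?_⟩,
    hk z W' μ' ⟨fun i f hf => ?_, fun x hx i => (hzy x hx i).1, fun x hx i => (hzy x hx i).2,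
      fun x hx i f hf => ?_, fun x hx i => ?_⟩⟩
  · funext i
    have := congrFun h i
    rw [hcoord, hcoord] at this
    rw [← hz i (x i) (hx i trivial), ← hz i (x' i) (hx' i trivial)]
    exact congrArg (z i) this
  · have e : (fun k => z k (coordMap 1 y x k)) = x := funext fun k => hz k _ (hx k trivial)
    have e' : z i (coordMap 1 y x i) = x i := hz i _ (hx i trivial)
    simp only [Equiv.Perm.coe_one, id, hμ', e, e']
    have := abs_ne_zero.2 (hy' i _ (hx i trivial))
    field_simp
  · refine ContDiffOn.comp (t := I i) hf ((hzs i).mono ?_) ?_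
    · rintro _ ⟨x, hx, rfl⟩
      exact hx i trivial
    · rintro _ ⟨x, hx, rfl⟩
      exact (hzy x hx i).1
  · have h1 := hzd i _ (hzy x hx i).1
    rw [(hzy x hx i).2] at h1
    exact (hf.hasDerivAt.comp (x i) h1).deriv
  · simp only [hμ', div_pow, sq_abs]

/-! ### Combinatorics of the dependences. -/

/-- The conditions on the relations between `i` and two other coordinates `j` and `k`. -/
def isForestAt (ij ik jk kj : Bool) : Bool :=
  (!(ik && kj) || ij) && (!(ij && ik) || (jk || kj))

/-- The conditions on the relations between three coordinates `i`, `j`, `k`. -/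
def isForest (ij ik ji jk ki kj : Bool) : Bool :=
  isForestAt ij ik jk kj && (isForestAt ik ij kj jk && (isForestAt ji jk ik ki &&
    (isForestAt jk ji ki ik && (isForestAt ki kj ij ji && isForestAt kj ki ji ij))))

/-- The pattern of dependences is one of those of the ten kinds. -/
def isListedPattern (d01 d02 d03 d10 d12 d13 d20 d21 d23 d30 d31 d32 : Bool) : Bool :=
  (d10 && d20 && d30 && d21 && d31 && !d01 && !d02 && !d03 && !d12 && !d13 && !d23 && !d32) ||
  ((!d01 && !d02 && !d03 && d23 && d32 && d12 && d13) ||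
  ((!d01 && !d02 && !d03 && !d12 && !d13 && d10 && d20 && d30 && d21 && d31 && d32) ||
  ((!d02 && !d03 && !d12 && !d13 && !d20 && !d21 && !d30 && !d31) ||
  ((!d02 && !d03 && !d12 && !d13 && d01 && d10 && d20 && d21 && d30 && d31 && d32) ||
  ((!d01 && !d02 && !d03 && !d12 && !d13 && !d21 && !d31 && d20 && d30 && d32) ||
  ((!d01 && !d02 && !d03 && !d12 && !d13 && !d21 && !d23 && !d31 && !d32) ||
  ((d01 && d02 && d03 && d10 && d12 && d13 && d20 && d21 && d23 && d30 && d31 && d32) ||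
  ((d01 && d02 && d03 && !d10 && d12 && d13 && !d20 && d21 && d23 && !d30 && d31 && d32) ||
  (!d01 && d02 && d03 && !d10 && d12 && d13 && !d20 && !d21 && d23 && !d30 && !d31 &&
      d32)))))))))

-- Exhaustive check over the twenty-four renumberings. Each forest condition is placed as soon as
-- its Booleans are bound, so most branches end before all twelve are introduced.
set_option maxRecDepth 100000 in
theorem listedPattern_of_forest_aux : ∀ d01 d02 d10 d12 d20 d21 : Bool,
    isForest d01 d02 d10 d12 d20 d21 = true → ∀ d03 d13 d30 d31 : Bool,
    isForest d01 d03 d10 d13 d30 d31 = true → ∀ d23 d32 : Bool,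
    isForest d02 d03 d20 d23 d30 d32 = true → isForest d12 d13 d21 d23 d31 d32 = true →
    (isListedPattern d01 d02 d03 d10 d12 d13 d20 d21 d23 d30 d31 d32 ||
    (isListedPattern d01 d03 d02 d10 d13 d12 d30 d31 d32 d20 d21 d23 ||
    (isListedPattern d02 d01 d03 d20 d21 d23 d10 d12 d13 d30 d32 d31 ||
    (isListedPattern d02 d03 d01 d20 d23 d21 d30 d32 d31 d10 d12 d13 ||
    (isListedPattern d03 d01 d02 d30 d31 d32 d10 d13 d12 d20 d23 d21 ||
    (isListedPattern d03 d02 d01 d30 d32 d31 d20 d23 d21 d10 d13 d12 ||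
    (isListedPattern d10 d12 d13 d01 d02 d03 d21 d20 d23 d31 d30 d32 ||
    (isListedPattern d10 d13 d12 d01 d03 d02 d31 d30 d32 d21 d20 d23 ||
    (isListedPattern d12 d10 d13 d21 d20 d23 d01 d02 d03 d31 d32 d30 ||
    (isListedPattern d12 d13 d10 d21 d23 d20 d31 d32 d30 d01 d02 d03 ||
    (isListedPattern d13 d10 d12 d31 d30 d32 d01 d03 d02 d21 d23 d20 ||
    (isListedPattern d13 d12 d10 d31 d32 d30 d21 d23 d20 d01 d03 d02 ||
    (isListedPattern d20 d21 d23 d02 d01 d03 d12 d10 d13 d32 d30 d31 ||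
    (isListedPattern d20 d23 d21 d02 d03 d01 d32 d30 d31 d12 d10 d13 ||
    (isListedPattern d21 d20 d23 d12 d10 d13 d02 d01 d03 d32 d31 d30 ||
    (isListedPattern d21 d23 d20 d12 d13 d10 d32 d31 d30 d02 d01 d03 ||
    (isListedPattern d23 d20 d21 d32 d30 d31 d02 d03 d01 d12 d13 d10 ||
    (isListedPattern d23 d21 d20 d32 d31 d30 d12 d13 d10 d02 d03 d01 ||
    (isListedPattern d30 d31 d32 d03 d01 d02 d13 d10 d12 d23 d20 d21 ||
    (isListedPattern d30 d32 d31 d03 d02 d01 d23 d20 d21 d13 d10 d12 ||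
    (isListedPattern d31 d30 d32 d13 d10 d12 d03 d01 d02 d23 d21 d20 ||
    (isListedPattern d31 d32 d30 d13 d12 d10 d23 d21 d20 d03 d01 d02 ||
    (isListedPattern d32 d30 d31 d23 d20 d21 d03 d02 d01 d13 d12 d10 ||
    (isListedPattern d32 d31 d30 d23 d21 d20 d13 d12 d10 d03 d02 d01)))))))))))))))))))))))) = true := by
  decide

theorem exists_listedPattern_of_forest {d : Fin 4 → Fin 4 → Bool}
    (hd : ∀ i j k : Fin 4, i ≠ j → i ≠ k → j ≠ k →
      isForestAt (d i j) (d i k) (d j k) (d k j) = true) :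
    ∃ e : Equiv.Perm (Fin 4), isListedPattern (d (e 0) (e 1)) (d (e 0) (e 2)) (d (e 0) (e 3))
      (d (e 1) (e 0)) (d (e 1) (e 2)) (d (e 1) (e 3)) (d (e 2) (e 0)) (d (e 2) (e 1))
      (d (e 2) (e 3)) (d (e 3) (e 0)) (d (e 3) (e 1)) (d (e 3) (e 2)) = true := by
  suffices h : ∃ e : Fin 4 → Fin 4, Injective e ∧ isListedPattern (d (e 0) (e 1)) (d (e 0) (e 2))
      (d (e 0) (e 3)) (d (e 1) (e 0)) (d (e 1) (e 2)) (d (e 1) (e 3)) (d (e 2) (e 0))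
      (d (e 2) (e 1)) (d (e 2) (e 3)) (d (e 3) (e 0)) (d (e 3) (e 1)) (d (e 3) (e 2)) = true by
    obtain ⟨e, he, h⟩ := h
    exact ⟨Equiv.ofBijective e (Finite.injective_iff_bijective.1 he), h⟩
  have hf : ∀ i j k : Fin 4, i ≠ j → i ≠ k → j ≠ k →
      isForest (d i j) (d i k) (d j i) (d j k) (d k i) (d k j) = true := by
    intro i j k hij hik hjk
    simp only [isForest, Bool.and_eq_true]
    exact ⟨hd i j k hij hik hjk, hd i k j hik hij hjk.symm, hd j i k hij.symm hjk hik,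
      hd j k i hjk hij.symm hik.symm, hd k i j hik.symm hjk.symm hij,
      hd k j i hjk.symm hik.symm hij.symm⟩
  have key := listedPattern_of_forest_aux _ _ _ _ _ _
    (hf 0 1 2 (by decide) (by decide) (by decide)) _ _ _ _
    (hf 0 1 3 (by decide) (by decide) (by decide)) _ _
    (hf 0 2 3 (by decide) (by decide) (by decide))
    (hf 1 2 3 (by decide) (by decide) (by decide))
  simp only [Bool.or_eq_true] at key
  rcases key with h | h | h | h | h | h | h | h | h | h | h | h | h | h | h | h | h | h | h | h | h | h | h | h
  · exact ⟨![0, 1, 2, 3], by decide, h⟩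
  · exact ⟨![0, 1, 3, 2], by decide, h⟩
  · exact ⟨![0, 2, 1, 3], by decide, h⟩
  · exact ⟨![0, 2, 3, 1], by decide, h⟩
  · exact ⟨![0, 3, 1, 2], by decide, h⟩
  · exact ⟨![0, 3, 2, 1], by decide, h⟩
  · exact ⟨![1, 0, 2, 3], by decide, h⟩
  · exact ⟨![1, 0, 3, 2], by decide, h⟩
  · exact ⟨![1, 2, 0, 3], by decide, h⟩
  · exact ⟨![1, 2, 3, 0], by decide, h⟩
  · exact ⟨![1, 3, 0, 2], by decide, h⟩
  · exact ⟨![1, 3, 2, 0], by decide, h⟩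
  · exact ⟨![2, 0, 1, 3], by decide, h⟩
  · exact ⟨![2, 0, 3, 1], by decide, h⟩
  · exact ⟨![2, 1, 0, 3], by decide, h⟩
  · exact ⟨![2, 1, 3, 0], by decide, h⟩
  · exact ⟨![2, 3, 0, 1], by decide, h⟩
  · exact ⟨![2, 3, 1, 0], by decide, h⟩
  · exact ⟨![3, 0, 1, 2], by decide, h⟩
  · exact ⟨![3, 0, 2, 1], by decide, h⟩
  · exact ⟨![3, 1, 0, 2], by decide, h⟩
  · exact ⟨![3, 1, 2, 0], by decide, h⟩
  · exact ⟨![3, 2, 0, 1], by decide, h⟩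
  · exact ⟨![3, 2, 1, 0], by decide, h⟩

/-! ### Renumbering the coordinates. -/

/-- The square coefficients are unchanged by a renumbering of the coordinates. -/
theorem NormalForm.relabel {I : Fin 4 → Set ℝ} {p : Fin 4 → ℝ}
    {μ : Fin 4 → (Fin 4 → ℝ) → ℝ} {u : Fin 4 → Fin 4 → ℝ → ℝ} {H : Fin 4 → ℝ → ℝ}
    (N : NormalForm I p μ u H) (e : Equiv.Perm (Fin 4)) :
    NormalForm (fun i => I (e i)) (fun i => p (e i)) (fun i x => μ (e i) fun k => x (e.symm k))
      (fun i j => u (e i) (e j)) fun i => H (e i) := by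
  have hmem : ∀ x ∈ Set.univ.pi fun i => I (e i), (fun k => x (e.symm k)) ∈ Set.univ.pi I := by
    intro x hx k _
    simpa using hx (e.symm k) trivial
  have hsm : ContDiff ℝ ∞ fun x : Fin 4 → ℝ => fun k => x (e.symm k) :=
    contDiff_pi.2 fun k => contDiff_apply ℝ ℝ (e.symm k)
  refine ⟨fun i => N.isOpen _, fun i => N.isPreconnected _, fun i => N.mem _,
    ⟨fun i => (N.metric.smooth _).comp hsm.contDiffOn hmem,
      fun i x hx => N.metric.pos _ _ (hmem x hx)⟩, fun i j => N.smooth_u _ _,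
    fun i => N.smooth_H _, fun i => N.H_pos _, fun i j => N.base _ _,
    fun i j hij => N.pos _ _ (e.injective.ne hij), fun x hx i => ?_,
    fun i j k hij hik hjk => N.compat _ _ _ (e.injective.ne hij) (e.injective.ne hik)
      (e.injective.ne hjk)⟩
  rw [N.sq _ (hmem x hx)]
  simp only [Equiv.symm_apply_apply]
  congr 1
  refine (Finset.prod_bij (fun j _ => e j) ?_ ?_ ?_ ?_).symm
  · intro j hj; simpa using hj
  · intro j _ k _ hjk; exact e.injective hjk
  · intro m hm
    refine ⟨e.symm m, ?_, by simp⟩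
    have : m ≠ e i := by simpa using hm
    simpa [Equiv.symm_apply_eq] using this
  · intro j _
    simp

/-- A renumbering is itself an admissible change of coordinates; it is composed with the given one
by precomposing σ with the inverse of e. -/
theorem IsLocallyOfListedKind.of_relabel {U U' : Set (Fin 4 → ℝ)} {μ : Fin 4 → (Fin 4 → ℝ) → ℝ}
    {p : Fin 4 → ℝ} (e : Equiv.Perm (Fin 4))
    (hU' : ∀ x ∈ U', (fun k => x (e.symm k)) ∈ U)
    (h : IsLocallyOfListedKind U' (fun i x => μ (e i) fun k => x (e.symm k)) fun i => p (e i)) :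
    IsLocallyOfListedKind U μ p := by
  obtain ⟨W, hW, hpW, hWU, W', μ', hW', hμ', ⟨σ, y, hy, hy', hbij, hμ⟩, hk⟩ := h
  have hinv : ∀ x : Fin 4 → ℝ, (fun k => (fun i => x (e i)) (e.symm k)) = x := fun x =>
    funext fun k => by simp
  have hinv' : ∀ x : Fin 4 → ℝ, (fun i => (fun k => x (e.symm k)) (e i)) = x := fun x =>
    funext fun k => by simp
  have hcoord : ∀ x, coordMap (e.symm.trans σ) (fun k => y (e.symm k)) x
      = coordMap σ y fun i => x (e i) := by
    intro x
    funext m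
    simp [coordMap]
  refine ⟨{x | (fun i => x (e i)) ∈ W}, hW.preimage (by fun_prop), hpW, fun x hx => ?_, W', μ',
    hW', hμ', ⟨e.symm.trans σ, fun k => y (e.symm k), fun k => ?_, fun k x hx => ?_,
      ⟨fun x hx => ?_, fun x hx x' hx' heq => ?_, fun x' hx' => ?_⟩, fun x hx k => ?_⟩, hk⟩
  · have := hU' _ (hWU hx)
    rwa [hinv] at this
  · refine (hy (e.symm k)).mono ?_
    rintro _ ⟨x, hx, rfl⟩
    exact ⟨_, hx, by simp⟩
  · have := hy' (e.symm k) _ hx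
    simpa using this
  · rw [hcoord]
    exact hbij.mapsTo hx
  · rw [hcoord, hcoord] at heq
    have := hbij.injOn hx hx' heq
    rw [← hinv x, ← hinv x', this]
  · obtain ⟨x, hx, rfl⟩ := hbij.surjOn hx'
    refine ⟨fun k => x (e.symm k), ?_, ?_⟩
    · change (fun i => (fun k => x (e.symm k)) (e i)) ∈ W
      rwa [hinv']
    · rw [hcoord, hinv']
  · have := hμ _ hx (e.symm k)
    rw [hcoord]
    simpa using this

/-! ### Each pattern of dependences leads to its kind. -/

section Patterns

variable {I : Fin 4 → Set ℝ} {p : Fin 4 → ℝ} {μ : Fin 4 → (Fin 4 → ℝ) → ℝ}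
  {u : Fin 4 → Fin 4 → ℝ → ℝ} {H : Fin 4 → ℝ → ℝ}

theorem NormalForm.add_half_pos (N : NormalForm I p μ u H) {i j : Fin 4} (hij : i ≠ j) {s : ℝ}
    (hs : s ∈ I i) : 0 < u i j s + 1 / 2 := by
  have := N.pos i j hij s hs _ (N.mem j)
  rwa [N.base] at this

theorem NormalForm.smooth_add_half (N : NormalForm I p μ u H) (i j : Fin 4) :
    ContDiffOn ℝ ∞ (fun s => u i j s + 1 / 2) (I i) :=
  (N.smooth_u i j).add contDiffOn_const

theorem NormalForm.exists_deriv_sq_eq (N : NormalForm I p μ u H) (i : Fin 4) {h : ℝ → ℝ}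
    (hh : ContDiffOn ℝ ∞ h (I i)) (hpos : ∀ s ∈ I i, 0 < h s) :
    ∃ y : ℝ → ℝ, ContDiffOn ℝ ∞ y (I i) ∧ (∀ s ∈ I i, deriv y s ≠ 0) ∧
      ∀ s ∈ I i, deriv y s ^ 2 = h s :=
  exists_smooth_deriv_sq_eq (N.isOpen i) (N.isPreconnected i) hh hpos

theorem forall_fin_four {P : Fin 4 → Prop} (h0 : P 0) (h1 : P 1) (h2 : P 2) (h3 : P 3) :
    ∀ i, P i := by
  intro i
  fin_cases i <;> assumption

variable {y z : Fin 4 → ℝ → ℝ} {W' : Set (Fin 4 → ℝ)} {μ' : Fin 4 → (Fin 4 → ℝ) → ℝ}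

/-- The coefficients in the new coordinates in terms of the normal form. -/
theorem IsReparam.sq_eq (R : IsReparam I μ y z W' μ') (N : NormalForm I p μ u H) {x : Fin 4 → ℝ}
    (hx : x ∈ W') :
    μ' 0 x ^ 2 = H 0 (z 0 (x 0)) / deriv (y 0) (z 0 (x 0)) ^ 2 *
      ((u 0 1 (z 0 (x 0)) + u 1 0 (z 1 (x 1))) * (u 0 2 (z 0 (x 0)) + u 2 0 (z 2 (x 2))) *
        (u 0 3 (z 0 (x 0)) + u 3 0 (z 3 (x 3)))) ∧
    μ' 1 x ^ 2 = H 1 (z 1 (x 1)) / deriv (y 1) (z 1 (x 1)) ^ 2 *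
      ((u 0 1 (z 0 (x 0)) + u 1 0 (z 1 (x 1))) * (u 1 2 (z 1 (x 1)) + u 2 1 (z 2 (x 2))) *
        (u 1 3 (z 1 (x 1)) + u 3 1 (z 3 (x 3)))) ∧
    μ' 2 x ^ 2 = H 2 (z 2 (x 2)) / deriv (y 2) (z 2 (x 2)) ^ 2 *
      ((u 0 2 (z 0 (x 0)) + u 2 0 (z 2 (x 2))) * (u 1 2 (z 1 (x 1)) + u 2 1 (z 2 (x 2))) *
        (u 2 3 (z 2 (x 2)) + u 3 2 (z 3 (x 3)))) ∧
    μ' 3 x ^ 2 = H 3 (z 3 (x 3)) / deriv (y 3) (z 3 (x 3)) ^ 2 *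
      ((u 0 3 (z 0 (x 0)) + u 3 0 (z 3 (x 3))) * (u 1 3 (z 1 (x 1)) + u 3 1 (z 3 (x 3))) *
        (u 2 3 (z 2 (x 2)) + u 3 2 (z 3 (x 3)))) := by
  have hm : (fun k => z k (x k)) ∈ Set.univ.pi I := fun i _ => R.mem x hx i
  refine ⟨?_, ?_, ?_, ?_⟩ <;> rw [R.sq x hx, N.sq _ hm]
  · rw [(prod_erase_fin_four _).1]; ring
  · rw [(prod_erase_fin_four _).2.1]; ring
  · rw [(prod_erase_fin_four _).2.2.1]; ring
  · rw [(prod_erase_fin_four _).2.2.2]; ring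

theorem IsReparam.deriv_comp_ne_zero (R : IsReparam I μ y z W' μ')
    (hI : ∀ i, IsOpen (I i)) {i : Fin 4} (hy' : ∀ s ∈ I i, deriv (y i) s ≠ 0) {f : ℝ → ℝ}
    (hf : ContDiffOn ℝ ∞ f (I i)) (hf' : ∀ s ∈ I i, deriv f s ≠ 0) {x : Fin 4 → ℝ}
    (hx : x ∈ W') : deriv (fun s => f (z i s)) (x i) ≠ 0 := by
  have hm := R.mem x hx i
  rw [R.deriv_comp x hx i f ((hf.contDiffAt ((hI i).mem_nhds hm)).differentiableAt (by simp))]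
  exact mul_ne_zero (hf' _ hm) (inv_ne_zero (hy' _ hm))

theorem NormalForm.smooth_div_deriv_sq (N : NormalForm I p μ u H) {i : Fin 4} {y : ℝ → ℝ}
    (hy : ContDiffOn ℝ ∞ y (I i)) (hy' : ∀ s ∈ I i, deriv y s ≠ 0) :
    ContDiffOn ℝ ∞ (fun s => H i s / deriv y s ^ 2) (I i) :=
  (N.smooth_H i).div ((hy.deriv_of_isOpen (N.isOpen i) (by simp)).pow 2) fun s hs =>
    pow_ne_zero _ (hy' s hs)

/-- `NormalForm.eq_of_dep` makes the three factors with index 0 equal to one function η of x_0, and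
S_23 = 1. The coordinates absorb H_0 η³, H_1 ψφ, H_2 and H_3. -/
theorem NormalForm.kindOne (N : NormalForm I p μ u H)
    (h10 : Dep I u 1 0) (h21 : Dep I u 2 1) (h31 : Dep I u 3 1) (i01 : Indep I u 0 1)
    (i02 : Indep I u 0 2) (i03 : Indep I u 0 3) (i12 : Indep I u 1 2) (i13 : Indep I u 1 3)
    (i23 : Indep I u 2 3) (i32 : Indep I u 3 2) :
    IsLocallyOfListedKind (Set.univ.pi I) μ p := by
  have e2 : ∀ s ∈ I 0, u 0 1 s = u 0 2 s := fun s hs =>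
    N.eq_of_dep (by decide) (by decide) (by decide) i01 h21 hs
  have e3 : ∀ s ∈ I 0, u 0 1 s = u 0 3 s := fun s hs =>
    N.eq_of_dep (by decide) (by decide) (by decide) i01 h31 hs
  obtain ⟨y0, a0, b0, c0⟩ := N.exists_deriv_sq_eq 0
    ((N.smooth_H 0).mul ((N.smooth_add_half 0 1).pow 3))
    (fun s hs => mul_pos (N.H_pos 0 s hs) (pow_pos (N.add_half_pos (by decide) hs) 3))
  obtain ⟨y1, a1, b1, c1⟩ := N.exists_deriv_sq_eq 1
    ((N.smooth_H 1).mul ((N.smooth_add_half 1 2).mul (N.smooth_add_half 1 3)))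
    (fun s hs => mul_pos (N.H_pos 1 s hs) (mul_pos (N.add_half_pos (by decide) hs) (N.add_half_pos (by decide) hs)))
  obtain ⟨y2, a2, b2, c2⟩ := N.exists_deriv_sq_eq 2
    (N.smooth_H 2)
    (N.H_pos 2)
  obtain ⟨y3, a3, b3, c3⟩ := N.exists_deriv_sq_eq 3
    (N.smooth_H 3)
    (N.H_pos 3)
  refine N.isLocallyOfListedKind ![y0, y1, y2, y3] (forall_fin_four a0 a1 a2 a3)
    (forall_fin_four b0 b1 b2 b3) fun z W' μ' R => .inl ⟨fun s => u 0 1 (z 0 s) + 1 / 2,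
      fun s => u 1 2 (z 1 s) + 1 / 2, fun s => u 1 3 (z 1 s) + 1 / 2,
      R.smooth_comp 0 _ (N.smooth_add_half 0 1), R.smooth_comp 1 _ (N.smooth_add_half 1 2),
      R.smooth_comp 1 _ (N.smooth_add_half 1 3), fun x hx => ?_, fun x hx => ?_⟩
  · exact R.deriv_comp_ne_zero N.isOpen b0 (N.smooth_add_half 0 1)
      (fun s hs => by simpa using h10 s hs) hx
  · obtain ⟨q0, q1, q2, q3⟩ := R.sq_eq N hx
    have m0 := R.mem x hx 0
    have m1 := R.mem x hx 1
    have m2 := R.mem x hx 2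
    have m3 := R.mem x hx 3
    have p0 := N.H_pos 0 _ m0
    have p1 := N.H_pos 1 _ m1
    have p2 := N.H_pos 2 _ m2
    have p3 := N.H_pos 3 _ m3
    have s01 := N.add_half_pos (i := 0) (j := 1) (by decide) m0
    have s12 := N.add_half_pos (i := 1) (j := 2) (by decide) m1
    have s13 := N.add_half_pos (i := 1) (j := 3) (by decide) m1
    simp only [Matrix.cons_val] at q0 q1 q2 q3
    beta_reduce
    rw [c0 _ m0] at q0
    rw [c1 _ m1] at q1
    rw [c2 _ m2] at q2
    rw [c3 _ m3] at q3
    rw [← e2 _ m0, ← e3 _ m0, N.eq_half i01 m1, N.eq_half i02 m2, N.eq_half i03 m3] at q0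
    rw [N.eq_half i01 m1, N.eq_half i12 m2, N.eq_half i13 m3] at q1
    rw [← e2 _ m0, N.eq_half i02 m2, N.eq_half i12 m2, N.eq_half i32 m2, N.eq_half i23 m3] at q2
    rw [← e3 _ m0, N.eq_half i03 m3, N.eq_half i13 m3, N.eq_half i32 m2, N.eq_half i23 m3] at q3
    generalize u 0 1 (z 0 (x 0)) + 1 / 2 = A at *
    generalize u 1 2 (z 1 (x 1)) + 1 / 2 = B at *
    generalize u 1 3 (z 1 (x 1)) + 1 / 2 = C at *
    refine ⟨?_, ?_, ?_, ?_⟩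
    · rw [q0]; field_simp
    · rw [q1]; field_simp
    · rw [q2]; field_simp; ring
    · rw [q3]; field_simp; ring

/-- The factors among 1, 2, 3 are multiples of differences by `NormalForm.exists_triple`. Whether
μ_2 and μ_3 involve x_1 is left open; accordingly ξ may be constant. -/
theorem NormalForm.kindTwo (N : NormalForm I p μ u H)
    (h12 : Dep I u 1 2) (h13 : Dep I u 1 3) (h23 : Dep I u 2 3) (h32 : Dep I u 3 2)
    (i01 : Indep I u 0 1) (i02 : Indep I u 0 2) (i03 : Indep I u 0 3) :
    IsLocallyOfListedKind (Set.univ.pi I) μ p := by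
  have e2 : ∀ s ∈ I 0, u 0 2 s = u 0 1 s := fun s hs =>
    N.eq_of_dep (by decide) (by decide) (by decide) i02 h12 hs
  have e3 : ∀ s ∈ I 0, u 0 3 s = u 0 1 s := fun s hs =>
    N.eq_of_dep (by decide) (by decide) (by decide) i03 h13 hs
  obtain ⟨r, hr, hr', -, f2, f3⟩ := N.exists_triple (i := 1) (j := 2) (k := 3) (by decide)
    (by decide) (by decide) h12 h13 h23 h32
  obtain ⟨y0, a0, b0, c0⟩ := N.exists_deriv_sq_eq 0
    ((N.smooth_H 0).mul ((N.smooth_add_half 0 1).pow 3))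
    (fun s hs => mul_pos (N.H_pos 0 s hs) (pow_pos (N.add_half_pos (by decide) hs) 3))
  obtain ⟨y1, a1, b1, c1⟩ := N.exists_deriv_sq_eq 1
    ((N.smooth_H 1).div_const |r * (1 - r)|)
    (fun s hs => div_pos (N.H_pos 1 s hs) (abs_pos.2 (mul_ne_zero hr hr')))
  obtain ⟨y2, a2, b2, c2⟩ := N.exists_deriv_sq_eq 2
    ((N.smooth_H 2).div_const |r|)
    (fun s hs => div_pos (N.H_pos 2 s hs) (abs_pos.2 hr))
  obtain ⟨y3, a3, b3, c3⟩ := N.exists_deriv_sq_eq 3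
    ((N.smooth_H 3).div_const |1 - r|)
    (fun s hs => div_pos (N.H_pos 3 s hs) (abs_pos.2 hr'))
  refine N.isLocallyOfListedKind ![y0, y1, y2, y3] (forall_fin_four a0 a1 a2 a3)
    (forall_fin_four b0 b1 b2 b3) fun z W' μ' R => .inr <| .inl ⟨fun s => u 0 1 (z 0 s) + 1 / 2,
      fun s => 1 - r * (u 1 2 (z 1 s) + 1 / 2), fun s => u 2 3 (z 2 s) + 1 / 2,
      fun s => 1 / 2 - u 3 2 (z 3 s),
      R.smooth_comp 0 _ (N.smooth_add_half 0 1),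
      R.smooth_comp 1 _ (contDiffOn_const.sub (contDiffOn_const.mul (N.smooth_add_half 1 2))),
      R.smooth_comp 2 _ (N.smooth_add_half 2 3), R.smooth_comp 3 _ (contDiffOn_const.sub (N.smooth_u 3 2)), fun x hx => ?_, fun x hx => ?_, fun x hx => ?_⟩
  · exact R.deriv_comp_ne_zero N.isOpen b2 (N.smooth_add_half 2 3)
      (fun s hs => by simpa using h32 s hs) hx
  · exact R.deriv_comp_ne_zero N.isOpen b3 (contDiffOn_const.sub (N.smooth_u 3 2))
      (fun s hs => by simpa using h23 s hs) hx
  · obtain ⟨q0, q1, q2, q3⟩ := R.sq_eq N hx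
    have m0 := R.mem x hx 0
    have m1 := R.mem x hx 1
    have m2 := R.mem x hx 2
    have m3 := R.mem x hx 3
    have p0 := N.H_pos 0 _ m0
    have p1 := N.H_pos 1 _ m1
    have p2 := N.H_pos 2 _ m2
    have p3 := N.H_pos 3 _ m3
    have s01 := N.add_half_pos (i := 0) (j := 1) (by decide) m0
    simp only [Matrix.cons_val] at q0 q1 q2 q3
    beta_reduce
    rw [c0 _ m0] at q0
    rw [c1 _ m1] at q1
    rw [c2 _ m2] at q2
    rw [c3 _ m3] at q3
    rw [e2 _ m0, e3 _ m0, N.eq_half i01 m1, N.eq_half i02 m2, N.eq_half i03 m3] at q0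
    rw [N.eq_half i01 m1, f2 _ m1 _ m2, f3 _ m1 _ m3] at q1
    rw [e2 _ m0, N.eq_half i02 m2, f2 _ m1 _ m2, 
      (show u 2 3 (z 2 (x 2)) + u 3 2 (z 3 (x 3)) =
      (u 2 3 (z 2 (x 2)) + 1 / 2) - (1 / 2 - u 3 2 (z 3 (x 3))) by ring)] at q2
    rw [e3 _ m0, N.eq_half i03 m3, f3 _ m1 _ m3, 
      (show u 2 3 (z 2 (x 2)) + u 3 2 (z 3 (x 3)) =
      (u 2 3 (z 2 (x 2)) + 1 / 2) - (1 / 2 - u 3 2 (z 3 (x 3))) by ring)] at q3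
    generalize 1 - r * (u 1 2 (z 1 (x 1)) + 1 / 2) = X₁ at *
    generalize 1 / 2 - u 3 2 (z 3 (x 3)) = X₃ at *
    generalize u 2 3 (z 2 (x 2)) + 1 / 2 = X₂ at *
    generalize u 0 1 (z 0 (x 0)) + 1 / 2 = A at *
    refine ⟨?_, ?_, ?_, ?_⟩
    · rw [q0]; field_simp
    · rw [← abs_of_nonneg (sq_nonneg (μ' 1 x)), q1]
      simp only [abs_mul, abs_div, abs_abs, abs_of_pos s01, abs_of_pos p1, abs_sub_comm X₂ X₁]
      field_simp
    · rw [← abs_of_nonneg (sq_nonneg (μ' 2 x)), q2]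
      simp only [abs_mul, abs_div, abs_abs, abs_of_pos s01, abs_of_pos p2, abs_sub_comm X₂ X₁]
      field_simp
    · rw [← abs_of_nonneg (sq_nonneg (μ' 3 x)), q3]
      simp only [abs_mul, abs_div, abs_abs, abs_of_pos s01, abs_of_pos p3, abs_sub_comm X₃ X₁, abs_sub_comm X₃ X₂]
      field_simp

/-- All factors with index 0 agree, as do S_12 and S_13. These two functions have nonvanishing
derivatives and serve as the coordinates x_0 and x_1. -/
theorem NormalForm.kindThree (N : NormalForm I p μ u H)
    (h10 : Dep I u 1 0) (h21 : Dep I u 2 1) (h31 : Dep I u 3 1) (h32 : Dep I u 3 2)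
    (i01 : Indep I u 0 1) (i02 : Indep I u 0 2) (i03 : Indep I u 0 3) (i12 : Indep I u 1 2)
    (i13 : Indep I u 1 3) :
    IsLocallyOfListedKind (Set.univ.pi I) μ p := by
  have e2 : ∀ s ∈ I 0, u 0 1 s = u 0 2 s := fun s hs =>
    N.eq_of_dep (by decide) (by decide) (by decide) i01 h21 hs
  have e3 : ∀ s ∈ I 0, u 0 1 s = u 0 3 s := fun s hs =>
    N.eq_of_dep (by decide) (by decide) (by decide) i01 h31 hs
  have e4 : ∀ s ∈ I 1, u 1 2 s = u 1 3 s := fun s hs =>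
    N.eq_of_dep (by decide) (by decide) (by decide) i12 h32 hs
  have a0 : ContDiffOn ℝ ∞ (fun s => u 0 1 s + 1 / 2) (I 0) := N.smooth_add_half 0 1
  have b0 : ∀ s ∈ I 0, deriv (fun s => u 0 1 s + 1 / 2) s ≠ 0 := fun s hs => by
    simpa using h10 s hs
  have a1 : ContDiffOn ℝ ∞ (fun s => u 1 2 s + 1 / 2) (I 1) := N.smooth_add_half 1 2
  have b1 : ∀ s ∈ I 1, deriv (fun s => u 1 2 s + 1 / 2) s ≠ 0 := fun s hs => by
    simpa using h21 s hs
  obtain ⟨y2, a2, b2, c2⟩ := N.exists_deriv_sq_eq 2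
    (N.smooth_H 2)
    (N.H_pos 2)
  obtain ⟨y3, a3, b3, c3⟩ := N.exists_deriv_sq_eq 3
    (N.smooth_H 3)
    (N.H_pos 3)
  refine N.isLocallyOfListedKind ![fun s => u 0 1 s + 1 / 2, fun s => u 1 2 s + 1 / 2, y2, y3] (forall_fin_four a0 a1 a2 a3)
    (forall_fin_four b0 b1 b2 b3) fun z W' μ' R => .inr <| .inr <| .inl ⟨fun s => H 0 (z 0 s) / deriv (fun s => u 0 1 s + 1 / 2) (z 0 s) ^ 2 * (u 0 1 (z 0 s) + 1 / 2) ^ 3,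
      fun s => H 1 (z 1 s) / deriv (fun s => u 1 2 s + 1 / 2) (z 1 s) ^ 2 * (u 1 2 (z 1 s) + 1 / 2) ^ 2,
      fun s => u 2 3 (z 2 s), fun s => u 3 2 (z 3 s),
      R.smooth_comp 0 _ ((N.smooth_div_deriv_sq a0 b0).mul (a0.pow 3)),
      R.smooth_comp 1 _ ((N.smooth_div_deriv_sq a1 b1).mul (a1.pow 2)),
      R.smooth_comp 2 _ (N.smooth_u 2 3), R.smooth_comp 3 _ (N.smooth_u 3 2), fun x hx => ?_⟩
  · obtain ⟨q0, q1, q2, q3⟩ := R.sq_eq N hx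
    have m0 := R.mem x hx 0
    have m1 := R.mem x hx 1
    have m2 := R.mem x hx 2
    have m3 := R.mem x hx 3
    have p0 := N.H_pos 0 _ m0
    have p1 := N.H_pos 1 _ m1
    have p2 := N.H_pos 2 _ m2
    have p3 := N.H_pos 3 _ m3
    have w0 : u 0 1 (z 0 (x 0)) + 1 / 2 = x 0 := R.right_inv x hx 0
    have w1 : u 1 2 (z 1 (x 1)) + 1 / 2 = x 1 := R.right_inv x hx 1
    simp only [Matrix.cons_val] at q0 q1 q2 q3
    beta_reduce
    rw [c2 _ m2] at q2
    rw [c3 _ m3] at q3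
    rw [← e2 _ m0, ← e3 _ m0, N.eq_half i01 m1, N.eq_half i02 m2, N.eq_half i03 m3] at q0
    rw [N.eq_half i01 m1, ← e4 _ m1, N.eq_half i12 m2, N.eq_half i13 m3] at q1
    rw [← e2 _ m0, N.eq_half i02 m2, N.eq_half i12 m2] at q2
    rw [← e3 _ m0, ← e4 _ m1, N.eq_half i03 m3, N.eq_half i13 m3] at q3
    refine ⟨?_, ?_, ?_, ?_⟩
    · rw [q0]; ring
    · rw [q1, w0]; ring
    · rw [q2, w0, w1]; field_simp
    · rw [q3, w0, w1]; field_simp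

/-- Every factor between {0, 1} and {2, 3} equals 1, and the coordinates absorb the H_i. -/
theorem NormalForm.kindFour (N : NormalForm I p μ u H)
    (i02 : Indep I u 0 2) (i03 : Indep I u 0 3) (i12 : Indep I u 1 2) (i13 : Indep I u 1 3)
    (i20 : Indep I u 2 0) (i21 : Indep I u 2 1) (i30 : Indep I u 3 0) (i31 : Indep I u 3 1) :
    IsLocallyOfListedKind (Set.univ.pi I) μ p := by
  obtain ⟨y0, a0, b0, c0⟩ := N.exists_deriv_sq_eq 0
    (N.smooth_H 0)
    (N.H_pos 0)
  obtain ⟨y1, a1, b1, c1⟩ := N.exists_deriv_sq_eq 1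
    (N.smooth_H 1)
    (N.H_pos 1)
  obtain ⟨y2, a2, b2, c2⟩ := N.exists_deriv_sq_eq 2
    (N.smooth_H 2)
    (N.H_pos 2)
  obtain ⟨y3, a3, b3, c3⟩ := N.exists_deriv_sq_eq 3
    (N.smooth_H 3)
    (N.H_pos 3)
  refine N.isLocallyOfListedKind ![y0, y1, y2, y3] (forall_fin_four a0 a1 a2 a3)
    (forall_fin_four b0 b1 b2 b3) fun z W' μ' R => .inr <| .inr <| .inr <| .inl ⟨fun s => u 0 1 (z 0 s), fun s => u 1 0 (z 1 s),
      fun s => u 2 3 (z 2 s), fun s => u 3 2 (z 3 s),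
      R.smooth_comp 0 _ (N.smooth_u 0 1), R.smooth_comp 1 _ (N.smooth_u 1 0),
      R.smooth_comp 2 _ (N.smooth_u 2 3), R.smooth_comp 3 _ (N.smooth_u 3 2), fun x hx => ?_⟩
  · obtain ⟨q0, q1, q2, q3⟩ := R.sq_eq N hx
    have m0 := R.mem x hx 0
    have m1 := R.mem x hx 1
    have m2 := R.mem x hx 2
    have m3 := R.mem x hx 3
    have p0 := N.H_pos 0 _ m0
    have p1 := N.H_pos 1 _ m1
    have p2 := N.H_pos 2 _ m2
    have p3 := N.H_pos 3 _ m3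
    simp only [Matrix.cons_val] at q0 q1 q2 q3
    beta_reduce
    rw [c0 _ m0] at q0
    rw [c1 _ m1] at q1
    rw [c2 _ m2] at q2
    rw [c3 _ m3] at q3
    rw [N.eq_half i20 m0, N.eq_half i02 m2, N.eq_half i30 m0, N.eq_half i03 m3] at q0
    rw [N.eq_half i21 m1, N.eq_half i12 m2, N.eq_half i31 m1, N.eq_half i13 m3] at q1
    rw [N.eq_half i20 m0, N.eq_half i02 m2, N.eq_half i21 m1, N.eq_half i12 m2] at q2
    rw [N.eq_half i30 m0, N.eq_half i03 m3, N.eq_half i31 m1, N.eq_half i13 m3] at q3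
    refine ⟨?_, ?_, ?_, ?_⟩
    · rw [q0]; field_simp; ring
    · rw [q1]; field_simp; ring
    · rw [q2]; field_simp; ring
    · rw [q3]; field_simp; ring

/-- In the triple attached to 0, 1 and 2, evaluation at p_2 gives X_2 the value 1 - r. Subtracting
it from X_0 and X_1 gives ξ and η, with S_02 = ξ/r and S_12 = -η/(1 - r); the resulting constant
-1/(r(1 - r)) is moved into ψ and φ. -/
theorem NormalForm.kindFive (N : NormalForm I p μ u H)
    (h01 : Dep I u 0 1) (h10 : Dep I u 1 0) (h20 : Dep I u 2 0) (h21 : Dep I u 2 1)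
    (h32 : Dep I u 3 2) (i02 : Indep I u 0 2) (i03 : Indep I u 0 3) (i12 : Indep I u 1 2)
    (i13 : Indep I u 1 3) :
    IsLocallyOfListedKind (Set.univ.pi I) μ p := by
  have e2 : ∀ s ∈ I 0, u 0 2 s = u 0 3 s := fun s hs =>
    N.eq_of_dep (by decide) (by decide) (by decide) i02 h32 hs
  have e3 : ∀ s ∈ I 1, u 1 2 s = u 1 3 s := fun s hs =>
    N.eq_of_dep (by decide) (by decide) (by decide) i12 h32 hs
  obtain ⟨r, hr, hr', -, f0, f1⟩ := N.exists_triple (i := 2) (j := 0) (k := 1) (by decide)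
    (by decide) (by decide) h20 h21 h01 h10
  have g0 : ∀ s ∈ I 0, u 0 2 s + 1 / 2 = (u 0 1 s + 1 / 2 - (1 - r)) / r := fun s hs => by
    have := f0 _ (N.mem 2) s hs
    rw [N.base, add_comm] at this
    rw [this]
    ring
  have g1 : ∀ s ∈ I 1, u 1 2 s + 1 / 2 = -(1 / 2 - u 1 0 s - (1 - r)) / (1 - r) := fun s hs => by
    have := f1 _ (N.mem 2) s hs
    rw [N.base, N.base, add_comm] at this
    rw [this]
    ring
  obtain ⟨y0, a0, b0, c0⟩ := N.exists_deriv_sq_eq 0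
    ((N.smooth_H 0).mul ((N.smooth_add_half 0 2).pow 2))
    (fun s hs => mul_pos (N.H_pos 0 s hs) (pow_pos (N.add_half_pos (by decide) hs) 2))
  obtain ⟨y1, a1, b1, c1⟩ := N.exists_deriv_sq_eq 1
    ((N.smooth_H 1).mul ((N.smooth_add_half 1 2).pow 2))
    (fun s hs => mul_pos (N.H_pos 1 s hs) (pow_pos (N.add_half_pos (by decide) hs) 2))
  obtain ⟨y2, a2, b2, c2⟩ := N.exists_deriv_sq_eq 2
    (N.smooth_H 2)
    (N.H_pos 2)
  obtain ⟨y3, a3, b3, c3⟩ := N.exists_deriv_sq_eq 3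
    (N.smooth_H 3)
    (N.H_pos 3)
  refine N.isLocallyOfListedKind ![y0, y1, y2, y3] (forall_fin_four a0 a1 a2 a3)
    (forall_fin_four b0 b1 b2 b3) fun z W' μ' R => .inr <| .inr <| .inr <| .inr <| .inl ⟨fun s => u 0 1 (z 0 s) + 1 / 2 - (1 - r),
      fun s => 1 / 2 - u 1 0 (z 1 s) - (1 - r), fun s => -u 2 3 (z 2 s) / (r * (1 - r)),
      fun s => -u 3 2 (z 3 s) / (r * (1 - r)),
      R.smooth_comp 0 _ ((N.smooth_add_half 0 1).sub contDiffOn_const),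
      R.smooth_comp 1 _ ((contDiffOn_const.sub (N.smooth_u 1 0)).sub contDiffOn_const),
      R.smooth_comp 2 _ ((N.smooth_u 2 3).neg.div_const _),
      R.smooth_comp 3 _ ((N.smooth_u 3 2).neg.div_const _), fun x hx => ?_, fun x hx => ?_, fun x hx => ?_⟩
  · exact R.deriv_comp_ne_zero N.isOpen b0 ((N.smooth_add_half 0 1).sub contDiffOn_const)
      (fun s hs => by simpa using h10 s hs) hx
  · exact R.deriv_comp_ne_zero N.isOpen b1
      ((contDiffOn_const.sub (N.smooth_u 1 0)).sub contDiffOn_const)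
      (fun s hs => by simpa using h01 s hs) hx
  · obtain ⟨q0, q1, q2, q3⟩ := R.sq_eq N hx
    have m0 := R.mem x hx 0
    have m1 := R.mem x hx 1
    have m2 := R.mem x hx 2
    have m3 := R.mem x hx 3
    have p0 := N.H_pos 0 _ m0
    have p1 := N.H_pos 1 _ m1
    have p2 := N.H_pos 2 _ m2
    have p3 := N.H_pos 3 _ m3
    have s02 := N.add_half_pos (i := 0) (j := 2) (by decide) m0
    have s12 := N.add_half_pos (i := 1) (j := 2) (by decide) m1
    simp only [Matrix.cons_val] at q0 q1 q2 q3
    beta_reduce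
    rw [c0 _ m0] at q0
    rw [c1 _ m1] at q1
    rw [c2 _ m2] at q2
    rw [c3 _ m3] at q3
    rw [← e2 _ m0, N.eq_half i02 m2, N.eq_half i03 m3] at q0
    rw [← e3 _ m1, N.eq_half i12 m2, N.eq_half i13 m3] at q1
    rw [N.eq_half i02 m2, N.eq_half i12 m2, g0 _ m0, g1 _ m1] at q2
    rw [← e2 _ m0, ← e3 _ m1, N.eq_half i03 m3, N.eq_half i13 m3, g0 _ m0, g1 _ m1] at q3
    refine ⟨?_, ?_, ?_, ?_⟩
    · rw [q0]
      generalize u 0 2 (z 0 (x 0)) + 1 / 2 = A at *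
      field_simp
      ring
    · rw [q1]
      generalize u 1 2 (z 1 (x 1)) + 1 / 2 = A at *
      field_simp
      ring
    · rw [q2, div_self p2.ne']
      generalize u 0 1 (z 0 (x 0)) + 1 / 2 - (1 - r) = A
      generalize 1 / 2 - u 1 0 (z 1 (x 1)) - (1 - r) = B
      field_simp
      ring
    · rw [q3, div_self p3.ne']
      generalize u 0 1 (z 0 (x 0)) + 1 / 2 - (1 - r) = A
      generalize 1 / 2 - u 1 0 (z 1 (x 1)) - (1 - r) = B
      field_simp
      ring

/-- The common function S_02 = S_03 of x_0 is taken as the coordinate x_0, so H_0 cannot be absorbed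
and contributes to φ. -/
theorem NormalForm.kindSix (N : NormalForm I p μ u H)
    (h20 : Dep I u 2 0) (h32 : Dep I u 3 2) (i01 : Indep I u 0 1) (i02 : Indep I u 0 2)
    (i03 : Indep I u 0 3) (i12 : Indep I u 1 2) (i13 : Indep I u 1 3) (i21 : Indep I u 2 1)
    (i31 : Indep I u 3 1) :
    IsLocallyOfListedKind (Set.univ.pi I) μ p := by
  have e2 : ∀ s ∈ I 0, u 0 2 s = u 0 3 s := fun s hs =>
    N.eq_of_dep (by decide) (by decide) (by decide) i02 h32 hs
  have a0 : ContDiffOn ℝ ∞ (fun s => u 0 2 s + 1 / 2) (I 0) := N.smooth_add_half 0 2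
  have b0 : ∀ s ∈ I 0, deriv (fun s => u 0 2 s + 1 / 2) s ≠ 0 := fun s hs => by
    simpa using h20 s hs
  obtain ⟨y1, a1, b1, c1⟩ := N.exists_deriv_sq_eq 1
    (N.smooth_H 1)
    (N.H_pos 1)
  obtain ⟨y2, a2, b2, c2⟩ := N.exists_deriv_sq_eq 2
    (N.smooth_H 2)
    (N.H_pos 2)
  obtain ⟨y3, a3, b3, c3⟩ := N.exists_deriv_sq_eq 3
    (N.smooth_H 3)
    (N.H_pos 3)
  refine N.isLocallyOfListedKind ![fun s => u 0 2 s + 1 / 2, y1, y2, y3] (forall_fin_four a0 a1 a2 a3)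
    (forall_fin_four b0 b1 b2 b3) fun z W' μ' R => .inr <| .inr <| .inr <| .inr <| .inr <| .inl ⟨fun s => H 0 (z 0 s) / deriv (fun s => u 0 2 s + 1 / 2) (z 0 s) ^ 2 *
        ((u 0 1 (z 0 s) + 1 / 2) * (u 0 2 (z 0 s) + 1 / 2) ^ 2),
      fun s => u 0 1 (z 0 s) + 1 / 2, fun s => u 2 3 (z 2 s), fun s => u 3 2 (z 3 s),
      R.smooth_comp 0 _ ((N.smooth_div_deriv_sq a0 b0).mul ((N.smooth_add_half 0 1).mul (a0.pow 2))),
      R.smooth_comp 0 _ (N.smooth_add_half 0 1), R.smooth_comp 2 _ (N.smooth_u 2 3),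
      R.smooth_comp 3 _ (N.smooth_u 3 2), fun x hx => ?_, fun x hx => ?_, fun x hx => ?_⟩
  · exact mul_pos (div_pos (N.H_pos 0 _ (R.mem x hx 0)) (sq_pos_of_ne_zero (b0 _ (R.mem x hx 0))))
      (mul_pos (N.add_half_pos (by decide) (R.mem x hx 0))
        (pow_pos (N.add_half_pos (by decide) (R.mem x hx 0)) 2))
  · exact N.add_half_pos (by decide) (R.mem x hx 0)
  · obtain ⟨q0, q1, q2, q3⟩ := R.sq_eq N hx
    have m0 := R.mem x hx 0
    have m1 := R.mem x hx 1
    have m2 := R.mem x hx 2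
    have m3 := R.mem x hx 3
    have p0 := N.H_pos 0 _ m0
    have p1 := N.H_pos 1 _ m1
    have p2 := N.H_pos 2 _ m2
    have p3 := N.H_pos 3 _ m3
    have w0 : u 0 2 (z 0 (x 0)) + 1 / 2 = x 0 := R.right_inv x hx 0
    simp only [Matrix.cons_val] at q0 q1 q2 q3
    beta_reduce
    rw [c1 _ m1] at q1
    rw [c2 _ m2] at q2
    rw [c3 _ m3] at q3
    rw [← e2 _ m0, N.eq_half i01 m1, N.eq_half i02 m2, N.eq_half i03 m3] at q0
    rw [N.eq_half i01 m1, N.eq_half i21 m1, N.eq_half i31 m1, N.eq_half i12 m2, N.eq_half i13 m3] at q1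
    rw [N.eq_half i02 m2, N.eq_half i21 m1, N.eq_half i12 m2] at q2
    rw [← e2 _ m0, N.eq_half i03 m3, N.eq_half i31 m1, N.eq_half i13 m3] at q3
    refine ⟨?_, ?_, ?_, ?_⟩
    · rw [q0]; ring
    · rw [q1, div_self p1.ne']; ring
    · rw [q2, w0]; field_simp; ring
    · rw [q3, w0]; field_simp; ring

/-- Only x_0 enters other coefficients: S_0j is a function of x_0, and the remaining factors are 1.
-/
theorem NormalForm.kindSeven (N : NormalForm I p μ u H)
    (i01 : Indep I u 0 1) (i02 : Indep I u 0 2) (i03 : Indep I u 0 3) (i12 : Indep I u 1 2)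
    (i13 : Indep I u 1 3) (i21 : Indep I u 2 1) (i23 : Indep I u 2 3) (i31 : Indep I u 3 1)
    (i32 : Indep I u 3 2) :
    IsLocallyOfListedKind (Set.univ.pi I) μ p := by
  obtain ⟨y0, a0, b0, c0⟩ := N.exists_deriv_sq_eq 0
    ((N.smooth_H 0).mul (((N.smooth_add_half 0 1).mul (N.smooth_add_half 0 2)).mul
      (N.smooth_add_half 0 3)))
    (fun s hs => mul_pos (N.H_pos 0 s hs) (mul_pos (mul_pos (N.add_half_pos (by decide) hs)
      (N.add_half_pos (by decide) hs)) (N.add_half_pos (by decide) hs)))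
  obtain ⟨y1, a1, b1, c1⟩ := N.exists_deriv_sq_eq 1
    (N.smooth_H 1)
    (N.H_pos 1)
  obtain ⟨y2, a2, b2, c2⟩ := N.exists_deriv_sq_eq 2
    (N.smooth_H 2)
    (N.H_pos 2)
  obtain ⟨y3, a3, b3, c3⟩ := N.exists_deriv_sq_eq 3
    (N.smooth_H 3)
    (N.H_pos 3)
  refine N.isLocallyOfListedKind ![y0, y1, y2, y3] (forall_fin_four a0 a1 a2 a3)
    (forall_fin_four b0 b1 b2 b3) fun z W' μ' R => .inr <| .inr <| .inr <| .inr <| .inr <| .inr <| .inl ⟨fun s => u 0 1 (z 0 s) + 1 / 2,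
      fun s => u 0 2 (z 0 s) + 1 / 2, fun s => u 0 3 (z 0 s) + 1 / 2,
      R.smooth_comp 0 _ (N.smooth_add_half 0 1), R.smooth_comp 0 _ (N.smooth_add_half 0 2),
      R.smooth_comp 0 _ (N.smooth_add_half 0 3), fun x hx => ?_⟩
  · obtain ⟨q0, q1, q2, q3⟩ := R.sq_eq N hx
    have m0 := R.mem x hx 0
    have m1 := R.mem x hx 1
    have m2 := R.mem x hx 2
    have m3 := R.mem x hx 3
    have p0 := N.H_pos 0 _ m0
    have p1 := N.H_pos 1 _ m1
    have p2 := N.H_pos 2 _ m2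
    have p3 := N.H_pos 3 _ m3
    have s01 := N.add_half_pos (i := 0) (j := 1) (by decide) m0
    have s02 := N.add_half_pos (i := 0) (j := 2) (by decide) m0
    have s03 := N.add_half_pos (i := 0) (j := 3) (by decide) m0
    simp only [Matrix.cons_val] at q0 q1 q2 q3
    beta_reduce
    rw [c0 _ m0] at q0
    rw [c1 _ m1] at q1
    rw [c2 _ m2] at q2
    rw [c3 _ m3] at q3
    rw [N.eq_half i01 m1, N.eq_half i02 m2, N.eq_half i03 m3] at q0
    rw [N.eq_half i01 m1, N.eq_half i21 m1, N.eq_half i31 m1, N.eq_half i12 m2, N.eq_half i13 m3] at q1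
    rw [N.eq_half i02 m2, N.eq_half i21 m1, N.eq_half i12 m2, N.eq_half i32 m2, N.eq_half i23 m3] at q2
    rw [N.eq_half i03 m3, N.eq_half i31 m1, N.eq_half i13 m3, N.eq_half i32 m2, N.eq_half i23 m3] at q3
    generalize u 0 1 (z 0 (x 0)) + 1 / 2 = A at *
    generalize u 0 2 (z 0 (x 0)) + 1 / 2 = B at *
    generalize u 0 3 (z 0 (x 0)) + 1 / 2 = C at *
    refine ⟨?_, ?_, ?_, ?_⟩
    · rw [q0]; field_simp
    · rw [q1]; field_simp; ring
    · rw [q2]; field_simp; ring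
    · rw [q3]; field_simp; ring

/-- Two triples share the pair 0, 1 and hence the same X_0 and X_1; `NormalForm.exists_quadruple`
settles the last factor S_23. The functions X_i are the coordinates, and the absolute values of the
constants go into the φ_i. -/
theorem NormalForm.kindEight (N : NormalForm I p μ u H)
    (h01 : Dep I u 0 1) (h02 : Dep I u 0 2) (h03 : Dep I u 0 3) (h10 : Dep I u 1 0)
    (h20 : Dep I u 2 0) (h21 : Dep I u 2 1) (h30 : Dep I u 3 0) (h31 : Dep I u 3 1) (h32 : Dep I u 3 2) :
    IsLocallyOfListedKind (Set.univ.pi I) μ p := by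
  obtain ⟨r, hr, hr', hj, f0, f1⟩ := N.exists_triple (i := 2) (j := 0) (k := 1)
    (by decide) (by decide) (by decide) h20 h21 h01 h10
  obtain ⟨q, hq, hq', hj', g0, g1⟩ := N.exists_triple (i := 3) (j := 0) (k := 1)
    (by decide) (by decide) (by decide) h30 h31 h01 h10
  obtain ⟨c, hc, f23⟩ := N.exists_quadruple (i := 2) (j := 0) (k := 1) (l := 3) (by decide)
    (by decide) (by decide) h32 h30 h20 h02 hr hj hj'
  obtain ⟨y0, e0, a0, b0⟩ : ∃ y : ℝ → ℝ, (∀ s, y s = u 0 1 s + 1 / 2) ∧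
      ContDiffOn ℝ ∞ y (I 0) ∧ ∀ s ∈ I 0, deriv y s ≠ 0 :=
    ⟨_, fun _ => rfl, N.smooth_add_half 0 1,
      fun s hs => by simpa using h10 s hs⟩
  obtain ⟨y1, e1, a1, b1⟩ : ∃ y : ℝ → ℝ, (∀ s, y s = 1 / 2 - u 1 0 s) ∧
      ContDiffOn ℝ ∞ y (I 1) ∧ ∀ s ∈ I 1, deriv y s ≠ 0 :=
    ⟨_, fun _ => rfl, contDiffOn_const.sub (N.smooth_u 1 0),
      fun s hs => by simpa using h01 s hs⟩
  obtain ⟨y2, e2, a2, b2⟩ : ∃ y : ℝ → ℝ, (∀ s, y s = 1 - r * (u 2 0 s + 1 / 2)) ∧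
      ContDiffOn ℝ ∞ y (I 2) ∧ ∀ s ∈ I 2, deriv y s ≠ 0 :=
    ⟨_, fun _ => rfl, contDiffOn_const.sub (contDiffOn_const.mul (N.smooth_add_half 2 0)),
      fun s hs => by simpa using And.intro hr (h02 s hs)⟩
  obtain ⟨y3, e3, a3, b3⟩ : ∃ y : ℝ → ℝ, (∀ s, y s = 1 - q * (u 3 0 s + 1 / 2)) ∧
      ContDiffOn ℝ ∞ y (I 3) ∧ ∀ s ∈ I 3, deriv y s ≠ 0 :=
    ⟨_, fun _ => rfl, contDiffOn_const.sub (contDiffOn_const.mul (N.smooth_add_half 3 0)),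
      fun s hs => by simpa using And.intro hq (h03 s hs)⟩
  have S01 : ∀ s ∈ I 0, ∀ t ∈ I 1, u 0 1 s + u 1 0 t = y0 s - y1 t := by
    intro s hs t ht
    rw [e0, e1]; ring
  have S02 : ∀ s ∈ I 0, ∀ t ∈ I 2, u 0 2 s + u 2 0 t = (y0 s - y2 t) / r := by
    intro s hs t ht
    rw [add_comm, f0 t ht s hs, e0, e2]
  have S12 : ∀ s ∈ I 1, ∀ t ∈ I 2, u 1 2 s + u 2 1 t = (y2 t - y1 s) / (1 - r) := by
    intro s hs t ht
    rw [add_comm, f1 t ht s hs, e1, e2]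
  have S03 : ∀ s ∈ I 0, ∀ t ∈ I 3, u 0 3 s + u 3 0 t = (y0 s - y3 t) / q := by
    intro s hs t ht
    rw [add_comm, g0 t ht s hs, e0, e3]
  have S13 : ∀ s ∈ I 1, ∀ t ∈ I 3, u 1 3 s + u 3 1 t = (y3 t - y1 s) / (1 - q) := by
    intro s hs t ht
    rw [add_comm, g1 t ht s hs, e1, e3]
  have S23 : ∀ s ∈ I 2, ∀ t ∈ I 3, u 2 3 s + u 3 2 t = (y2 s - y3 t) / c := by
    intro s hs t ht
    rw [f23 s hs t ht, e2, e3]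
  refine N.isLocallyOfListedKind ![y0, y1, y2, y3] (forall_fin_four a0 a1 a2 a3)
    (forall_fin_four b0 b1 b2 b3) fun z W' μ' R => .inr <| .inr <| .inr <| .inr <| .inr <| .inr <| .inr <| .inl ⟨![fun s => H 0 (z 0 s) / deriv y0 (z 0 s) ^ 2 / |r * q|,
      fun s => H 1 (z 1 s) / deriv y1 (z 1 s) ^ 2 / |(1 - r) * (1 - q)|,
      fun s => H 2 (z 2 s) / deriv y2 (z 2 s) ^ 2 / |r * (1 - r) * c|,
      fun s => H 3 (z 3 s) / deriv y3 (z 3 s) ^ 2 / |q * (1 - q) * c|],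
      forall_fin_four (R.smooth_comp 0 _ ((N.smooth_div_deriv_sq a0 b0).div_const _))
      (R.smooth_comp 1 _ ((N.smooth_div_deriv_sq a1 b1).div_const _))
      (R.smooth_comp 2 _ ((N.smooth_div_deriv_sq a2 b2).div_const _))
      (R.smooth_comp 3 _ ((N.smooth_div_deriv_sq a3 b3).div_const _)), fun x hx => ?_⟩
  · obtain ⟨q0, q1, q2, q3⟩ := R.sq_eq N hx
    have m0 := R.mem x hx 0
    have m1 := R.mem x hx 1
    have m2 := R.mem x hx 2
    have m3 := R.mem x hx 3
    have p0 := N.H_pos 0 _ m0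
    have p1 := N.H_pos 1 _ m1
    have p2 := N.H_pos 2 _ m2
    have p3 := N.H_pos 3 _ m3
    have w0 : y0 (z 0 (x 0)) = x 0 := R.right_inv x hx 0
    have w1 : y1 (z 1 (x 1)) = x 1 := R.right_inv x hx 1
    have w2 : y2 (z 2 (x 2)) = x 2 := R.right_inv x hx 2
    have w3 : y3 (z 3 (x 3)) = x 3 := R.right_inv x hx 3
    have k0 : 0 < H 0 (z 0 (x 0)) / deriv y0 (z 0 (x 0)) ^ 2 :=
      div_pos p0 (sq_pos_of_ne_zero (b0 _ m0))
    have k1 : 0 < H 1 (z 1 (x 1)) / deriv y1 (z 1 (x 1)) ^ 2 :=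
      div_pos p1 (sq_pos_of_ne_zero (b1 _ m1))
    have k2 : 0 < H 2 (z 2 (x 2)) / deriv y2 (z 2 (x 2)) ^ 2 :=
      div_pos p2 (sq_pos_of_ne_zero (b2 _ m2))
    have k3 : 0 < H 3 (z 3 (x 3)) / deriv y3 (z 3 (x 3)) ^ 2 :=
      div_pos p3 (sq_pos_of_ne_zero (b3 _ m3))
    simp only [Matrix.cons_val] at q0 q1 q2 q3
    rw [S01 _ m0 _ m1, S02 _ m0 _ m2, S03 _ m0 _ m3, w0, w1, w2, w3] at q0
    rw [S01 _ m0 _ m1, S12 _ m1 _ m2, S13 _ m1 _ m3, w0, w1, w2, w3] at q1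
    rw [S02 _ m0 _ m2, S12 _ m1 _ m2, S23 _ m2 _ m3, w0, w1, w2, w3] at q2
    rw [S03 _ m0 _ m3, S13 _ m1 _ m3, S23 _ m2 _ m3, w0, w1, w2, w3] at q3
    refine forall_fin_four ?_ ?_ ?_ ?_
    · rw [(prod_erase_fin_four _).1, ← abs_of_nonneg (sq_nonneg (μ' 0 x)), q0]
      simp only [abs_mul, abs_div, abs_of_pos k0, abs_sub_comm (x 0), Matrix.cons_val]
      field_simp
    · rw [(prod_erase_fin_four _).2.1, ← abs_of_nonneg (sq_nonneg (μ' 1 x)), q1]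
      simp only [abs_mul, abs_div, abs_of_pos k1, abs_sub_comm (x 1), Matrix.cons_val]
      field_simp
    · rw [(prod_erase_fin_four _).2.2.1, ← abs_of_nonneg (sq_nonneg (μ' 2 x)), q2]
      simp only [abs_mul, abs_div, abs_of_pos k2, abs_sub_comm (x 2), Matrix.cons_val]
      field_simp
    · rw [(prod_erase_fin_four _).2.2.2, ← abs_of_nonneg (sq_nonneg (μ' 3 x)), q3]
      simp only [abs_mul, abs_div, abs_of_pos k3, abs_sub_comm (x 3), Matrix.cons_val]
      field_simp

/-- As for four mutually dependent indices, except that x_0 enters no other coefficient and X_0 is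
the constant 1 - q. Shifting by it makes S_0j a multiple of the coordinate x_j. -/
theorem NormalForm.kindNine (N : NormalForm I p μ u H)
    (h01 : Dep I u 0 1) (h02 : Dep I u 0 2) (h03 : Dep I u 0 3) (h12 : Dep I u 1 2)
    (h13 : Dep I u 1 3) (h21 : Dep I u 2 1) (h31 : Dep I u 3 1)
    (h32 : Dep I u 3 2) (i10 : Indep I u 1 0) (i20 : Indep I u 2 0) (i30 : Indep I u 3 0) :
    IsLocallyOfListedKind (Set.univ.pi I) μ p := by
  obtain ⟨r, hr, hr', hj, f1, f2⟩ := N.exists_triple (i := 3) (j := 1) (k := 2)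
    (by decide) (by decide) (by decide) h31 h32 h12 h21
  obtain ⟨q, hq, hq', hj', g1, g2⟩ := N.exists_triple (i := 0) (j := 1) (k := 2)
    (by decide) (by decide) (by decide) h01 h02 h12 h21
  obtain ⟨c, hc, f30⟩ := N.exists_quadruple (i := 3) (j := 1) (k := 2) (l := 0) (by decide)
    (by decide) (by decide) h03 h01 h31 h13 hr hj hj'
  -- Kind `KindNine` prescribes μ_0² = x_1 x_2 x_3 without absolute values. Reversing all three
  -- coordinates at once corrects the sign of this product and preserves the absolute differences.
  obtain ⟨ε, hε, hK⟩ : ∃ ε : ℝ, (ε = 1 ∨ ε = -1) ∧ 0 < ε * -(q * (1 - q) * c) := by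
    rcases lt_or_gt_of_ne (mul_ne_zero (mul_ne_zero hq hq') hc) with h | h
    · exact ⟨1, .inl rfl, by linarith⟩
    · exact ⟨-1, .inr rfl, by linarith⟩
  have hε0 : ε ≠ 0 := by rcases hε with rfl | rfl <;> norm_num
  have hε2 : ε * ε = 1 := by rcases hε with rfl | rfl <;> norm_num
  have hεabs : |ε| = 1 := by rcases hε with rfl | rfl <;> norm_num
  obtain ⟨y1, e1, a1, b1⟩ : ∃ y : ℝ → ℝ, (∀ s, y s = ε * (u 1 2 s + 1 / 2 - (1 - q))) ∧
      ContDiffOn ℝ ∞ y (I 1) ∧ ∀ s ∈ I 1, deriv y s ≠ 0 :=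
    ⟨_, fun _ => rfl, contDiffOn_const.mul ((N.smooth_add_half 1 2).sub contDiffOn_const),
      fun s hs => by simpa using And.intro hε0 (h21 s hs)⟩
  obtain ⟨y2, e2, a2, b2⟩ : ∃ y : ℝ → ℝ, (∀ s, y s = ε * (1 / 2 - u 2 1 s - (1 - q))) ∧
      ContDiffOn ℝ ∞ y (I 2) ∧ ∀ s ∈ I 2, deriv y s ≠ 0 :=
    ⟨_, fun _ => rfl, contDiffOn_const.mul ((contDiffOn_const.sub (N.smooth_u 2 1)).sub contDiffOn_const),
      fun s hs => by simpa using And.intro hε0 (h12 s hs)⟩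
  obtain ⟨y3, e3, a3, b3⟩ : ∃ y : ℝ → ℝ, (∀ s, y s = ε * (1 - r * (u 3 1 s + 1 / 2) - (1 - q))) ∧
      ContDiffOn ℝ ∞ y (I 3) ∧ ∀ s ∈ I 3, deriv y s ≠ 0 :=
    ⟨_, fun _ => rfl, contDiffOn_const.mul ((contDiffOn_const.sub (contDiffOn_const.mul (N.smooth_add_half 3 1))).sub contDiffOn_const),
      fun s hs => by simpa using And.intro hε0 (And.intro hr (h13 s hs))⟩
  have A1 : ∀ s ∈ I 1, u 1 0 s + 1 / 2 = ε * y1 s / q := fun s hs => by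
    have := g1 _ (N.mem 0) s hs
    rw [N.base, add_comm] at this
    rw [this, e1, ← mul_assoc, hε2]
    ring
  have A2 : ∀ s ∈ I 2, u 2 0 s + 1 / 2 = -(ε * y2 s / (1 - q)) := fun s hs => by
    have := g2 _ (N.mem 0) s hs
    rw [N.base, N.base, add_comm] at this
    rw [this, e2, ← mul_assoc, hε2]
    ring
  have A3 : ∀ s ∈ I 3, u 3 0 s + 1 / 2 = ε * y3 s / c := fun s hs => by
    have := f30 s hs _ (N.mem 0)
    rw [N.base, N.base] at this
    rw [this, e3, ← mul_assoc, hε2]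
    ring
  have S01 : ∀ s ∈ I 0, ∀ t ∈ I 1, u 0 1 s + u 1 0 t = u 1 0 t + 1 / 2 := by
    intro s hs t ht
    rw [N.eq_half i10 hs, add_comm]
  have S02 : ∀ s ∈ I 0, ∀ t ∈ I 2, u 0 2 s + u 2 0 t = u 2 0 t + 1 / 2 := by
    intro s hs t ht
    rw [N.eq_half i20 hs, add_comm]
  have S03 : ∀ s ∈ I 0, ∀ t ∈ I 3, u 0 3 s + u 3 0 t = u 3 0 t + 1 / 2 := by
    intro s hs t ht
    rw [N.eq_half i30 hs, add_comm]
  have S12 : ∀ s ∈ I 1, ∀ t ∈ I 2, u 1 2 s + u 2 1 t = ε * (y1 s - y2 t) := by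
    intro s hs t ht
    rw [e1, e2]; linear_combination (-(u 1 2 s + u 2 1 t)) * hε2
  have S13 : ∀ s ∈ I 1, ∀ t ∈ I 3, u 1 3 s + u 3 1 t = ε * (y1 s - y3 t) / r := by
    intro s hs t ht
    rw [add_comm, f1 t ht s hs, e1, e3, ← mul_sub, ← mul_assoc, hε2]; ring
  have S23 : ∀ s ∈ I 2, ∀ t ∈ I 3, u 2 3 s + u 3 2 t = ε * (y3 t - y2 s) / (1 - r) := by
    intro s hs t ht
    rw [add_comm, f2 t ht s hs, e2, e3, ← mul_sub, ← mul_assoc, hε2]; ring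
  obtain ⟨y0, a0, b0, c0⟩ := N.exists_deriv_sq_eq 0
    ((N.smooth_H 0).div_const (ε * -(q * (1 - q) * c)))
    (fun s hs => div_pos (N.H_pos 0 s hs) hK)
  refine N.isLocallyOfListedKind ![y0, y1, y2, y3] (forall_fin_four a0 a1 a2 a3)
    (forall_fin_four b0 b1 b2 b3) fun z W' μ' R => .inr <| .inr <| .inr <| .inr <| .inr <| .inr <| .inr <| .inr <| .inl ⟨fun s => H 1 (z 1 s) / deriv y1 (z 1 s) ^ 2 * (u 1 0 (z 1 s) + 1 / 2) / |r|,
      fun s => H 2 (z 2 s) / deriv y2 (z 2 s) ^ 2 * (u 2 0 (z 2 s) + 1 / 2) / |1 - r|,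
      fun s => H 3 (z 3 s) / deriv y3 (z 3 s) ^ 2 * (u 3 0 (z 3 s) + 1 / 2) / |r * (1 - r)|,
      R.smooth_comp 1 _ (((N.smooth_div_deriv_sq a1 b1).mul
        (N.smooth_add_half 1 0)).div_const _),
      R.smooth_comp 2 _ (((N.smooth_div_deriv_sq a2 b2).mul
        (N.smooth_add_half 2 0)).div_const _),
      R.smooth_comp 3 _ (((N.smooth_div_deriv_sq a3 b3).mul
        (N.smooth_add_half 3 0)).div_const _), fun x hx => ?_⟩
  · obtain ⟨q0, q1, q2, q3⟩ := R.sq_eq N hx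
    have m0 := R.mem x hx 0
    have m1 := R.mem x hx 1
    have m2 := R.mem x hx 2
    have m3 := R.mem x hx 3
    have p0 := N.H_pos 0 _ m0
    have p1 := N.H_pos 1 _ m1
    have p2 := N.H_pos 2 _ m2
    have p3 := N.H_pos 3 _ m3
    have s10 := N.add_half_pos (i := 1) (j := 0) (by decide) m1
    have s20 := N.add_half_pos (i := 2) (j := 0) (by decide) m2
    have s30 := N.add_half_pos (i := 3) (j := 0) (by decide) m3
    have w1 : y1 (z 1 (x 1)) = x 1 := R.right_inv x hx 1
    have w2 : y2 (z 2 (x 2)) = x 2 := R.right_inv x hx 2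
    have w3 : y3 (z 3 (x 3)) = x 3 := R.right_inv x hx 3
    have k1 : 0 < H 1 (z 1 (x 1)) / deriv y1 (z 1 (x 1)) ^ 2 :=
      div_pos p1 (sq_pos_of_ne_zero (b1 _ m1))
    have k2 : 0 < H 2 (z 2 (x 2)) / deriv y2 (z 2 (x 2)) ^ 2 :=
      div_pos p2 (sq_pos_of_ne_zero (b2 _ m2))
    have k3 : 0 < H 3 (z 3 (x 3)) / deriv y3 (z 3 (x 3)) ^ 2 :=
      div_pos p3 (sq_pos_of_ne_zero (b3 _ m3))
    simp only [Matrix.cons_val] at q0 q1 q2 q3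
    beta_reduce
    rw [c0 _ m0] at q0
    rw [S01 _ m0 _ m1, S02 _ m0 _ m2, S03 _ m0 _ m3, A1 _ m1, A2 _ m2, A3 _ m3, w1, w2, w3] at q0
    rw [S01 _ m0 _ m1, S12 _ m1 _ m2, S13 _ m1 _ m3, w1, w2, w3] at q1
    rw [S02 _ m0 _ m2, S12 _ m1 _ m2, S23 _ m2 _ m3, w1, w2, w3] at q2
    rw [S03 _ m0 _ m3, S13 _ m1 _ m3, S23 _ m2 _ m3, w1, w2, w3] at q3
    refine ⟨?_, ?_, ?_, ?_⟩
    · rw [q0]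
      field_simp
      linear_combination (x 1 * x 2 * x 3) * (ε * ε + 1) * hε2
    · rw [← abs_of_nonneg (sq_nonneg (μ' 1 x)), q1]
      simp only [abs_mul, abs_div, abs_of_pos k1, abs_of_pos s10, hεabs, abs_sub_comm (x 1)]
      generalize u 1 0 (z 1 (x 1)) + 1 / 2 = A
      field_simp
    · rw [← abs_of_nonneg (sq_nonneg (μ' 2 x)), q2]
      simp only [abs_mul, abs_div, abs_of_pos k2, abs_of_pos s20, hεabs, abs_sub_comm (x 2)]
      generalize u 2 0 (z 2 (x 2)) + 1 / 2 = A
      field_simp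
    · rw [← abs_of_nonneg (sq_nonneg (μ' 3 x)), q3]
      simp only [abs_mul, abs_div, abs_of_pos k3, abs_of_pos s30, hεabs, abs_sub_comm (x 3)]
      generalize u 3 0 (z 3 (x 3)) + 1 / 2 = A
      field_simp

/-- The indices 0 and 1 each form a triple with 2, 3, in which X_0 and X_1 are the constants 1 - r
and 1 - q. Shifting by the latter puts index 1 at 0 and index 0 at b = q - r. -/
theorem NormalForm.kindTen (N : NormalForm I p μ u H)
    (h02 : Dep I u 0 2) (h03 : Dep I u 0 3) (h12 : Dep I u 1 2) (h13 : Dep I u 1 3)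
    (h23 : Dep I u 2 3) (h32 : Dep I u 3 2) (i01 : Indep I u 0 1) (i10 : Indep I u 1 0)
    (i20 : Indep I u 2 0) (i21 : Indep I u 2 1) (i30 : Indep I u 3 0) (i31 : Indep I u 3 1) :
    IsLocallyOfListedKind (Set.univ.pi I) μ p := by
  obtain ⟨r, hr, hr', -, f2, f3⟩ := N.exists_triple (i := 0) (j := 2) (k := 3)
    (by decide) (by decide) (by decide) h02 h03 h23 h32
  obtain ⟨q, hq, hq', -, g2, g3⟩ := N.exists_triple (i := 1) (j := 2) (k := 3)
    (by decide) (by decide) (by decide) h12 h13 h23 h32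
  obtain ⟨y2, e2, a2, b2⟩ : ∃ y : ℝ → ℝ, (∀ s, y s = u 2 3 s + 1 / 2 - (1 - q)) ∧
      ContDiffOn ℝ ∞ y (I 2) ∧ ∀ s ∈ I 2, deriv y s ≠ 0 :=
    ⟨_, fun _ => rfl, (N.smooth_add_half 2 3).sub contDiffOn_const,
      fun s hs => by simpa using h32 s hs⟩
  obtain ⟨y3, e3, a3, b3⟩ : ∃ y : ℝ → ℝ, (∀ s, y s = 1 / 2 - u 3 2 s - (1 - q)) ∧
      ContDiffOn ℝ ∞ y (I 3) ∧ ∀ s ∈ I 3, deriv y s ≠ 0 :=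
    ⟨_, fun _ => rfl, (contDiffOn_const.sub (N.smooth_u 3 2)).sub contDiffOn_const,
      fun s hs => by simpa using h23 s hs⟩
  have S02 : ∀ s ∈ I 0, ∀ t ∈ I 2, u 0 2 s + u 2 0 t = (y2 t - (q - r)) / r := by
    intro s hs t ht
    rw [f2 s hs t ht, N.eq_half i20 hs, e2]; ring
  have S03 : ∀ s ∈ I 0, ∀ t ∈ I 3, u 0 3 s + u 3 0 t = -((y3 t - (q - r)) / (1 - r)) := by
    intro s hs t ht
    rw [f3 s hs t ht, N.eq_half i20 hs, e3]; ring
  have S12 : ∀ s ∈ I 1, ∀ t ∈ I 2, u 1 2 s + u 2 1 t = y2 t / q := by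
    intro s hs t ht
    rw [g2 s hs t ht, N.eq_half i21 hs, e2]; ring
  have S13 : ∀ s ∈ I 1, ∀ t ∈ I 3, u 1 3 s + u 3 1 t = -(y3 t / (1 - q)) := by
    intro s hs t ht
    rw [g3 s hs t ht, N.eq_half i21 hs, e3]; ring
  have S23 : ∀ s ∈ I 2, ∀ t ∈ I 3, u 2 3 s + u 3 2 t = y2 s - y3 t := by
    intro s hs t ht
    rw [e2, e3]; ring
  have T02 : ∀ s ∈ I 0, ∀ t ∈ I 2, u 0 2 s + u 2 0 t = u 2 0 t + 1 / 2 := by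
    intro s hs t ht
    rw [N.eq_half i20 hs, add_comm]
  have T03 : ∀ s ∈ I 0, ∀ t ∈ I 3, u 0 3 s + u 3 0 t = u 3 0 t + 1 / 2 := by
    intro s hs t ht
    rw [N.eq_half i30 hs, add_comm]
  have T12 : ∀ s ∈ I 1, ∀ t ∈ I 2, u 1 2 s + u 2 1 t = u 2 1 t + 1 / 2 := by
    intro s hs t ht
    rw [N.eq_half i21 hs, add_comm]
  have T13 : ∀ s ∈ I 1, ∀ t ∈ I 3, u 1 3 s + u 3 1 t = u 3 1 t + 1 / 2 := by
    intro s hs t ht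
    rw [N.eq_half i31 hs, add_comm]
  obtain ⟨y0, a0, b0, c0⟩ := N.exists_deriv_sq_eq 0
    ((N.smooth_H 0).div_const |r * (1 - r)|)
    (fun s hs => div_pos (N.H_pos 0 s hs) (abs_pos.2 (mul_ne_zero hr hr')))
  obtain ⟨y1, a1, b1, c1⟩ := N.exists_deriv_sq_eq 1
    ((N.smooth_H 1).div_const |q * (1 - q)|)
    (fun s hs => div_pos (N.H_pos 1 s hs) (abs_pos.2 (mul_ne_zero hq hq')))
  refine N.isLocallyOfListedKind ![y0, y1, y2, y3] (forall_fin_four a0 a1 a2 a3)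
    (forall_fin_four b0 b1 b2 b3) fun z W' μ' R => .inr <| .inr <| .inr <| .inr <| .inr <| .inr <| .inr <| .inr <| .inr <|  ⟨q - r,
      fun s => H 2 (z 2 s) / deriv y2 (z 2 s) ^ 2 * ((u 2 0 (z 2 s) + 1 / 2) * (u 2 1 (z 2 s) + 1 / 2)),
      fun s => H 3 (z 3 s) / deriv y3 (z 3 s) ^ 2 * ((u 3 0 (z 3 s) + 1 / 2) * (u 3 1 (z 3 s) + 1 / 2)),
      R.smooth_comp 2 _ ((N.smooth_div_deriv_sq a2 b2).mul
        ((N.smooth_add_half 2 0).mul (N.smooth_add_half 2 1))),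
      R.smooth_comp 3 _ ((N.smooth_div_deriv_sq a3 b3).mul
        ((N.smooth_add_half 3 0).mul (N.smooth_add_half 3 1))), fun x hx => ?_⟩
  · obtain ⟨q0, q1, q2, q3⟩ := R.sq_eq N hx
    have m0 := R.mem x hx 0
    have m1 := R.mem x hx 1
    have m2 := R.mem x hx 2
    have m3 := R.mem x hx 3
    have p0 := N.H_pos 0 _ m0
    have p1 := N.H_pos 1 _ m1
    have p2 := N.H_pos 2 _ m2
    have p3 := N.H_pos 3 _ m3
    have s20 := N.add_half_pos (i := 2) (j := 0) (by decide) m2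
    have s30 := N.add_half_pos (i := 3) (j := 0) (by decide) m3
    have s21 := N.add_half_pos (i := 2) (j := 1) (by decide) m2
    have s31 := N.add_half_pos (i := 3) (j := 1) (by decide) m3
    have w2 : y2 (z 2 (x 2)) = x 2 := R.right_inv x hx 2
    have w3 : y3 (z 3 (x 3)) = x 3 := R.right_inv x hx 3
    have k2 : 0 < H 2 (z 2 (x 2)) / deriv y2 (z 2 (x 2)) ^ 2 :=
      div_pos p2 (sq_pos_of_ne_zero (b2 _ m2))
    have k3 : 0 < H 3 (z 3 (x 3)) / deriv y3 (z 3 (x 3)) ^ 2 :=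
      div_pos p3 (sq_pos_of_ne_zero (b3 _ m3))
    simp only [Matrix.cons_val] at q0 q1 q2 q3
    beta_reduce
    rw [c0 _ m0] at q0
    rw [c1 _ m1] at q1
    rw [N.eq_half i10 m0, N.eq_half i01 m1, S02 _ m0 _ m2, S03 _ m0 _ m3, w2, w3] at q0
    rw [N.eq_half i10 m0, N.eq_half i01 m1, S12 _ m1 _ m2, S13 _ m1 _ m3, w2, w3] at q1
    rw [T02 _ m0 _ m2, T12 _ m1 _ m2, S23 _ m2 _ m3, w2, w3] at q2
    rw [T03 _ m0 _ m3, T13 _ m1 _ m3, S23 _ m2 _ m3, w2, w3] at q3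
    refine ⟨?_, ?_, ?_, ?_⟩
    · rw [← abs_of_nonneg (sq_nonneg (μ' 0 x)), q0, add_halves, one_mul]
      simp only [abs_mul, abs_div, abs_abs, abs_neg, abs_of_pos p0]
      field_simp
    · rw [← abs_of_nonneg (sq_nonneg (μ' 1 x)), q1, add_halves, one_mul]
      simp only [abs_mul, abs_div, abs_abs, abs_neg, abs_of_pos p1]
      field_simp
    · rw [← abs_of_nonneg (sq_nonneg (μ' 2 x)), q2]
      simp only [abs_mul, abs_of_pos k2, abs_of_pos s20, abs_of_pos s21, abs_sub_comm (x 2)]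
      ring
    · rw [← abs_of_nonneg (sq_nonneg (μ' 3 x)), q3]
      simp only [abs_mul, abs_of_pos k3, abs_of_pos s30, abs_of_pos s31, abs_sub_comm (x 3)]
      ring

end Patterns

/-! ### Generic points and the conclusion. -/

/-- Finitely many continuous functions are each identically zero or nowhere zero on some open
subset of a given nonempty open set. -/
theorem exists_open_subset_forall_zero_or_ne {X ι : Type*} [TopologicalSpace X] {U : Set X}
    {f : ι → X → ℝ} (hf : ∀ a, ContinuousOn (f a) U) (s : Finset ι) {O : Set X} (hO : IsOpen O)
    (hne : O.Nonempty) (hOU : O ⊆ U) :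
    ∃ O' ⊆ O, IsOpen O' ∧ O'.Nonempty ∧
      ∀ a ∈ s, (∀ x ∈ O', f a x = 0) ∨ ∀ x ∈ O', f a x ≠ 0 := by
  classical
  induction s using Finset.induction_on with
  | empty => exact ⟨O, subset_rfl, hO, hne, by simp⟩
  | insert a s _ ih =>
    obtain ⟨O', hsub, hopen, hne', h⟩ := ih
    by_cases hz : ∀ x ∈ O', f a x = 0
    · refine ⟨O', hsub, hopen, hne', fun b hb => ?_⟩
      rcases Finset.mem_insert.1 hb with rfl | hb
      · exact .inl hz
      · exact h b hb
    · push Not at hz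
      obtain ⟨x, hx, hfx⟩ := hz
      refine ⟨O' ∩ f a ⁻¹' {0}ᶜ, Set.inter_subset_left.trans hsub,
        ((hf a).mono (hsub.trans hOU)).isOpen_inter_preimage hopen isOpen_compl_singleton,
        ⟨x, hx, hfx⟩, fun b hb => ?_⟩
      rcases Finset.mem_insert.1 hb with rfl | hb
      · exact .inr fun y hy => hy.2
      · exact (h b hb).imp (fun h y hy => h y hy.1) fun h y hy => h y hy.1

theorem isForestAt_of_eq {a b c d : ℝ} (h : a * c + b * d = a * b) :
    isForestAt (decide (a ≠ 0)) (decide (b ≠ 0)) (decide (c ≠ 0)) (decide (d ≠ 0)) = true := by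
  by_cases ha : a = 0 <;> by_cases hb : b = 0 <;> by_cases hc : c = 0 <;> by_cases hd : d = 0 <;>
    simp_all [isForestAt]

theorem NormalForm.isLocallyOfListedKind_of_dep {I : Fin 4 → Set ℝ} {p : Fin 4 → ℝ}
    {μ : Fin 4 → (Fin 4 → ℝ) → ℝ} {u : Fin 4 → Fin 4 → ℝ → ℝ} {H : Fin 4 → ℝ → ℝ}
    (N : NormalForm I p μ u H) (hd : ∀ i j, i ≠ j → Dep I u i j ∨ Indep I u i j) :
    IsLocallyOfListedKind (Set.univ.pi I) μ p := by
  obtain ⟨d, hd_def⟩ : ∃ d : Fin 4 → Fin 4 → Bool,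
      ∀ i j, d i j = decide (deriv (u j i) (p j) ≠ 0) := ⟨_, fun _ _ => rfl⟩
  -- At p all factors are 1, so compatibility involves only the derivatives there; by the dichotomy
  -- their vanishing at p decides between dependence and independence on the whole side.
  obtain ⟨e, he⟩ := exists_listedPattern_of_forest (d := d) (fun i j k hij hik hjk => by
    have := N.compat i j k hij hik hjk _ (N.mem i) _ (N.mem j) _ (N.mem k)
    simp only [N.base, add_halves, mul_one] at this
    simpa only [hd_def] using isForestAt_of_eq this)
  have hD : ∀ i j, i ≠ j → d (e i) (e j) = true →
      Dep (fun i => I (e i)) (fun i j => u (e i) (e j)) i j := fun i j hij h =>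
    (hd (e i) (e j) (e.injective.ne hij)).resolve_right fun h' =>
      of_decide_eq_true ((hd_def _ _).symm.trans h) (h' _ (N.mem _))
  have hN : ∀ i j, i ≠ j → d (e i) (e j) = false →
      Indep (fun i => I (e i)) (fun i j => u (e i) (e j)) i j := fun i j hij h =>
    (hd (e i) (e j) (e.injective.ne hij)).resolve_left fun h' =>
      of_decide_eq_false ((hd_def _ _).symm.trans h) (h' _ (N.mem _))
  refine IsLocallyOfListedKind.of_relabel (U' := Set.univ.pi fun i => I (e i)) e
    (fun x hx k _ => by simpa using hx (e.symm k) trivial) ?_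
  have N' := N.relabel e
  simp only [isListedPattern, Bool.or_eq_true, Bool.and_eq_true, Bool.not_eq_true', and_assoc]
    at he
  rcases he with h | h | h | h | h | h | h | h | h | h
  · apply N'.kindOne <;>
      first
        | exact hD _ _ (by decide) (by simp only [h])
        | exact hN _ _ (by decide) (by simp only [h])
  · apply N'.kindTwo <;>
      first
        | exact hD _ _ (by decide) (by simp only [h])
        | exact hN _ _ (by decide) (by simp only [h])
  · apply N'.kindThree <;>
      first
        | exact hD _ _ (by decide) (by simp only [h])
        | exact hN _ _ (by decide) (by simp only [h])
  · apply N'.kindFour <;> exact hN _ _ (by decide) (by simp only [h])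
  · apply N'.kindFive <;>
      first
        | exact hD _ _ (by decide) (by simp only [h])
        | exact hN _ _ (by decide) (by simp only [h])
  · apply N'.kindSix <;>
      first
        | exact hD _ _ (by decide) (by simp only [h])
        | exact hN _ _ (by decide) (by simp only [h])
  · apply N'.kindSeven <;> exact hN _ _ (by decide) (by simp only [h])
  · apply N'.kindEight <;> exact hD _ _ (by decide) (by simp only [h])
  · apply N'.kindNine <;>
      first
        | exact hD _ _ (by decide) (by simp only [h])
        | exact hN _ _ (by decide) (by simp only [h])
  · apply N'.kindTen <;>
      first
        | exact hD _ _ (by decide) (by simp only [h])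
        | exact hN _ _ (by decide) (by simp only [h])

theorem IsLocallyOfListedKind.mono {U U' : Set (Fin 4 → ℝ)} {μ : Fin 4 → (Fin 4 → ℝ) → ℝ}
    {p : Fin 4 → ℝ} (h : IsLocallyOfListedKind U' μ p) (hU : U' ⊆ U) :
    IsLocallyOfListedKind U μ p := by
  obtain ⟨W, hW, hp, hWU, h⟩ := h
  exact ⟨W, hW, hp, hWU.trans hU, h⟩

/-- Since ν_{i,j} = u_ji'/(2 S_ij) with S_ij nonzero, the dichotomy for ν_{i,j} passes to u_ji'. -/
theorem StackelSystem.isLocallyOfListedKind {U : Set (Fin 4 → ℝ)} (hU : IsOpen U)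
    {μ : Fin 4 → (Fin 4 → ℝ) → ℝ} (hμ : IsDiagonalMetric U μ) (h : StackelSystem U μ)
    {p : Fin 4 → ℝ} (hp : p ∈ U)
    (hd : ∀ i j, (∀ x ∈ U, pderiv j (logCoeff μ i) x = 0) ∨
      ∀ x ∈ U, pderiv j (logCoeff μ i) x ≠ 0) : IsLocallyOfListedKind U μ p := by
  obtain ⟨ε, hε, hball⟩ := Metric.isOpen_iff.1 hU p hp
  -- Balls for the supremum metric are boxes, so a box around p lies in U.
  rw [ball_pi p hε] at hball
  obtain ⟨u, H, N⟩ := StackelSystem.exists_normalForm (p := p)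
    (fun i => Metric.isOpen_ball) (fun i => (convex_ball (p i) ε).isPreconnected)
    (fun i => Metric.mem_ball_self hε) (hμ.mono hball) (h.mono hball)
  refine (N.isLocallyOfListedKind_of_dep fun i j hij => ?_).mono hball
  have key : ∀ t ∈ Metric.ball (p j) ε, update p j t ∈ U ∧
      pderiv j (logCoeff μ i) (update p j t)
        = deriv (u j i) t / (2 * sepFactor u i j (update p j t)) ∧
      sepFactor u i j (update p j t) ≠ 0 := by
    intro t ht
    have hx := update_mem_pi (I := fun i => Metric.ball (p i) ε) (fun i _ => N.mem i) ht
    have := N.separable.pderiv_logCoeff N.metric N.isOpen_pi hx hij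
    rw [update_self] at this
    exact ⟨hball hx, this, N.separable.sepFactor_ne_zero N.metric hx hij⟩
  rcases hd i j with h0 | h0
  · refine .inr fun t ht => ?_
    obtain ⟨k1, k2, k3⟩ := key t ht
    have := k2.symm.trans (h0 _ k1)
    simpa [k3] using this
  · refine .inl fun t ht h' => ?_
    obtain ⟨k1, k2, k3⟩ := key t ht
    exact h0 _ k1 (by rw [k2, h', zero_div])

theorem lemmal3 (U : Set (Fin 4 → ℝ)) (hU : IsOpen U)
    (μ : Fin 4 → (Fin 4 → ℝ) → ℝ) (hμ : IsDiagonalMetric U μ) :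
    (IsOfListedKind U μ → StackelSystem U μ) ∧
    (StackelSystem U μ ↔
      ∃ V : Set (Fin 4 → ℝ), IsOpen V ∧ V ⊆ U ∧ U ⊆ closure V ∧
        ∀ p ∈ V, IsLocallyOfListedKind U μ p) := by
  refine ⟨fun h => h.stackelSystem hU hμ, fun h => ?_, fun ⟨V, _, _, hVU, hV⟩ =>
    stackelSystem_of_dense hU hμ hVU fun p hp => (hV p hp).exists_stackelSystem hμ⟩
  have hcont : ∀ a : Fin 4 × Fin 4, ContinuousOn (pderiv a.2 (logCoeff μ a.1)) U := fun a =>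
    (contDiffOn_pderiv hU (contDiffOn_logCoeff hμ a.1) a.2).continuousOn
  -- V is the union of all open subsets of U on which every ν_{i,j} vanishes identically or nowhere.
  -- Such subsets exist inside every nonempty open subset of U, whence density.
  refine ⟨⋃₀ {O | IsOpen O ∧ O ⊆ U ∧ ∀ a : Fin 4 × Fin 4,
    (∀ x ∈ O, pderiv a.2 (logCoeff μ a.1) x = 0) ∨ ∀ x ∈ O, pderiv a.2 (logCoeff μ a.1) x ≠ 0},
    isOpen_sUnion fun O hO => hO.1, Set.sUnion_subset fun O hO => hO.2.1, fun x hx => ?_, ?_⟩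
  · refine mem_closure_iff.2 fun O hO hxO => ?_
    obtain ⟨O', hsub, hopen, ⟨y, hy⟩, h'⟩ := exists_open_subset_forall_zero_or_ne hcont
      Finset.univ (hO.inter hU) ⟨x, hxO, hx⟩ Set.inter_subset_right
    exact ⟨y, (hsub hy).1, O', ⟨hopen, fun z hz => (hsub hz).2,
      fun a => h' a (Finset.mem_univ a)⟩, hy⟩
  · rintro p ⟨O, ⟨hO, hOU, hd⟩, hpO⟩
    exact (StackelSystem.isLocallyOfListedKind hO (hμ.mono hOU) (h.mono hOU) hpO
      fun i j => hd (i, j)).mono hOU
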